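/- Let $G$ be an $r$-discrete groupoid, i.e. a locally compact Hausdorff topological groupoid whose range and domain maps $r,d:G\to G^0$ are local homeomorphisms. The open $G$-sets (open subsets of $G$ on which $r$ and $d$ are injective) form an inverse semigroup $G^{op}$ under $st=\{xy: x\in s,\ y\in t,\ d(x)=r(y)\}$ and $s^*=\{x^{-1}:x\in s\}$; write $d(s)=s^*s$ and $r(s)=ss^*$. An inverse subsemigroup $S\subset G^{op}$ is \emph{full} if it is a base for the topology of $G$ and every two idempotents of $S$ have a common upper bound among the idempotents of $S$, for the order $s\le t\iff s=ss^*t$; it is \emph{additive} if it is a base for the topology of $G$ and $s\cup t\in S$ whenever $s,t\in S$ and $s\cup t\in G^{op}$. An action of an inverse semigroup $S$ on a $C^*$-algebra $B$ is a homomorphism $\beta$ from $S$ to the semigroup of partial automorphisms of $B$ (isomorphisms between closed ideals of $B$, under composition) whose domain ideals are upward-directed and have dense span. Write $B_e$ for the domain of $\beta_e$, $e$ idempotent. A covariant representation is a pair $(\pi,U)$ consisting of a nondegenerate representation $\pi$ of $B$ and a $^*$-representation $U$ of $S$ on a Hilbert space $H$, the ranges of the $U_s$ having dense span, with $U_eH=\overline{\operatorname{span}}\,\pi(B_e)H$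 for idempotents $e$ and $U_s\pi(b)U_s^*=\pi(\beta_s(b))$ for $b\in B_{d(s)}$. The crossed product $B\times_\beta S$ is the Hausdorff completion of the $^*$-algebra of finite formal sums $\sum(b_i,s_i)$ with $b_i\in B_{r(s_i)}$, with operations $(b,s)(c,t)=(\beta_s(\beta_{s^*}(b)c),st)$ and $(b,s)^*=(\beta_{s^*}(b^*),s^*)$, in the supremum of the $C^*$-seminorms $\sum(b_i,s_i)\mapsto\|\sum\pi(b_i)U_{s_i}\|$ over all covariant representations. The $C^*$-algebra $C^*(G)$ is the Hausdorff completion of $C_c(G)$, with $(fg)(x)=\sum_{r(y)=r(x)}f(y)g(y^{-1}x)$ and $f^*(x)=\overline{f(x^{-1})}$, in the supremum of the $C^*$-seminorms $f\mapsto\|\Pi(f)\|$ over all representations $\Pi$ of $C_c(G)$ that are continuous from the inductive limit topology to the weak operator topology. \textbf{Theorem.} Let $G$ be an $r$-discrete (Hausdorff) groupoid and let $S$ be a full inverse semigroup of open $G$-sets. Then there is a unique action $\beta$ of $S$ on $C_0(G^0)$ such that each $\beta_s$ has domain $B_{d(s)}=\{f\in C_0(G^0): f=0\text{ off }d(s)\}$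 and, for $f\in B_{d(s)}$, \[ \beta_s(f)(u)=\begin{cases} f(s^*us) & \text{if } u\in r(s),\\ 0 & \text{otherwise.}\end{cases} \] Here $s^*us$ is identified with the unique unit that it contains. The suprema defining $C^*(G)$ and $C_0(G^0)\times_\beta S$ are finite, and \[ C^*(G)\cong C_0(G^0)\times_\beta S . \] Moreover every additive inverse subsemigroup of $G^{op}$ is full, so this applies in particular to additive $S$. -/

import Mathlib

universe u

open scoped CompactlySupported ZeroAtInfty

/-! ### C*-seminorms and Hausdorff completions of complex *-algebras -/

section Envelope

/-- A C*-seminorm on a complex *-algebra `D`. -/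
structure CStarSeminorm (D : Type u) [NonUnitalRing D] [StarRing D] [Module ℂ D] extends
    Seminorm ℂ D where
  mul_le' : ∀ a b : D, toFun (a * b) ≤ toFun a * toFun b
  star_mul_self' : ∀ a : D, toFun (star a * a) = toFun a * toFun a

namespace CStarSeminorm

variable {D : Type u} [NonUnitalRing D] [StarRing D] [Module ℂ D]

noncomputable instance : CoeFun (CStarSeminorm D) (fun _ => D → ℝ) := ⟨fun p => p.toSeminorm⟩

theorem mul_le (p : CStarSeminorm D) (a b : D) : p (a * b) ≤ p a * p b := p.mul_le' a b

theorem star_mul_self (p : CStarSeminorm D) (a : D) : p (star a * a) = p a * p a :=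
  p.star_mul_self' a

theorem nonneg (p : CStarSeminorm D) (a : D) : 0 ≤ p a := apply_nonneg p.toSeminorm a

theorem le_star (p : CStarSeminorm D) (a : D) : p a ≤ p (star a) := by
  by_contra! h
  have h1 := p.mul_le (star a) a
  rw [p.star_mul_self] at h1
  have h0 : 0 < p a := lt_of_le_of_lt (p.nonneg _) h
  have := le_of_mul_le_mul_right h1 h0
  linarith

theorem star_eq (p : CStarSeminorm D) (a : D) : p (star a) = p a :=
  le_antisymm (by simpa using p.le_star (star a)) (p.le_star a)

/-- The zero seminorm. -/
noncomputable instance : Zero (CStarSeminorm D) :=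
  ⟨{ (0 : Seminorm ℂ D) with
      mul_le' := fun _ _ => by show (0 : ℝ) ≤ 0 * 0; simp
      star_mul_self' := fun _ => by show (0 : ℝ) = 0 * 0; simp }⟩

/-- A family of C*-seminorms is pointwise bounded when its pointwise supremum is finite. -/
def PointwiseBounded (P : Set (CStarSeminorm D)) : Prop :=
  ∀ a : D, BddAbove {t : ℝ | ∃ p ∈ P, t = p a}

open Classical in
/-- The supremum of a family of C*-seminorms, if it is finite (otherwise, by convention, the zero
seminorm). The supremum of the empty family is zero. -/
noncomputable def sup (P : Set (CStarSeminorm D)) : CStarSeminorm D :=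
  if h : PointwiseBounded P then
    { toFun := fun a => ⨆ p : P, p.1 a
      map_zero' := by simp
      add_le' := fun a b => by
        have hb : ∀ a : D, BddAbove (Set.range fun p : P => p.1 a) := fun a =>
          (h a).mono (by rintro _ ⟨p, rfl⟩; exact ⟨p.1, p.2, rfl⟩)
        refine Real.iSup_le (fun p => (map_add_le_add p.1.toSeminorm a b).trans
          (add_le_add (le_ciSup (hb a) p) (le_ciSup (hb b) p))) ?_
        exact add_nonneg (Real.iSup_nonneg fun p => p.1.nonneg a)
          (Real.iSup_nonneg fun p => p.1.nonneg b)
      neg' := fun a => by simp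
      smul' := fun c a => by
        rw [Real.mul_iSup_of_nonneg (norm_nonneg c)]
        exact iSup_congr fun p => map_smul_eq_mul p.1.toSeminorm c a
      mul_le' := fun a b => by
        have hb : ∀ a : D, BddAbove (Set.range fun p : P => p.1 a) := fun a =>
          (h a).mono (by rintro _ ⟨p, rfl⟩; exact ⟨p.1, p.2, rfl⟩)
        refine Real.iSup_le (fun p => (p.1.mul_le a b).trans
          (mul_le_mul (le_ciSup (hb a) p) (le_ciSup (hb b) p) (p.1.nonneg b)
            (Real.iSup_nonneg fun p => p.1.nonneg a))) ?_
        exact mul_nonneg (Real.iSup_nonneg fun p => p.1.nonneg a)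
          (Real.iSup_nonneg fun p => p.1.nonneg b)
      star_mul_self' := fun a => by
        have hb : ∀ a : D, BddAbove (Set.range fun p : P => p.1 a) := fun a =>
          (h a).mono (by rintro _ ⟨p, rfl⟩; exact ⟨p.1, p.2, rfl⟩)
        have hs : 0 ≤ ⨆ p : P, p.1 (star a * a) := Real.iSup_nonneg fun p => p.1.nonneg _
        apply le_antisymm
        · refine Real.iSup_le (fun p => ?_) (mul_self_nonneg _)
          rw [p.1.star_mul_self]
          exact mul_self_le_mul_self (p.1.nonneg a) (le_ciSup (hb a) p)
        · refine (mul_self_le_mul_self (Real.iSup_nonneg fun p => p.1.nonneg a)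
            (Real.iSup_le (fun p => Real.le_sqrt_of_sq_le ?_) (Real.sqrt_nonneg _))).trans
              (Real.mul_self_sqrt hs).le
          rw [sq, ← p.1.star_mul_self]
          exact le_ciSup (hb (star a * a)) p }
  else 0

/-- The *-algebra `D`, seen as a seminormed space through the C*-seminorm `p`. -/
def Carrier (_p : CStarSeminorm D) : Type u := D

noncomputable section

variable (p : CStarSeminorm D)

instance : NonUnitalRing p.Carrier := inferInstanceAs (NonUnitalRing D)
instance : StarRing p.Carrier := inferInstanceAs (StarRing D)
instance : Module ℂ p.Carrier := inferInstanceAs (Module ℂ D)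
instance [IsScalarTower ℂ D D] : IsScalarTower ℂ p.Carrier p.Carrier :=
  inferInstanceAs (IsScalarTower ℂ D D)
instance [SMulCommClass ℂ D D] : SMulCommClass ℂ p.Carrier p.Carrier :=
  inferInstanceAs (SMulCommClass ℂ D D)
instance [StarModule ℂ D] : StarModule ℂ p.Carrier :=
  inferInstanceAs (StarModule ℂ D)

instance : NonUnitalSeminormedRing p.Carrier :=
  { AddGroupSeminorm.toSeminormedAddCommGroup (E := p.Carrier) p.toSeminorm.toAddGroupSeminorm,
    (inferInstance : NonUnitalRing p.Carrier) with
    norm_mul_le := p.mul_le }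

theorem norm_def (a : p.Carrier) : ‖a‖ = p a := rfl

instance : NormedSpace ℂ p.Carrier where
  norm_smul_le c a := (map_smul_eq_mul p.toSeminorm c a).le

instance : NormedStarGroup p.Carrier where
  norm_star_le a := (p.star_eq a).le

/-- The Hausdorff completion of `D` relative to the C*-seminorm `p`. -/
def HausdorffCompletion : Type u := UniformSpace.Completion p.Carrier

open UniformSpace UniformSpace.Completion

namespace HausdorffCompletion

instance : NormedAddCommGroup p.HausdorffCompletion :=
  inferInstanceAs (NormedAddCommGroup (Completion p.Carrier))
instance : NormedSpace ℂ p.HausdorffCompletion :=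
  inferInstanceAs (NormedSpace ℂ (Completion p.Carrier))
instance : CompleteSpace p.HausdorffCompletion :=
  inferInstanceAs (CompleteSpace (Completion p.Carrier))

/-- The canonical map of `D` into its completion. -/
def mk (a : D) : p.HausdorffCompletion := ((show p.Carrier from a : p.Carrier) : Completion p.Carrier)

theorem mk_add (a b : D) : mk p (a + b) = mk p a + mk p b := coe_add (α := p.Carrier) a b

theorem mk_smul (c : ℂ) (a : D) : mk p (c • a) = c • mk p a := coe_smul (X := p.Carrier) c a

theorem norm_mk (a : D) : ‖mk p a‖ = p a := norm_coe (E := p.Carrier) a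

theorem denseRange_mk : DenseRange (mk p) := denseRange_coe (α := p.Carrier)

theorem continuous_mk : Continuous (X := p.Carrier) (mk p) := continuous_coe p.Carrier

/-- The product of the completion: the continuous extension of the product of `D`. -/
instance : Mul p.HausdorffCompletion :=
  ⟨Function.curry <| ((isDenseInducing_coe (α := p.Carrier)).prodMap
    (isDenseInducing_coe (α := p.Carrier))).extend
      fun q : p.Carrier × p.Carrier => mk p (q.1 * q.2)⟩

/-- The involution of the completion: the continuous extension of the involution of `D`. -/
instance : Star p.HausdorffCompletion :=
  ⟨Completion.map (fun a : p.Carrier => star a)⟩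

theorem mk_mul (a b : D) : mk p (a * b) = mk p a * mk p b :=
  (((isDenseInducing_coe (α := p.Carrier)).prodMap
    (isDenseInducing_coe (α := p.Carrier))).extend_eq
      ((continuous_mk p).comp (@continuous_mul p.Carrier _ _ _)) (a, b)).symm

theorem mk_star (a : D) : mk p (star a) = star (mk p a) :=
  (Completion.map_coe (α := p.Carrier) (β := p.Carrier) (f := star)
    (star_isometry (E := p.Carrier)).uniformContinuous a).symm

instance : ContinuousMul p.HausdorffCompletion where
  continuous_mul := by
    let m := (AddMonoidHom.mul : p.Carrier →+ p.Carrier →+ p.Carrier).compr₂ toCompl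
    have : Continuous fun q : p.Carrier × p.Carrier => m q.1 q.2 :=
      (continuous_coe p.Carrier).comp continuous_mul
    have di : IsDenseInducing (toCompl : p.Carrier → Completion p.Carrier) := isDenseInducing_coe
    exact (di.extend_Z_bilin di this :)

theorem continuous_star' : Continuous (star : p.HausdorffCompletion → p.HausdorffCompletion) :=
  Completion.continuous_map

@[elab_as_elim]
theorem induction₁ {P : p.HausdorffCompletion → Prop} (x : p.HausdorffCompletion)
    (hc : IsClosed {x | P x}) (h : ∀ a : D, P (mk p a)) : P x :=
  Completion.induction_on (α := p.Carrier) x hc h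

@[elab_as_elim]
theorem induction₂ {P : p.HausdorffCompletion → p.HausdorffCompletion → Prop}
    (x y : p.HausdorffCompletion)
    (hc : IsClosed {q : p.HausdorffCompletion × p.HausdorffCompletion | P q.1 q.2})
    (h : ∀ a b : D, P (mk p a) (mk p b)) : P x y :=
  Completion.induction_on₂ (α := p.Carrier) (β := p.Carrier) x y hc h

@[elab_as_elim]
theorem induction₃ {P : p.HausdorffCompletion → p.HausdorffCompletion →
      p.HausdorffCompletion → Prop} (x y z : p.HausdorffCompletion)
    (hc : IsClosed {q : p.HausdorffCompletion × p.HausdorffCompletion × p.HausdorffCompletion |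
      P q.1 q.2.1 q.2.2})
    (h : ∀ a b c : D, P (mk p a) (mk p b) (mk p c)) : P x y z :=
  Completion.induction_on₃ (α := p.Carrier) (β := p.Carrier) (γ := p.Carrier) x y z hc h

instance : NonUnitalNormedRing p.HausdorffCompletion :=
  { (inferInstance : NormedAddCommGroup p.HausdorffCompletion),
    (inferInstance : Mul p.HausdorffCompletion) with
    zero_mul := fun x => by
      have h0 : (0 : p.HausdorffCompletion) = mk p 0 := rfl
      induction x using induction₁ with
      | hc => exact isClosed_eq (by fun_prop) continuous_const
      | h a => rw [h0, ← mk_mul, zero_mul]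
    mul_zero := fun x => by
      have h0 : (0 : p.HausdorffCompletion) = mk p 0 := rfl
      induction x using induction₁ with
      | hc => exact isClosed_eq (by fun_prop) continuous_const
      | h a => rw [h0, ← mk_mul, mul_zero]
    mul_assoc := fun x y z => by
      induction x, y, z using induction₃ with
      | hc => exact isClosed_eq (by fun_prop) (by fun_prop)
      | h a b c => simp only [← mk_mul, mul_assoc]
    left_distrib := fun x y z => by
      induction x, y, z using induction₃ with
      | hc => exact isClosed_eq (by fun_prop) (by fun_prop)
      | h a b c => simp only [← mk_mul, ← mk_add, mul_add]
    right_distrib := fun x y z => by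
      induction x, y, z using induction₃ with
      | hc => exact isClosed_eq (by fun_prop) (by fun_prop)
      | h a b c => simp only [← mk_mul, ← mk_add, add_mul]
    norm_mul_le := fun x y => by
      induction x, y using induction₂ with
      | hc => exact isClosed_le (by fun_prop) (by fun_prop)
      | h a b => simp only [← mk_mul, norm_mk]; exact p.mul_le a b }

instance : StarRing p.HausdorffCompletion where
  star_involutive x := by
    have := continuous_star' p
    induction x using induction₁ with
    | hc => exact isClosed_eq (by fun_prop) (by fun_prop)
    | h a => rw [← mk_star, ← mk_star, star_star]
  star_mul x y := by
    have := continuous_star' p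
    induction x, y using induction₂ with
    | hc => exact isClosed_eq (by fun_prop) (by fun_prop)
    | h a b => simp only [← mk_mul, ← mk_star, star_mul]
  star_add x y := by
    have := continuous_star' p
    induction x, y using induction₂ with
    | hc => exact isClosed_eq (by fun_prop) (by fun_prop)
    | h a b => simp only [← mk_add, ← mk_star, star_add]

theorem smul_mul' [IsScalarTower ℂ D D] (c : ℂ) (x y : p.HausdorffCompletion) : c • x * y = c • (x * y) := by
  induction x, y using induction₂ with
  | hc =>
    have h1 : Continuous fun q : p.HausdorffCompletion × p.HausdorffCompletion => c • q.1 :=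
      continuous_fst.const_smul c
    exact isClosed_eq (h1.mul continuous_snd) (continuous_mul.const_smul c)
  | h a b => rw [← mk_mul, ← mk_smul, ← mk_smul, ← mk_mul, smul_mul_assoc]

theorem mul_smul' [SMulCommClass ℂ D D] (c : ℂ) (x y : p.HausdorffCompletion) : x * c • y = c • (x * y) := by
  induction x, y using induction₂ with
  | hc =>
    have h1 : Continuous fun q : p.HausdorffCompletion × p.HausdorffCompletion => c • q.2 :=
      continuous_snd.const_smul c
    exact isClosed_eq (continuous_fst.mul h1) (continuous_mul.const_smul c)
  | h a b => rw [← mk_mul, ← mk_smul, ← mk_smul, ← mk_mul, mul_smul_comm]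

theorem star_smul' [StarModule ℂ D] (c : ℂ) (x : p.HausdorffCompletion) : star (c • x) = star c • star x := by
  have := continuous_star' p
  induction x using induction₁ with
  | hc =>
    exact isClosed_eq (this.comp (continuous_id.const_smul c))
      (Continuous.const_smul (g := fun x : p.HausdorffCompletion => star x) this (star c))
  | h a => rw [← mk_smul, ← mk_star, ← mk_star, ← mk_smul, star_smul]

/-- The completion of a *-algebra relative to a C*-seminorm is a C*-algebra. -/
instance [IsScalarTower ℂ D D] [SMulCommClass ℂ D D] [StarModule ℂ D] :
    NonUnitalCStarAlgebra p.HausdorffCompletion where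
  norm_mul_self_le x := by
    have := continuous_star' p
    induction x using induction₁ with
    | hc => exact isClosed_le (by fun_prop) (by fun_prop)
    | h a => simp only [← mk_star, ← mk_mul, norm_mk, p.star_mul_self, le_refl]
  norm_smul_le c x := norm_smul_le c x
  smul_assoc c x y := smul_mul' p c x y
  smul_comm c x y := (mul_smul' p c x y).symm
  star_smul c x := star_smul' p c x

end HausdorffCompletion

/-- The C*-seminorm `a ↦ ‖ρ a‖` of a representation `ρ` of `D` on a Hilbert space. -/
def ofRepresentation {H : Type u} [NormedAddCommGroup H] [InnerProductSpace ℂ H] [CompleteSpace H]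
    (ρ : D →⋆ₙₐ[ℂ] (H →L[ℂ] H)) : CStarSeminorm D where
  toFun a := ‖ρ a‖
  map_zero' := by simp
  add_le' a b := by simpa using norm_add_le (ρ a) (ρ b)
  neg' a := by simp
  smul' c a := by simp [norm_smul]
  mul_le' a b := by simpa using norm_mul_le (ρ a) (ρ b)
  star_mul_self' a := by
    show ‖ρ (star a * a)‖ = _
    rw [map_mul, map_star, CStarRing.norm_star_mul_self]

end

end CStarSeminorm

end Envelope

/-! ### Inverse semigroups and their actions on C*-algebras -/

/-- An inverse semigroup, with the inverse of `s` written `star s`. -/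
class InverseSemigroup (S : Type u) extends Semigroup S, StarMul S where
  mul_star_mul_self : ∀ s : S, s * star s * s = s
  range_idem_comm : ∀ s t : S, (s * star s) * (t * star t) = (t * star t) * (s * star s)

namespace InverseSemigroup

variable {S : Type u} [InverseSemigroup S]

/-- The domain idempotent `d(s) = s* s`. -/
def d (s : S) : S := star s * s

/-- The range idempotent `r(s) = s s*`. -/
def r (s : S) : S := s * star s

/-- The natural partial order: `s ≤ t` means `s = s s* t`. -/
def NatLE (s t : S) : Prop := s = s * star s * t

theorem star_mul_self_star (s : S) : star s * s * star s = star s := by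
  have := congrArg star (mul_star_mul_self s)
  simpa [star_mul, mul_assoc] using this

end InverseSemigroup

/-- An inverse subsemigroup of an inverse semigroup. -/
structure InverseSubsemigroup (T : Type u) [InverseSemigroup T] where
  carrier : Set T
  mul_mem : ∀ {s t : T}, s ∈ carrier → t ∈ carrier → s * t ∈ carrier
  star_mem : ∀ {s : T}, s ∈ carrier → star s ∈ carrier

namespace InverseSubsemigroup

variable {T : Type u} [InverseSemigroup T]

instance : CoeSort (InverseSubsemigroup T) (Type u) := ⟨fun S => S.carrier⟩

instance (S : InverseSubsemigroup T) : InverseSemigroup S where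
  mul s t := ⟨s.1 * t.1, S.mul_mem s.2 t.2⟩
  mul_assoc s t v := Subtype.ext (mul_assoc s.1 t.1 v.1)
  star s := ⟨star s.1, S.star_mem s.2⟩
  star_involutive s := Subtype.ext (star_star s.1)
  star_mul s t := Subtype.ext (star_mul s.1 t.1)
  mul_star_mul_self s := Subtype.ext (InverseSemigroup.mul_star_mul_self s.1)
  range_idem_comm s t := Subtype.ext (InverseSemigroup.range_idem_comm s.1 t.1)

end InverseSubsemigroup

/-- A closed two-sided ideal of a C*-algebra (such an ideal is automatically a *-subalgebra). -/
structure ClosedIdeal (B : Type u) [NonUnitalCStarAlgebra B] extends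
    NonUnitalStarSubalgebra ℂ B where
  isClosed' : IsClosed carrier
  mul_mem_left' : ∀ (a : B) {b : B}, b ∈ carrier → a * b ∈ carrier
  mul_mem_right' : ∀ {b : B} (a : B), b ∈ carrier → b * a ∈ carrier

/-- A partial automorphism of a C*-algebra `B`: an isomorphism between two closed ideals. -/
structure PartialAut (B : Type u) [NonUnitalCStarAlgebra B] where
  dom : ClosedIdeal B
  ran : ClosedIdeal B
  equiv : dom.toNonUnitalStarSubalgebra ≃⋆ₐ[ℂ] ran.toNonUnitalStarSubalgebra

namespace PartialAut

variable {B : Type u} [NonUnitalCStarAlgebra B]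

/-- The domain, as a *-subalgebra. -/
abbrev Dom (φ : PartialAut B) : NonUnitalStarSubalgebra ℂ B := φ.dom.toNonUnitalStarSubalgebra

/-- The range, as a *-subalgebra. -/
abbrev Ran (φ : PartialAut B) : NonUnitalStarSubalgebra ℂ B := φ.ran.toNonUnitalStarSubalgebra

/-- `φ.Maps a b` means that `a` is in the domain of `φ` and that `φ a = b`. -/
def Maps (φ : PartialAut B) (a b : B) : Prop := ∃ h : a ∈ φ.Dom, (φ.equiv ⟨a, h⟩ : B) = b

theorem maps_equiv (φ : PartialAut B) (a : φ.Dom) : φ.Maps a (φ.equiv a) := ⟨a.2, rfl⟩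

theorem maps_symm (φ : PartialAut B) (b : φ.Ran) : φ.Maps (φ.equiv.symm b) b :=
  ⟨(φ.equiv.symm b).2, by simp⟩

variable {φ : PartialAut B} {a a' b b' : B}

theorem Maps.mem_dom (h : φ.Maps a b) : a ∈ φ.Dom := h.1

theorem Maps.mem_ran (h : φ.Maps a b) : b ∈ φ.Ran := by
  obtain ⟨h, rfl⟩ := h; exact (φ.equiv _).2

theorem Maps.equiv_eq (h : φ.Maps a b) : φ.equiv ⟨a, h.mem_dom⟩ = ⟨b, h.mem_ran⟩ :=
  Subtype.ext h.2

theorem Maps.symm_eq (h : φ.Maps a b) : φ.equiv.symm ⟨b, h.mem_ran⟩ = ⟨a, h.mem_dom⟩ := by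
  rw [← h.equiv_eq, StarAlgEquiv.symm_apply_apply]

theorem Maps.right_unique (h : φ.Maps a b) (h' : φ.Maps a b') : b = b' := by
  obtain ⟨_, rfl⟩ := h; obtain ⟨_, rfl⟩ := h'; rfl

theorem Maps.left_unique (h : φ.Maps a b) (h' : φ.Maps a' b) : a = a' :=
  congrArg Subtype.val (h.symm_eq.symm.trans h'.symm_eq)

theorem Maps.mul (h : φ.Maps a b) (h' : φ.Maps a' b') : φ.Maps (a * a') (b * b') :=
  ⟨mul_mem h.1 h'.1, by
    have := congrArg Subtype.val (map_mul φ.equiv ⟨a, h.1⟩ ⟨a', h'.1⟩)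
    rw [← h.2, ← h'.2]; exact this⟩

theorem Maps.sub (h : φ.Maps a b) (h' : φ.Maps a' b') : φ.Maps (a - a') (b - b') :=
  ⟨sub_mem h.1 h'.1, by
    have := congrArg Subtype.val (map_sub φ.equiv ⟨a, h.1⟩ ⟨a', h'.1⟩)
    rw [← h.2, ← h'.2]; exact this⟩

theorem Maps.add (h : φ.Maps a b) (h' : φ.Maps a' b') : φ.Maps (a + a') (b + b') :=
  ⟨add_mem h.1 h'.1, by
    have := congrArg Subtype.val (map_add φ.equiv ⟨a, h.1⟩ ⟨a', h'.1⟩)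
    rw [← h.2, ← h'.2]; exact this⟩

theorem Maps.smul (k : ℂ) (h : φ.Maps a b) : φ.Maps (k • a) (k • b) :=
  ⟨SMulMemClass.smul_mem k h.1, by
    have := congrArg Subtype.val (map_smul φ.equiv k ⟨a, h.1⟩)
    rw [← h.2]; exact this⟩

theorem Maps.star (h : φ.Maps a b) : φ.Maps (star a) (star b) :=
  ⟨star_mem h.1, by
    have := congrArg Subtype.val (map_star φ.equiv ⟨a, h.1⟩)
    rw [← h.2]; exact this⟩

theorem exists_maps_of_mem_dom (h : a ∈ φ.Dom) : ∃ b, φ.Maps a b := ⟨_, h, rfl⟩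

theorem exists_maps_of_mem_ran (h : b ∈ φ.Ran) : ∃ a, φ.Maps a b := ⟨_, φ.maps_symm ⟨b, h⟩⟩

theorem mul_mem_dom_left (c : B) (h : a ∈ φ.Dom) : c * a ∈ φ.Dom := φ.dom.mul_mem_left' c h
theorem mul_mem_dom_right (c : B) (h : a ∈ φ.Dom) : a * c ∈ φ.Dom := φ.dom.mul_mem_right' c h
theorem mul_mem_ran_left (c : B) (h : a ∈ φ.Ran) : c * a ∈ φ.Ran := φ.ran.mul_mem_left' c h
theorem mul_mem_ran_right (c : B) (h : a ∈ φ.Ran) : a * c ∈ φ.Ran := φ.ran.mul_mem_right' c h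

/-- If `b = φ a`, `c ∈ B`, `e ∈ ran φ`, then multiplying on the right by `c` before applying `φ`
commutes with multiplying on the left by an arbitrary `x` after applying `φ`. -/
theorem Maps.assoc_aux {x c y z w : B} (h : φ.Maps a b) (hy : φ.Maps y (x * b))
    (hz : φ.Maps (y * c) z) (hw : φ.Maps (a * c) w) : z = x * w := by
  have key : ∀ e e', φ.Maps e e' → z * e' = x * w * e' := by
    intro e e' he
    obtain ⟨f, hf⟩ := exists_maps_of_mem_dom (φ := φ) (mul_mem_dom_left c he.mem_dom)
    have h1 := hz.mul he
    have h2 := hy.mul hf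
    rw [mul_assoc] at h1
    have h3 := hw.mul he
    have h4 := h.mul hf
    rw [mul_assoc] at h3
    rw [h1.right_unique h2, mul_assoc x w, h3.right_unique h4, mul_assoc]
  have hd : z - x * w ∈ φ.Ran := sub_mem hz.mem_ran (mul_mem_ran_left x hw.mem_ran)
  obtain ⟨e, he⟩ := exists_maps_of_mem_ran (star_mem hd)
  have := key _ _ he
  rw [← sub_eq_zero, ← sub_mul, CStarRing.mul_star_self_eq_zero_iff] at this
  exact sub_eq_zero.mp this

/-- `χ` is the composition `φ ∘ ψ` of partial maps, defined wherever it makes sense. -/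
def IsComp (φ ψ χ : PartialAut B) : Prop :=
  ∀ a c : B, χ.Maps a c ↔ ∃ b, ψ.Maps a b ∧ φ.Maps b c

end PartialAut

/-- An action of the inverse semigroup `S` on the C*-algebra `B`: a homomorphism of `S` to the
partial automorphisms of `B` whose domain ideals are upward-directed with dense span. -/
structure InverseSemigroupAction (S : Type u) [InverseSemigroup S] (B : Type u)
    [NonUnitalCStarAlgebra B] where
  toPAut : S → PartialAut B
  map_mul' : ∀ s t : S, (toPAut s).IsComp (toPAut t) (toPAut (s * t))
  directed' : ∀ s t : S, ∃ v : S, (toPAut s).Dom ≤ (toPAut v).Dom ∧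
    (toPAut t).Dom ≤ (toPAut v).Dom
  dense_span' : Dense (Submodule.span ℂ (⋃ s : S, ((toPAut s).Dom : Set B)) : Set B)

namespace InverseSemigroupAction

variable {S : Type u} [InverseSemigroup S] {B : Type u} [NonUnitalCStarAlgebra B]

instance : CoeFun (InverseSemigroupAction S B) (fun _ => S → PartialAut B) := ⟨toPAut⟩

variable (β : InverseSemigroupAction S B)

theorem maps_mul {s t : S} {a c : B} :
    (β (s * t)).Maps a c ↔ ∃ b, (β t).Maps a b ∧ (β s).Maps b c := β.map_mul' s t a c

theorem maps_star_of_maps {s : S} {a b : B} (h : (β s).Maps a b) : (β (star s)).Maps b a := by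
  have h' := h
  rw [← InverseSemigroup.mul_star_mul_self s, mul_assoc] at h'
  obtain ⟨a', h1, h2⟩ := β.maps_mul.mp h'
  obtain ⟨b', h3, h4⟩ := β.maps_mul.mp h1
  obtain rfl := h2.left_unique h
  obtain rfl := h3.right_unique h
  exact h4

/-- `β_{s*}` is the inverse of `β_s`. -/
theorem maps_star {s : S} {a b : B} : (β (star s)).Maps b a ↔ (β s).Maps a b :=
  ⟨fun h => by simpa using β.maps_star_of_maps h, β.maps_star_of_maps⟩

/-- The fibre over `s` of the bundle of ideals: the ideal `B_{r(s)}`, which is the range of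
`β_s`. -/
abbrev Fib (s : S) : Type u := (β s).Ran

theorem mem_fib_iff (s : S) (b : B) : b ∈ (β s).Ran ↔ b ∈ (β (InverseSemigroup.r s)).Dom := by
  constructor
  · intro h
    obtain ⟨a, ha⟩ := PartialAut.exists_maps_of_mem_ran h
    exact (β.maps_mul.mpr ⟨a, β.maps_star.mpr ha, ha⟩ : (β (s * star s)).Maps b b).mem_dom
  · intro h
    obtain ⟨c, hc⟩ := PartialAut.exists_maps_of_mem_dom h
    obtain ⟨a, ha, -⟩ := β.maps_mul.mp hc
    exact (β.maps_star.mp ha).mem_ran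

theorem mulGen_mem {s t : S} (b : β.Fib s) (c : β.Fib t) :
    ∃ x ∈ (β (s * t)).Ran, (β s).Maps (((β s).equiv.symm b : B) * c) x := by
  have hd : ((β s).equiv.symm b : B) * c ∈ (β s).Dom :=
    PartialAut.mul_mem_dom_right _ ((β s).equiv.symm b).2
  have hr : ((β s).equiv.symm b : B) * c ∈ (β t).Ran := PartialAut.mul_mem_ran_left _ c.2
  obtain ⟨x, hx⟩ := PartialAut.exists_maps_of_mem_dom hd
  obtain ⟨a, ha⟩ := PartialAut.exists_maps_of_mem_ran hr
  exact ⟨x, (β.maps_mul.mpr ⟨_, ha, hx⟩).mem_ran, hx⟩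

noncomputable section

/-- The product of generators, `(b, s) (c, t) = (β_s(β_{s*}(b) c), s t)`; here `β_{s*}` is written
as the inverse of `β_s`, which it is by `maps_star`. -/
def mulGen {s t : S} (b : β.Fib s) (c : β.Fib t) : β.Fib (s * t) :=
  ⟨(β s).equiv ⟨((β s).equiv.symm b : B) * c,
      PartialAut.mul_mem_dom_right _ ((β s).equiv.symm b).2⟩, by
    obtain ⟨x, hx, h⟩ := β.mulGen_mem b c
    rw [h.equiv_eq]; exact hx⟩

theorem mulGen_maps {s t : S} (b : β.Fib s) (c : β.Fib t) :
    (β s).Maps (((β s).equiv.symm b : B) * c) (β.mulGen b c) := ⟨_, rfl⟩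

theorem mulGen_eq {s t : S} {b : β.Fib s} {c : β.Fib t} {a x : B} (ha : (β s).Maps a b)
    (hx : (β s).Maps (a * c) x) : (β.mulGen b c : B) = x := by
  have := β.mulGen_maps b c
  rw [ha.left_unique ((β s).maps_symm b)] at hx
  exact this.right_unique hx

/-- The adjoint of a generator, `(b, s)* = (β_{s*}(b*), s*)`. -/
def starGen {s : S} (b : β.Fib s) : β.Fib (star s) :=
  ⟨(β (star s)).equiv ⟨star (b : B), (β.maps_star.mpr ((β s).maps_symm b).star).mem_dom⟩,
    Subtype.property _⟩

theorem starGen_maps {s : S} (b : β.Fib s) : (β (star s)).Maps (star (b : B)) (β.starGen b) :=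
  ⟨_, rfl⟩

theorem mulGen_add_left {s t : S} (b b' : β.Fib s) (c : β.Fib t) :
    β.mulGen (b + b') c = β.mulGen b c + β.mulGen b' c := by
  refine Subtype.ext (β.mulGen_eq (((β s).maps_symm b).add ((β s).maps_symm b')) ?_)
  rw [add_mul]
  exact (β.mulGen_maps b c).add (β.mulGen_maps b' c)

theorem mulGen_add_right {s t : S} (b : β.Fib s) (c c' : β.Fib t) :
    β.mulGen b (c + c') = β.mulGen b c + β.mulGen b c' := by
  refine Subtype.ext (β.mulGen_eq ((β s).maps_symm b) ?_)
  show (β s).Maps (_ * ((c : B) + (c' : B))) _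
  rw [mul_add]
  exact (β.mulGen_maps b c).add (β.mulGen_maps b c')

theorem mulGen_smul_left {s t : S} (k : ℂ) (b : β.Fib s) (c : β.Fib t) :
    β.mulGen (k • b) c = k • β.mulGen b c := by
  refine Subtype.ext (β.mulGen_eq (((β s).maps_symm b).smul k) ?_)
  rw [smul_mul_assoc]
  exact (β.mulGen_maps b c).smul k

theorem mulGen_smul_right {s t : S} (k : ℂ) (b : β.Fib s) (c : β.Fib t) :
    β.mulGen b (k • c) = k • β.mulGen b c := by
  refine Subtype.ext (β.mulGen_eq ((β s).maps_symm b) ?_)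
  show (β s).Maps (_ * (k • (c : B))) _
  rw [mul_smul_comm]
  exact (β.mulGen_maps b c).smul k

theorem mulGen_assoc {s t v : S} (a : β.Fib s) (b : β.Fib t) (c : β.Fib v) :
    (β.mulGen (β.mulGen a b) c : B) = β.mulGen a (β.mulGen b c) := by
  obtain ⟨y, hy1, hy2⟩ := β.maps_mul.mp ((β (s * t)).maps_symm (β.mulGen a b))
  have hab := β.mulGen_maps a b
  obtain rfl := hy2.left_unique hab
  obtain ⟨w, hw1, hw2⟩ := β.maps_mul.mp (β.mulGen_maps (β.mulGen a b) c)
  have hbc := β.mulGen_maps b c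
  have := ((β t).maps_symm b).assoc_aux hy1 hw1 hbc
  rw [this] at hw2
  exact hw2.right_unique (β.mulGen_maps a (β.mulGen b c))

theorem starGen_add {s : S} (b b' : β.Fib s) :
    β.starGen (b + b') = β.starGen b + β.starGen b' := by
  refine Subtype.ext ((β.starGen_maps (b + b')).right_unique ?_)
  show (β (star s)).Maps (star ((b : B) + (b' : B))) _
  rw [star_add]
  exact (β.starGen_maps b).add (β.starGen_maps b')

theorem starGen_smul {s : S} (k : ℂ) (b : β.Fib s) :
    β.starGen (k • b) = star k • β.starGen b := by
  refine Subtype.ext ((β.starGen_maps (k • b)).right_unique ?_)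
  show (β (star s)).Maps (star (k • (b : B))) _
  rw [star_smul]
  exact (β.starGen_maps b).smul _

theorem starGen_starGen {s : S} (b : β.Fib s) : (β.starGen (β.starGen b) : B) = b := by
  have h1 := β.maps_star.mp (β.starGen_maps b)
  have h2 := β.maps_star.mp (β.starGen_maps (β.starGen b))
  have h3 := β.maps_star.mpr h1.star
  rw [star_star] at h3
  exact h2.left_unique h3

theorem starGen_mulGen {s t : S} (b : β.Fib s) (c : β.Fib t) :
    (β.starGen (β.mulGen b c) : B) = β.mulGen (β.starGen c) (β.starGen b) := by
  have hb := (β.maps_star.mp (β.starGen_maps b))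
  have hb' : ((β s).equiv.symm b : B) = star (β.starGen b : B) :=
    ((β s).maps_symm b).left_unique (by simpa using hb.star)
  have h1 := (β.mulGen_maps b c).star
  rw [star_mul, hb', star_star] at h1
  -- the product is the image of `star c * starGen b` under `β_{t*}`
  have hc := β.starGen_maps c
  obtain ⟨x, hx⟩ := PartialAut.exists_maps_of_mem_dom
    (PartialAut.mul_mem_dom_right (β.starGen b : B) hc.mem_dom)
  rw [β.mulGen_eq hc hx]
  have h2 : (β (s * t)).Maps x (star (β.mulGen b c : B)) :=
    β.maps_mul.mpr ⟨_, β.maps_star.mp hx, h1⟩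
  exact (β.starGen_maps (β.mulGen b c)).right_unique (β.maps_star.mpr h2)

/-- The space of finitely supported sections of the bundle with fibre `B_{r(s)}` over `s`. -/
def SectionAlgebra : Type u := DirectSum S (fun s => β.Fib s)

namespace SectionAlgebra

instance : AddCommGroup β.SectionAlgebra :=
  inferInstanceAs (AddCommGroup (DirectSum S fun s => β.Fib s))
instance : Module ℂ β.SectionAlgebra :=
  inferInstanceAs (Module ℂ (DirectSum S fun s => β.Fib s))

open Classical in
/-- The generator `(b, s)`, as an additive function of `b`. -/
def ofHom (s : S) : β.Fib s →+ β.SectionAlgebra := DirectSum.of (fun s => β.Fib s) s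

/-- The generator `(b, s)`. -/
def of {s : S} (b : β.Fib s) : β.SectionAlgebra := ofHom β s b

variable {β}

theorem of_congr {s t : S} {b : β.Fib s} {c : β.Fib t} (h : s = t) (hb : (b : B) = c) :
    of β b = of β c := by
  subst h; rw [Subtype.ext hb]

theorem of_add {s : S} (b b' : β.Fib s) : of β (b + b') = of β b + of β b' := map_add _ _ _

theorem of_smul {s : S} (k : ℂ) (b : β.Fib s) : of β (k • b) = k • of β b := by
  classical
  exact DirectSum.of_smul ℂ (M := fun s => β.Fib s) s k b

@[elab_as_elim]
theorem induction {P : β.SectionAlgebra → Prop} (f : β.SectionAlgebra) (zero : P 0)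
    (of : ∀ (s : S) (b : β.Fib s), P (of β b)) (add : ∀ f g, P f → P g → P (f + g)) : P f := by
  classical
  exact DirectSum.induction_on (motive := P) f zero of add

open Classical in
/-- The additive extension of a family of additive maps defined on the fibres. -/
def lift {M : Type*} [AddCommMonoid M] (F : ∀ s : S, β.Fib s →+ M) : β.SectionAlgebra →+ M :=
  DirectSum.toAddMonoid F

theorem lift_of {M : Type*} [AddCommMonoid M] (F : ∀ s : S, β.Fib s →+ M) {s : S} (b : β.Fib s) :
    lift F (of β b) = F s b := by
  classical
  exact DirectSum.toAddMonoid_of F s b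

/-- The product of generators, as a biadditive map. -/
def mulGenHom (s t : S) : β.Fib s →+ β.Fib t →+ β.SectionAlgebra :=
  AddMonoidHom.mk' (fun b => AddMonoidHom.mk' (fun c => of β (β.mulGen b c))
      fun c c' => by rw [mulGen_add_right, of_add])
    fun b b' => by ext c; simp [mulGen_add_left, of_add]

/-- The biadditive extension of the product of generators. -/
def mulHom : β.SectionAlgebra →+ β.SectionAlgebra →+ β.SectionAlgebra :=
  lift fun s => AddMonoidHom.flip (lift fun t => AddMonoidHom.flip (mulGenHom s t))

instance : Mul β.SectionAlgebra := ⟨fun f g => mulHom f g⟩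

instance : Star β.SectionAlgebra :=
  ⟨lift fun s => AddMonoidHom.mk' (fun b => of β (β.starGen b))
    fun b b' => by rw [starGen_add, of_add]⟩

theorem of_mul_of {s t : S} (b : β.Fib s) (c : β.Fib t) :
    of β b * of β c = of β (β.mulGen b c) := by
  show mulHom (of β b) (of β c) = _
  rw [mulHom, lift_of, AddMonoidHom.flip_apply, lift_of]
  rfl

theorem star_of {s : S} (b : β.Fib s) : star (of β b) = of β (β.starGen b) := lift_of _ b

theorem star_add' (f g : β.SectionAlgebra) : star (f + g) = star f + star g := map_add (lift _) f g

theorem star_zero' : star (0 : β.SectionAlgebra) = 0 := map_zero (lift _)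

instance : NonUnitalNonAssocRing β.SectionAlgebra :=
  { (inferInstance : AddCommGroup β.SectionAlgebra), (inferInstance : Mul β.SectionAlgebra) with
    left_distrib := fun f g h => map_add (mulHom f) g h
    right_distrib := fun f g h => by
      show mulHom (f + g) h = mulHom f h + mulHom g h
      rw [map_add, AddMonoidHom.add_apply]
    zero_mul := fun f => by
      show mulHom 0 f = 0
      rw [map_zero, AddMonoidHom.zero_apply]
    mul_zero := fun f => map_zero (mulHom f) }

instance : NonUnitalRing β.SectionAlgebra where
  mul_assoc f g h := by
    induction f using induction with
    | zero => simp only [zero_mul]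
    | add f f' hf hf' => simp only [add_mul, hf, hf']
    | of s a =>
      induction g using induction with
      | zero => simp only [zero_mul, mul_zero]
      | add f f' hf hf' => simp only [add_mul, mul_add, hf, hf']
      | of t b =>
        induction h using induction with
        | zero => simp only [mul_zero]
        | add f f' hf hf' => simp only [mul_add, hf, hf']
        | of v c =>
          simp only [of_mul_of]
          exact of_congr (mul_assoc s t v) (β.mulGen_assoc a b c)

instance : StarRing β.SectionAlgebra where
  star_involutive f := by
    induction f using induction with
    | zero => rw [star_zero', star_zero']
    | add f f' hf hf' => rw [star_add', star_add', hf, hf']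
    | of s a => rw [star_of, star_of]; exact of_congr (star_star s) (β.starGen_starGen a)
  star_mul f g := by
    induction f using induction with
    | zero => rw [zero_mul, star_zero', mul_zero]
    | add f f' hf hf' => rw [add_mul, star_add', star_add', mul_add, hf, hf']
    | of s a =>
      induction g using induction with
      | zero => rw [mul_zero, star_zero', zero_mul]
      | add f f' hf hf' => rw [mul_add, star_add', star_add', add_mul, hf, hf']
      | of t b =>
        simp only [star_of, of_mul_of]
        exact of_congr (star_mul s t) (β.starGen_mulGen a b)
  star_add := star_add'

instance : IsScalarTower ℂ β.SectionAlgebra β.SectionAlgebra where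
  smul_assoc k f g := by
    simp only [smul_eq_mul]
    induction f using induction with
    | zero => simp only [smul_zero, zero_mul]
    | add f f' hf hf' => simp only [smul_add, add_mul, hf, hf']
    | of s a =>
      induction g using induction with
      | zero => simp only [smul_zero, mul_zero]
      | add f f' hf hf' => simp only [smul_add, mul_add, hf, hf']
      | of t b => simp only [← of_smul, of_mul_of, mulGen_smul_left]

instance : SMulCommClass ℂ β.SectionAlgebra β.SectionAlgebra where
  smul_comm k f g := by
    simp only [smul_eq_mul]
    induction f using induction with
    | zero => simp only [smul_zero, zero_mul]
    | add f f' hf hf' => simp only [smul_add, add_mul, hf, hf']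
    | of s a =>
      induction g using induction with
      | zero => simp only [smul_zero, mul_zero]
      | add f f' hf hf' => simp only [smul_add, mul_add, hf, hf']
      | of t b => simp only [← of_smul, of_mul_of, mulGen_smul_right]

instance : StarModule ℂ β.SectionAlgebra where
  star_smul k f := by
    induction f using induction with
    | zero => rw [smul_zero, star_zero', smul_zero]
    | add f f' hf hf' => rw [smul_add, star_add', star_add', smul_add, hf, hf']
    | of s a => rw [← of_smul, star_of, star_of, starGen_smul, of_smul]

end SectionAlgebra

/-- A covariant representation of the action `β` on the Hilbert space `H`. -/
structure CovariantRep (H : Type u) [NormedAddCommGroup H] [InnerProductSpace ℂ H]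
    [CompleteSpace H] where
  π : B →⋆ₙₐ[ℂ] (H →L[ℂ] H)
  nondegenerate : Dense (Submodule.span ℂ {ξ : H | ∃ b η, ξ = π b η} : Set H)
  U : S → (H →L[ℂ] H)
  U_mul : ∀ s t : S, U (s * t) = U s * U t
  U_star : ∀ s : S, U (star s) = star (U s)
  U_dense : Dense (Submodule.span ℂ {ξ : H | ∃ s η, ξ = U s η} : Set H)
  /-- `U_e H = π(B_e) H` for every idempotent `e`. -/
  range_idem : ∀ e : S, e * e = e → Set.range (U e) =
    closure (Submodule.span ℂ {ξ : H | ∃ b ∈ (β e).Dom, ∃ η, ξ = π b η} : Set H)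
  covariant : ∀ (s : S) (b : (β s).Dom), U s * π b * star (U s) = π ((β s).equiv b)

namespace CovariantRep

variable {β} {H : Type u} [NormedAddCommGroup H] [InnerProductSpace ℂ H] [CompleteSpace H]
  (R : β.CovariantRep H)

theorem covariant_maps {s : S} {a b : B} (h : (β s).Maps a b) :
    R.U s * R.π a * star (R.U s) = R.π b := by
  obtain ⟨h, rfl⟩ := h; exact R.covariant s ⟨a, h⟩

theorem initial_mul {s : S} {a b : B} (h : (β s).Maps a b) :
    star (R.U s) * R.U s * R.π a = R.π a := by
  have he : (star s * s) * (star s * s) = star s * s := by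
    rw [← mul_assoc, InverseSemigroup.star_mul_self_star]
  have hidem : R.U (star s * s) * R.U (star s * s) = R.U (star s * s) := by
    rw [← R.U_mul, he]
  rw [← R.U_star, ← R.U_mul]
  ext η
  have hd : a ∈ (β (star s * s)).Dom :=
    (β.maps_mul.mpr ⟨b, h, β.maps_star.mpr h⟩ : (β (star s * s)).Maps a a).mem_dom
  have hmem : R.π a η ∈ Set.range (R.U (star s * s)) := by
    rw [R.range_idem _ he]
    exact subset_closure (Submodule.subset_span ⟨a, hd, η, rfl⟩)
  obtain ⟨ζ, hζ⟩ := hmem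
  show R.U (star s * s) (R.π a η) = R.π a η
  rw [← hζ]
  exact DFunLike.congr_fun hidem ζ

theorem mul_initial {s : S} {a b : B} (h : (β s).Maps a b) :
    R.π a * (star (R.U s) * R.U s) = R.π a := by
  have := congrArg star (R.initial_mul h.star)
  simpa [star_mul, mul_assoc, ← map_star] using this

/-- The integrated form of a covariant representation, `∑ (bᵢ, sᵢ) ↦ ∑ π(bᵢ) U_{sᵢ}`. -/
def integratedForm : β.SectionAlgebra →⋆ₙₐ[ℂ] (H →L[ℂ] H) :=
  let F : β.SectionAlgebra →+ (H →L[ℂ] H) := SectionAlgebra.lift fun s =>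
    AddMonoidHom.mk' (fun b : β.Fib s => R.π b * R.U s) fun b b' => by
      show R.π ((b : B) + (b' : B)) * _ = _
      rw [map_add, add_mul]
  have hF : ∀ (s : S) (b : β.Fib s), F (SectionAlgebra.of β b) = R.π b * R.U s :=
    fun s b => SectionAlgebra.lift_of _ b
  { toFun := F
    map_zero' := map_zero F
    map_add' := map_add F
    map_smul' := fun k f => by
      show F (k • f) = k • F f
      induction f using SectionAlgebra.induction with
      | zero => rw [smul_zero, map_zero, smul_zero]
      | add f f' hf hf' => rw [smul_add, map_add, map_add, smul_add, hf, hf']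
      | of s a =>
        rw [← SectionAlgebra.of_smul, hF, hF]
        show R.π (k • (a : B)) * _ = _
        rw [map_smul, smul_mul_assoc]
    map_mul' := fun f g => by
      induction f using SectionAlgebra.induction with
      | zero => rw [zero_mul, map_zero, zero_mul]
      | add f f' hf hf' => rw [add_mul, map_add, map_add, add_mul, hf, hf']
      | of s a =>
        induction g using SectionAlgebra.induction with
        | zero => rw [mul_zero, map_zero, mul_zero]
        | add f f' hf hf' => rw [mul_add, map_add, map_add, mul_add, hf, hf']
        | of t b =>
          rw [SectionAlgebra.of_mul_of, hF, hF, hF, R.U_mul]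
          have ha := (β s).maps_symm a
          have hab := β.mulGen_maps a b
          have h1 : R.π a * R.U s = R.U s * R.π ((β s).equiv.symm a : B) := by
            rw [← R.covariant_maps ha, mul_assoc, mul_assoc, R.mul_initial ha]
          rw [← R.covariant_maps hab, h1]
          have h2 := R.mul_initial hab
          calc R.U s * R.π (((β s).equiv.symm a : B) * b) * star (R.U s) * (R.U s * R.U t)
              = R.U s * (R.π (((β s).equiv.symm a : B) * b) * (star (R.U s) * R.U s)) * R.U t := by
                simp only [mul_assoc]
            _ = _ := by rw [h2, map_mul]; simp only [mul_assoc]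
    map_star' := fun f => by
      show F (star f) = star (F f)
      induction f using SectionAlgebra.induction with
      | zero => rw [star_zero, map_zero, star_zero]
      | add f f' hf hf' => rw [star_add, map_add, map_add, star_add, hf, hf']
      | of s a =>
        rw [SectionAlgebra.star_of, hF, hF, R.U_star, star_mul, ← map_star]
        have ha := β.maps_star.mp (β.starGen_maps a)
        rw [← R.covariant_maps ha, ← mul_assoc, ← mul_assoc, R.initial_mul ha] }

theorem integratedForm_of {s : S} (b : β.Fib s) :
    R.integratedForm (SectionAlgebra.of β b) = R.π b * R.U s :=
  SectionAlgebra.lift_of (fun s => AddMonoidHom.mk' (fun b : β.Fib s => R.π b * R.U s) _) b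

end CovariantRep

/-- The C*-seminorms `f ↦ ‖Π f‖`, where `Π` runs over the integrated forms of the covariant
representations of `β`. -/
def covariantSeminorms : Set (CStarSeminorm β.SectionAlgebra) :=
  {p | ∃ (H : Type u) (_ : NormedAddCommGroup H) (_ : InnerProductSpace ℂ H) (_ : CompleteSpace H)
    (R : β.CovariantRep H), p = CStarSeminorm.ofRepresentation R.integratedForm}

/-- The crossed product of `B` by the action `β` of `S`. -/
abbrev CrossedProduct : Type u := (CStarSeminorm.sup β.covariantSeminorms).HausdorffCompletion

end
end InverseSemigroupAction

/-! ### Groupoids -/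

/-- A groupoid, presented by its set `G` of arrows: the units are the arrows `dom x`, `rng x`,
and `comp x y h` is the product of the composable pair `(x, y)`. -/
class ArrowGroupoid (G : Type u) where
  dom : G → G
  rng : G → G
  inv : G → G
  comp : ∀ x y : G, dom x = rng y → G
  dom_dom : ∀ x, dom (dom x) = dom x
  rng_dom : ∀ x, rng (dom x) = dom x
  dom_rng : ∀ x, dom (rng x) = rng x
  rng_rng : ∀ x, rng (rng x) = rng x
  dom_comp : ∀ x y h, dom (comp x y h) = dom y
  rng_comp : ∀ x y h, rng (comp x y h) = rng x
  comp_assoc : ∀ x y z (h : dom x = rng y) (h' : dom y = rng z),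
    comp (comp x y h) z ((dom_comp x y h).trans h') =
      comp x (comp y z h') (h.trans (rng_comp y z h').symm)
  rng_comp_self : ∀ x, comp (rng x) x (dom_rng x) = x
  comp_dom_self : ∀ x, comp x (dom x) (rng_dom x).symm = x
  dom_inv : ∀ x, dom (inv x) = rng x
  rng_inv : ∀ x, rng (inv x) = dom x
  inv_comp : ∀ x, comp (inv x) x (dom_inv x) = dom x
  comp_inv : ∀ x, comp x (inv x) (rng_inv x).symm = rng x

open ArrowGroupoid

/-- The unit space `G⁰`. -/
def unitSpace (G : Type u) [ArrowGroupoid G] : Set G := {u | rng u = u}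

/-- An `r`-discrete groupoid: a locally compact Hausdorff topological groupoid whose range and
domain maps are local homeomorphisms onto the unit space. -/
class IsRDiscrete (G : Type u) [TopologicalSpace G] [ArrowGroupoid G] : Prop where
  t2 : T2Space G
  locallyCompact : LocallyCompactSpace G
  continuous_comp : Continuous
    fun q : {q : G × G // dom q.1 = rng q.2} => comp q.1.1 q.1.2 q.2
  continuous_inv : Continuous (inv : G → G)
  isLocalHomeomorph_rng : IsLocalHomeomorph fun x : G => (⟨rng x, rng_rng x⟩ : unitSpace G)
  isLocalHomeomorph_dom : IsLocalHomeomorph fun x : G => (⟨dom x, rng_dom x⟩ : unitSpace G)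

namespace ArrowGroupoid

section Algebra

variable {G : Type u} [ArrowGroupoid G]

theorem comp_congr {x x' y y' : G} (hx : x = x') (hy : y = y') (h : dom x = rng y)
    (h' : dom x' = rng y') : comp x y h = comp x' y' h' := by subst hx; subst hy; rfl

theorem inv_comp_cancel (x y : G) (h : dom x = rng y) :
    comp (inv x) (comp x y h) ((dom_inv x).trans (rng_comp x y h).symm) = y := by
  rw [← comp_assoc (inv x) x y (dom_inv x) h]
  exact (comp_congr ((inv_comp x).trans h) rfl _ (dom_rng y)).trans (rng_comp_self y)

theorem comp_inv_cancel (x y : G) (h : rng x = rng y) :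
    comp x (comp (inv x) y ((dom_inv x).trans h))
      ((rng_inv x).symm.trans (rng_comp _ _ _).symm) = y := by
  rw [← comp_assoc x (inv x) y (rng_inv x).symm ((dom_inv x).trans h)]
  exact (comp_congr ((comp_inv x).trans h) rfl _ (dom_rng y)).trans (rng_comp_self y)

theorem comp_left_cancel {x y z : G} {h : dom x = rng y} {h' : dom x = rng z}
    (e : comp x y h = comp x z h') : y = z := by
  rw [← inv_comp_cancel x y h, ← inv_comp_cancel x z h']
  exact comp_congr rfl e _ _

theorem eq_inv_of_comp {x y : G} (h : dom x = rng y) (e : comp x y h = rng x) : y = inv x :=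
  comp_left_cancel (h := h) (h' := (rng_inv x).symm) (e.trans (comp_inv x).symm)

theorem inv_inv_arrow (x : G) : inv (inv x) = x :=
  (eq_inv_of_comp (dom_inv x) ((inv_comp x).trans (rng_inv x).symm)).symm

theorem inv_eq_of_comp_cancel (x y : G) (h : dom x = rng y) :
    inv (comp x y h) =
      comp (inv y) (inv x) ((dom_inv y).trans (h.symm.trans (rng_inv x).symm)) := by
  symm
  apply eq_inv_of_comp
  · rw [comp_assoc x y _ h (by rw [rng_comp, rng_inv])]
    have : comp y (comp (inv y) (inv x) ((dom_inv y).trans (h.symm.trans (rng_inv x).symm)))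
        (by rw [rng_comp, rng_inv]) = inv x :=
      comp_inv_cancel y (inv x) (h.symm.trans (rng_inv x).symm)
    exact (comp_congr rfl this _ (rng_inv x).symm).trans ((comp_inv x).trans (rng_comp x y h).symm)

theorem dom_eq_of_mem {u : G} (h : u ∈ unitSpace G) : dom u = u := by
  have h' : rng u = u := h
  rw [← h', dom_rng]

theorem inv_eq_of_mem {u : G} (h : u ∈ unitSpace G) : inv u = u := by
  have hr : rng u = u := h
  have hd := dom_eq_of_mem h
  symm
  apply eq_inv_of_comp (hd.trans hr.symm)
  exact (comp_congr hr.symm rfl _ (dom_rng u)).trans ((rng_comp_self u).trans hr.symm)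

/-- The product `A B = {x y : x ∈ A, y ∈ B, (x, y) composable}` of two subsets of a groupoid. -/
def setComp (A B : Set G) : Set G := {z | ∃ x ∈ A, ∃ y ∈ B, ∃ h : dom x = rng y, comp x y h = z}

theorem setComp_assoc (A B C : Set G) : setComp (setComp A B) C = setComp A (setComp B C) := by
  ext w
  constructor
  · rintro ⟨_, ⟨x, hx, y, hy, h, rfl⟩, z, hz, h', rfl⟩
    have h'' : dom y = rng z := (dom_comp x y h).symm.trans h'
    exact ⟨x, hx, _, ⟨y, hy, z, hz, h'', rfl⟩, h.trans (rng_comp y z h'').symm,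
      (comp_assoc x y z h h'').symm⟩
  · rintro ⟨x, hx, _, ⟨y, hy, z, hz, h', rfl⟩, h, rfl⟩
    have h'' : dom x = rng y := h.trans (rng_comp y z h')
    exact ⟨_, ⟨x, hx, y, hy, h'', rfl⟩, z, hz, (dom_comp x y h'').trans h',
      comp_assoc x y z h'' h'⟩

/-- A `G`-set: a subset of `G` on which the range and domain maps are injective. -/
def IsGSet (s : Set G) : Prop := Set.InjOn rng s ∧ Set.InjOn dom s

theorem IsGSet.comp {s t : Set G} (hs : IsGSet s) (ht : IsGSet t) : IsGSet (setComp s t) := by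
  constructor
  · rintro _ ⟨x, hx, y, hy, h, rfl⟩ _ ⟨x', hx', y', hy', h', rfl⟩ e
    rw [rng_comp, rng_comp] at e
    have hxx := hs.1 hx hx' e
    have hyy := ht.1 hy hy' (h.symm.trans ((congrArg dom hxx).trans h'))
    exact comp_congr hxx hyy _ _
  · rintro _ ⟨x, hx, y, hy, h, rfl⟩ _ ⟨x', hx', y', hy', h', rfl⟩ e
    rw [dom_comp, dom_comp] at e
    have hyy := ht.2 hy hy' e
    have hxx := hs.2 hx hx' (h.trans ((congrArg rng hyy).trans h'.symm))
    exact comp_congr hxx hyy _ _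

theorem IsGSet.inv {s : Set G} (hs : IsGSet s) : IsGSet {x | ArrowGroupoid.inv x ∈ s} := by
  constructor
  · intro x hx y hy e
    have := hs.2 hx hy (by rw [dom_inv, dom_inv, e])
    rw [← inv_inv_arrow x, this, inv_inv_arrow]
  · intro x hx y hy e
    have := hs.1 hx hy (by rw [rng_inv, rng_inv, e])
    rw [← inv_inv_arrow x, this, inv_inv_arrow]

theorem IsGSet.setComp_inv {s : Set G} (hs : IsGSet s) :
    setComp s {x | ArrowGroupoid.inv x ∈ s} = rng '' s := by
  ext z
  constructor
  · rintro ⟨x, hx, y, hy, h, rfl⟩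
    have hxy : x = ArrowGroupoid.inv y := hs.2 hx hy (by rw [dom_inv, h])
    refine ⟨x, hx, ?_⟩
    rw [← comp_inv x]
    exact comp_congr rfl (by rw [hxy, inv_inv_arrow]) _ _
  · rintro ⟨x, hx, rfl⟩
    exact ⟨x, hx, ArrowGroupoid.inv x, by simpa [inv_inv_arrow] using hx, (rng_inv x).symm, comp_inv x⟩

theorem setComp_of_subset_units {A : Set G} (B : Set G) (hA : A ⊆ unitSpace G) :
    setComp A B = {y | y ∈ B ∧ rng y ∈ A} := by
  ext z
  constructor
  · rintro ⟨x, hx, y, hy, h, rfl⟩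
    have hxy : x = rng y := (dom_eq_of_mem (hA hx)).symm.trans h
    have : comp x y h = y := (comp_congr hxy rfl _ (dom_rng y)).trans (rng_comp_self y)
    rw [this]
    exact ⟨hy, hxy ▸ hx⟩
  · rintro ⟨hz, hr⟩
    exact ⟨rng z, hr, z, hz, dom_rng z, rng_comp_self z⟩

theorem rng_image_subset (s : Set G) : rng '' s ⊆ unitSpace G := by
  rintro _ ⟨x, -, rfl⟩; exact rng_rng x

end Algebra

section Topology

variable {G : Type u} [TopologicalSpace G] [ArrowGroupoid G] [hG : IsRDiscrete G]

theorem continuous_rng : Continuous (rng : G → G) :=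
  continuous_subtype_val.comp hG.isLocalHomeomorph_rng.continuous

theorem continuous_dom : Continuous (dom : G → G) :=
  continuous_subtype_val.comp hG.isLocalHomeomorph_dom.continuous

/-- The range of an open neighbourhood of `y` contains the ranges of all arrows near any `x` with
the same range as `y`. -/
theorem exists_rng_nhds {V : Set G} (hV : IsOpen V) {X : Type*} [TopologicalSpace X] {a : X → G}
    (ha : Continuous a) {x : X} (hax : a x ∈ rng '' V) (hu : ∀ x, a x ∈ unitSpace G) :
    ∃ W : Set X, IsOpen W ∧ x ∈ W ∧ ∀ z ∈ W, a z ∈ rng '' V := by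
  have ho := hG.isLocalHomeomorph_rng.isOpenMap V hV
  refine ⟨_, ho.preimage (ha.subtype_mk hu), ?_, ?_⟩
  · obtain ⟨y, hy, e⟩ := hax
    exact ⟨y, hy, Subtype.ext e⟩
  · rintro z ⟨y, hy, e⟩
    exact ⟨y, hy, congrArg Subtype.val e⟩

/-- Every arrow has an open neighbourhood on which the range map is injective. -/
theorem exists_injOn_rng (x : G) : ∃ V : Set G, IsOpen V ∧ x ∈ V ∧ Set.InjOn rng V := by
  obtain ⟨e, hx, he⟩ := hG.isLocalHomeomorph_rng x
  refine ⟨e.source, e.open_source, hx, fun y hy z hz h => e.injOn hy hz ?_⟩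
  rw [← he]; exact Subtype.ext h

theorem continuous_ldiv : Continuous
    fun q : {q : G × G // rng q.1 = rng q.2} =>
      comp (inv q.1.1) q.1.2 ((dom_inv q.1.1).trans q.2) :=
  hG.continuous_comp.comp (f := fun q : {q : G × G // rng q.1 = rng q.2} =>
    (⟨(inv q.1.1, q.1.2), (dom_inv q.1.1).trans q.2⟩ : {q : G × G // dom q.1 = rng q.2}))
    (Continuous.subtype_mk ((hG.continuous_inv.comp (continuous_fst.comp
      continuous_subtype_val)).prodMk (continuous_snd.comp continuous_subtype_val)) _)

theorem isOpen_setComp {s t : Set G} (hs : IsOpen s) (ht : IsOpen t) : IsOpen (setComp s t) := by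
  rw [isOpen_iff_forall_mem_open]
  rintro _ ⟨x, hx, y, hy, h, rfl⟩
  have ho := ht.preimage (continuous_ldiv (G := G))
  obtain ⟨O, hO, hOe⟩ := isOpen_induced_iff.mp ho
  have hmem : (x, comp x y h) ∈ O := by
    have : (⟨(x, comp x y h), (rng_comp x y h).symm⟩ : {q : G × G // rng q.1 = rng q.2}) ∈
        Subtype.val ⁻¹' O := by
      rw [hOe]
      show comp _ _ _ ∈ t
      rw [inv_comp_cancel x y h]; exact hy
    exact this
  obtain ⟨V, W, hV, hW, hxV, hyW, hVW⟩ := isOpen_prod_iff.mp hO _ _ hmem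
  obtain ⟨W', hW', hyW', hr⟩ := exists_rng_nhds (hV.inter hs) (continuous_rng (G := G))
    (x := comp x y h) ⟨x, ⟨hxV, hx⟩, (rng_comp x y h).symm⟩ rng_rng
  refine ⟨W ∩ W', ?_, hW.inter hW', hyW, hyW'⟩
  rintro z ⟨hz, hz'⟩
  obtain ⟨x', ⟨hx'V, hx's⟩, e⟩ := hr z hz'
  have : (⟨(x', z), e⟩ : {q : G × G // rng q.1 = rng q.2}) ∈ Subtype.val ⁻¹' O := hVW ⟨hx'V, hz⟩
  rw [hOe] at this
  exact ⟨x', hx's, _, this, (rng_inv x').symm.trans (rng_comp _ _ _).symm,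
    comp_inv_cancel x' z e⟩

end Topology

end ArrowGroupoid

/-- The elements of `G^op`: the open `G`-sets of a groupoid `G`. -/
structure OpenGSet (G : Type u) [TopologicalSpace G] [ArrowGroupoid G] where
  carrier : Set G
  isOpen' : IsOpen carrier
  isGSet' : ArrowGroupoid.IsGSet carrier

namespace OpenGSet

variable {G : Type u} [TopologicalSpace G] [ArrowGroupoid G]

instance : CoeOut (OpenGSet G) (Set G) := ⟨carrier⟩

theorem ext' {s t : OpenGSet G} (h : (s : Set G) = t) : s = t := by
  cases s; cases t; cases h; rfl

/-- The open `G`-sets form an inverse semigroup, with the operations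
`s t = {x y : x ∈ s, y ∈ t, (x, y) composable}` and `s* = {x⁻¹ : x ∈ s}`. -/
instance [hG : IsRDiscrete G] : InverseSemigroup (OpenGSet G) where
  mul s t := ⟨setComp s t, isOpen_setComp s.isOpen' t.isOpen', s.isGSet'.comp t.isGSet'⟩
  mul_assoc s t v := ext' (setComp_assoc s.carrier t v)
  star s := ⟨{x | inv x ∈ s.carrier}, s.isOpen'.preimage hG.continuous_inv, s.isGSet'.inv⟩
  star_involutive s := ext' (by ext x; show inv (inv x) ∈ s.carrier ↔ _; rw [inv_inv_arrow])
  star_mul s t := ext' (by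
    ext z
    constructor
    · rintro ⟨x, hx, y, hy, h, e⟩
      have hz : z = inv (comp x y h) := by rw [e, inv_inv_arrow]
      refine ⟨inv y, by simpa [inv_inv_arrow] using hy, inv x, by simpa [inv_inv_arrow] using hx,
        (dom_inv y).trans (h.symm.trans (rng_inv x).symm), ?_⟩
      rw [hz, inv_eq_of_comp_cancel]
    · rintro ⟨x, hx, y, hy, h, rfl⟩
      exact ⟨inv y, hy, inv x, hx, (dom_inv y).trans (h.symm.trans (rng_inv x).symm),
        (inv_eq_of_comp_cancel x y h).symm⟩)
  mul_star_mul_self s := ext' (by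
    show setComp (setComp s.carrier {x | inv x ∈ s.carrier}) s = s
    rw [s.isGSet'.setComp_inv, setComp_of_subset_units _ (rng_image_subset _)]
    ext y
    exact ⟨fun h => h.1, fun h => ⟨h, y, h, rfl⟩⟩)
  range_idem_comm s t := ext' (by
    show setComp (setComp s.carrier {x | inv x ∈ s.carrier})
        (setComp t.carrier {x | inv x ∈ t.carrier}) =
      setComp (setComp t.carrier {x | inv x ∈ t.carrier})
        (setComp s.carrier {x | inv x ∈ s.carrier})
    rw [s.isGSet'.setComp_inv, t.isGSet'.setComp_inv,
      setComp_of_subset_units _ (rng_image_subset _),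
      setComp_of_subset_units _ (rng_image_subset _)]
    ext y
    constructor
    · rintro ⟨⟨x, hx, rfl⟩, h⟩
      rw [rng_rng] at h
      exact ⟨h, by rw [rng_rng]; exact ⟨x, hx, rfl⟩⟩
    · rintro ⟨⟨x, hx, rfl⟩, h⟩
      rw [rng_rng] at h
      exact ⟨h, by rw [rng_rng]; exact ⟨x, hx, rfl⟩⟩)

end OpenGSet

namespace InverseSubsemigroup

variable {G : Type u} [TopologicalSpace G] [ArrowGroupoid G] [IsRDiscrete G]

/-- The family of open sets `S` is a base for the topology of `G`. -/
def IsBase (S : InverseSubsemigroup (OpenGSet G)) : Prop :=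
  TopologicalSpace.IsTopologicalBasis (OpenGSet.carrier '' S.carrier)

/-- `S` is full: it is a base for the topology of `G`, and every two idempotents of `S` have a
common upper bound among the idempotents of `S`. -/
def IsFull (S : InverseSubsemigroup (OpenGSet G)) : Prop :=
  S.IsBase ∧ ∀ e f : S, e * e = e → f * f = f →
    ∃ g : S, g * g = g ∧ InverseSemigroup.NatLE e g ∧ InverseSemigroup.NatLE f g

/-- `S` is additive: it is a base for the topology of `G`, and it contains the union of any two of
its elements whenever this union is an open `G`-set. -/
def IsAdditive (S : InverseSubsemigroup (OpenGSet G)) : Prop :=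
  S.IsBase ∧ ∀ s t v : OpenGSet G, s ∈ S.carrier → t ∈ S.carrier →
    (v : Set G) = (s : Set G) ∪ (t : Set G) → v ∈ S.carrier

end InverseSubsemigroup

/-! ### The convolution algebra and the C*-algebra of an `r`-discrete groupoid -/

namespace ArrowGroupoid

section Ldiv

variable {G : Type u} [ArrowGroupoid G]

/-- The product `y⁻¹ x`, for `r(y) = r(x)`. -/
def ldiv (y x : G) (h : rng y = rng x) : G := comp (inv y) x ((dom_inv y).trans h)

theorem rng_ldiv (y x : G) (h : rng y = rng x) : rng (ldiv y x h) = dom y :=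
  (rng_comp _ _ _).trans (rng_inv y)

theorem dom_ldiv (y x : G) (h : rng y = rng x) : dom (ldiv y x h) = dom x := dom_comp _ _ _

theorem comp_ldiv (y x : G) (h : rng y = rng x) :
    comp y (ldiv y x h) (rng_ldiv y x h).symm = x := comp_inv_cancel y x h

theorem ldiv_comp (y x : G) (h : dom y = rng x) :
    ldiv y (comp y x h) (rng_comp y x h).symm = x := inv_comp_cancel y x h

theorem ldiv_eq_of_comp {y x z : G} {h : rng y = rng x} (h' : dom y = rng z)
    (e : comp y z h' = x) : ldiv y x h = z := by
  subst e; exact ldiv_comp y z h'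

theorem ldiv_ldiv (z y x : G) (hy : rng z = rng y) (hx : rng z = rng x) :
    ldiv (ldiv z y hy) (ldiv z x hx) ((rng_ldiv _ _ _).trans (rng_ldiv _ _ _).symm) =
      ldiv y x (hy.symm.trans hx) := by
  have h1 : dom (ldiv z y hy) = rng (ldiv y x (hy.symm.trans hx)) := by
    rw [dom_ldiv, rng_ldiv]
  refine ldiv_eq_of_comp h1 ?_
  symm
  refine ldiv_eq_of_comp ((rng_ldiv z y hy).symm.trans (rng_comp _ _ _).symm) ?_
  rw [← comp_assoc z _ _ (rng_ldiv z y hy).symm h1]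
  exact (comp_congr (comp_ldiv z y hy) rfl _ (rng_ldiv y x _).symm).trans (comp_ldiv y x _)

theorem inv_ldiv (y x : G) (h : rng y = rng x) : inv (ldiv y x h) = ldiv x y h.symm := by
  symm
  refine ldiv_eq_of_comp ((rng_inv _).trans (dom_ldiv y x h)).symm ?_
  have h2 : comp x (inv (ldiv y x h)) ((rng_inv _).trans (dom_ldiv y x h)).symm =
      comp (comp y (ldiv y x h) (rng_ldiv y x h).symm) (inv (ldiv y x h))
        ((dom_comp _ _ _).trans (rng_inv _).symm) :=
    comp_congr (comp_ldiv y x h).symm rfl _ _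
  rw [h2, comp_assoc y _ _ (rng_ldiv y x h).symm (rng_inv _).symm]
  exact (comp_congr rfl ((comp_inv _).trans (rng_ldiv y x h)) _ (rng_dom y).symm).trans
    (comp_dom_self y)

/-- The arrows with range `u`. -/
abbrev Fibre (u : G) : Type u := {y : G // rng y = u}

/-- Left translation by `z⁻¹`, from the arrows with range `r(z)` to the arrows with range `v`,
for `v = d(z)`. -/
def translate (z : G) {u v : G} (hu : rng z = u) (hv : dom z = v) : Fibre u ≃ Fibre v where
  toFun y := ⟨ldiv z y.1 (hu.trans y.2.symm), (rng_ldiv _ _ _).trans hv⟩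
  invFun w := ⟨comp z w.1 (hv.trans w.2.symm), (rng_comp _ _ _).trans hu⟩
  left_inv y := Subtype.ext (comp_ldiv z y.1 (hu.trans y.2.symm))
  right_inv w := Subtype.ext (ldiv_comp z w.1 (hv.trans w.2.symm))

/-- The convolution `(f g)(x) = ∑_{r(y) = r(x)} f(y) g(y⁻¹ x)`. -/
noncomputable def conv (f g : G → ℂ) (x : G) : ℂ :=
  ∑ᶠ y : Fibre (rng x), f y.1 * g (ldiv y.1 x y.2)

theorem conv_eq (f g : G → ℂ) {x u : G} (h : rng x = u) :
    conv f g x = ∑ᶠ y : Fibre u, f y.1 * g (ldiv y.1 x (y.2.trans h.symm)) := by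
  subst h; rfl

theorem conv_star (f g : G → ℂ) (x : G) :
    star (conv f g (inv x)) = conv (fun y => star (g (inv y))) (fun y => star (f (inv y))) x := by
  rw [conv_eq f g (rng_inv x), conv, ← finsum_comp_equiv (translate x rfl rfl)]
  show starAddEquiv _ = _
  rw [AddEquiv.map_finsum]
  refine finsum_congr fun w => ?_
  have h1 : rng (ldiv x w.1 w.2.symm) = rng (inv x) := (rng_ldiv _ _ _).trans (rng_inv x).symm
  have h2 : ldiv (ldiv x w.1 w.2.symm) (inv x) h1 = inv w.1 := by
    refine ldiv_eq_of_comp ((dom_ldiv _ _ _).trans (rng_inv _).symm) ?_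
    have h3 := inv_eq_of_comp_cancel w.1 (ldiv w.1 x w.2) (rng_ldiv _ _ _).symm
    have h4 : inv (comp w.1 (ldiv w.1 x w.2) (rng_ldiv _ _ _).symm) = inv x :=
      congrArg inv (comp_ldiv w.1 x w.2)
    rw [← h4, h3]
    exact comp_congr (inv_ldiv w.1 x w.2).symm rfl _ _
  show star (f (ldiv x w.1 w.2.symm) * g (ldiv (ldiv x w.1 w.2.symm) (inv x) h1)) = _
  rw [star_mul, inv_ldiv, h2]

end Ldiv

section Conv

variable {G : Type u} [TopologicalSpace G] [ArrowGroupoid G] [hG : IsRDiscrete G]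

theorem finite_fibre {K : Set G} (hK : IsCompact K) (u : G) : {y : Fibre u | y.1 ∈ K}.Finite := by
  choose V hVo hV hVi using exists_injOn_rng (G := G)
  obtain ⟨t, -, ht⟩ := hK.elim_nhds_subcover V fun x _ => (hVo x).mem_nhds (hV x)
  refine Set.Finite.subset (t.finite_toSet.biUnion
    (t := fun i => {y : Fibre u | y.1 ∈ V i}) fun i _ => Set.Subsingleton.finite ?_) ?_
  · intro y hy z hz
    exact Subtype.ext (hVi i hy hz (y.2.trans z.2.symm))
  · intro y hy
    obtain ⟨i, hi, hyi⟩ := Set.mem_iUnion₂.mp (ht hy)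
    exact Set.mem_iUnion₂.mpr ⟨i, hi, hyi⟩

/-- Summation over the fibres of the range map, of a continuous function which is properly
supported, gives a continuous function. -/
theorem continuous_fibreSum (F : {q : G × G // rng q.1 = rng q.2} → ℂ) (hF : Continuous F)
    {K : Set G} (hK : IsCompact K) (hFK : ∀ q, F q ≠ 0 → q.1.1 ∈ K) :
    Continuous fun x : G => ∑ᶠ y : Fibre (rng x), F ⟨(y.1, x), y.2⟩ := by
  classical
  have := hG.t2
  rw [continuous_iff_continuousAt]
  intro x₀
  have hfin := finite_fibre hK (rng x₀)
  set A : Finset (Fibre (rng x₀)) := hfin.toFinset with hA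
  obtain ⟨U, hU, hUd⟩ := (A.image Subtype.val).finite_toSet.t2_separation
  choose V hVo hV hVi using exists_injOn_rng (G := G)
  set W : G → Set G := fun y => U y ∩ V y with hW
  have hWo : ∀ y, IsOpen (W y) := fun y => (hU y).2.inter (hVo y)
  have hWy : ∀ y, y ∈ W y := fun y => ⟨(hU y).1, hV y⟩
  have hWi : ∀ y, Set.InjOn rng (W y) := fun y => (hVi y).mono Set.inter_subset_right
  -- the part of the sum over the arrows in `W y`
  set T : G → G → ℂ := fun y x =>
    ∑ᶠ z : Fibre (rng x), if z.1 ∈ W y then F ⟨(z.1, x), z.2⟩ else 0 with hT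
  have hTz : ∀ (y x : G) (z : Fibre (rng x)), z.1 ∈ W y → T y x = F ⟨(z.1, x), z.2⟩ := by
    intro y x z hz
    have h1 : T y x = if z.1 ∈ W y then F ⟨(z.1, x), z.2⟩ else 0 := by
      refine finsum_eq_single _ z fun z' hz' => if_neg fun h => hz' ?_
      exact Subtype.ext (hWi y h hz (z'.2.trans z.2.symm))
    rw [h1, if_pos hz]
  have hTc : ∀ y : Fibre (rng x₀), ContinuousAt (T y.1) x₀ := by
    intro y
    rw [ContinuousAt, hTz y.1 x₀ y (hWy y.1), tendsto_nhds]
    intro O hO hmem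
    obtain ⟨P, hP, hPe⟩ := isOpen_induced_iff.mp (hO.preimage hF)
    have hmP : (y.1, x₀) ∈ P := by
      have : (⟨(y.1, x₀), y.2⟩ : {q : G × G // rng q.1 = rng q.2}) ∈ Subtype.val ⁻¹' P := by
        rw [hPe]; exact hmem
      exact this
    obtain ⟨P₁, P₂, hP₁, hP₂, h₁, h₂, hPP⟩ := isOpen_prod_iff.mp hP _ _ hmP
    obtain ⟨N, hN, hxN, hr⟩ := exists_rng_nhds (hP₁.inter (hWo y.1)) (continuous_rng (G := G))
      (x := x₀) ⟨y.1, ⟨h₁, hWy y.1⟩, y.2⟩ rng_rng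
    filter_upwards [(hN.inter hP₂).mem_nhds ⟨hxN, h₂⟩] with x hx
    obtain ⟨z, ⟨hz₁, hzW⟩, e⟩ := hr x hx.1
    show T y.1 x ∈ O
    rw [hTz y.1 x ⟨z, e⟩ hzW]
    have : (⟨(z, x), e⟩ : {q : G × G // rng q.1 = rng q.2}) ∈ Subtype.val ⁻¹' P := hPP ⟨hz₁, hx.2⟩
    rw [hPe] at this
    exact this
  have hsum : ContinuousAt (fun x => ∑ y ∈ A, T y.1 x) x₀ :=
    tendsto_finsetSum _ fun y _ => hTc y
  refine hsum.congr ?_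
  -- near `x₀`, the fibres meet `K` only inside the sets `W y`
  have hK' : IsCompact (K \ ⋃ y ∈ A, W y.1) :=
    hK.diff (isOpen_biUnion fun y _ => hWo y.1)
  have hcl : IsClosed (rng '' (K \ ⋃ y ∈ A, W y.1)) := (hK'.image continuous_rng).isClosed
  have hnot : rng x₀ ∉ rng '' (K \ ⋃ y ∈ A, W y.1) := by
    rintro ⟨y, ⟨hyK, hy⟩, e⟩
    refine hy (Set.mem_iUnion₂.mpr ⟨⟨y, e⟩, ?_, hWy y⟩)
    rw [hA, Set.Finite.mem_toFinset]; exact hyK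
  filter_upwards [(hcl.isOpen_compl.preimage (continuous_rng (G := G))).mem_nhds hnot] with x hx
  rw [← finsum_sum_comm]
  · refine finsum_congr fun z => ?_
    by_cases hz : F ⟨(z.1, x), z.2⟩ = 0
    · rw [hz]; exact Finset.sum_eq_zero fun y _ => by simp
    · have hzK := hFK _ hz
      have hzW : z.1 ∈ ⋃ y ∈ A, W y.1 := by
        by_contra h
        exact hx ⟨z.1, ⟨hzK, h⟩, z.2⟩
      obtain ⟨y, hyA, hy⟩ := Set.mem_iUnion₂.mp hzW
      rw [Finset.sum_eq_single y, if_pos hy]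
      · intro y' hy' hne
        refine if_neg fun h => ?_
        have hd := hUd (Finset.mem_coe.mpr (Finset.mem_image_of_mem _ hy'))
          (Finset.mem_coe.mpr (Finset.mem_image_of_mem _ hyA)) (fun e => hne (Subtype.ext e))
        exact Set.disjoint_left.mp hd h.1 hy.1
      · intro h; exact absurd hyA h
  · intro y _
    refine Set.Subsingleton.finite ?_
    intro z hz z' hz'
    have h1 : z.1 ∈ W y.1 := by by_contra h; exact hz (if_neg h)
    have h2 : z'.1 ∈ W y.1 := by by_contra h; exact hz' (if_neg h)
    exact Subtype.ext (hWi _ h1 h2 (z.2.trans z'.2.symm))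

theorem finite_conv (f g : C_c(G, ℂ)) (x u : G) (h : rng x = u) :
    (Function.support fun y : Fibre u => f y.1 * g (ldiv y.1 x (y.2.trans h.symm))).Finite := by
  refine (finite_fibre f.hasCompactSupport u).subset fun y hy => ?_
  exact subset_tsupport _ (left_ne_zero_of_mul hy)

theorem finite_ldiv {K : Set G} (hK : IsCompact K) (x u : G) (h : rng x = u) :
    {y : Fibre u | ldiv y.1 x (y.2.trans h.symm) ∈ K}.Finite := by
  have hf := finite_fibre (hK.image hG.continuous_inv) (dom x)
  refine ((hf.preimage (translate x h rfl).injective.injOn)).subset fun y hy => ?_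
  refine ⟨_, hy, ?_⟩
  rw [inv_ldiv]; rfl

theorem hasCompactSupport_conv (f g : C_c(G, ℂ)) : HasCompactSupport (conv f g) := by
  have := hG.t2
  have hcl : IsClosed {q : G × G | dom q.1 = rng q.2} :=
    isClosed_eq (continuous_dom.comp continuous_fst) (continuous_rng.comp continuous_snd)
  have hc : IsCompact ((Subtype.val : {q : G × G // dom q.1 = rng q.2} → G × G) ⁻¹'
      (tsupport f ×ˢ tsupport g)) :=
    hcl.isClosedEmbedding_subtypeVal.isCompact_preimage
      (f.hasCompactSupport.isCompact.prod g.hasCompactSupport.isCompact)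
  refine HasCompactSupport.intro (hc.image hG.continuous_comp) fun x hx => ?_
  refine finsum_eq_zero_of_forall_eq_zero fun y => ?_
  by_contra hne
  refine hx ⟨⟨(y.1, ldiv y.1 x y.2), (rng_ldiv y.1 x y.2).symm⟩, ⟨?_, ?_⟩, comp_ldiv y.1 x y.2⟩
  · exact subset_tsupport _ (left_ne_zero_of_mul hne)
  · exact subset_tsupport _ (right_ne_zero_of_mul hne)

theorem continuous_conv (f g : C_c(G, ℂ)) : Continuous (conv f g) := by
  refine continuous_fibreSum (fun q => f q.1.1 * g (ldiv q.1.1 q.1.2 q.2)) ?_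
    f.hasCompactSupport.isCompact fun q hq => subset_tsupport _ (left_ne_zero_of_mul hq)
  exact (f.continuous.comp (continuous_fst.comp continuous_subtype_val)).mul
    (g.continuous.comp continuous_ldiv)

theorem conv_assoc (f g h : C_c(G, ℂ)) (fg gh : C_c(G, ℂ)) (hfg : ⇑fg = conv f g)
    (hgh : ⇑gh = conv g h) (x : G) : conv fg h x = conv f gh x := by
  have e1 : ∀ y : Fibre (rng x), fg y.1 * h (ldiv y.1 x y.2) =
      ∑ᶠ z : Fibre (rng x), f z.1 * g (ldiv z.1 y.1 (z.2.trans y.2.symm)) *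
        h (ldiv y.1 x y.2) := by
    intro y
    rw [hfg, conv_eq f g y.2, finsum_mul]
  have e2 : ∀ z : Fibre (rng x), f z.1 * gh (ldiv z.1 x z.2) =
      ∑ᶠ y : Fibre (rng x), f z.1 * g (ldiv z.1 y.1 (z.2.trans y.2.symm)) *
        h (ldiv y.1 x y.2) := by
    intro z
    rw [hgh, conv_eq g h (rng_ldiv z.1 x z.2), mul_finsum,
      ← finsum_comp_equiv (translate z.1 z.2 rfl)]
    refine finsum_congr fun y => ?_
    rw [mul_assoc]
    refine congrArg (fun t => f z.1 * (g _ * t)) ?_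
    exact congrArg h (ldiv_ldiv z.1 y.1 x (z.2.trans y.2.symm) z.2)
  rw [conv, conv, finsum_congr e1, finsum_congr e2]
  have hs : (Function.support fun q : Fibre (rng x) × Fibre (rng x) =>
      f q.2.1 * g (ldiv q.2.1 q.1.1 (q.2.2.trans q.1.2.symm)) * h (ldiv q.1.1 x q.1.2)).Finite := by
    refine ((finite_ldiv h.hasCompactSupport.isCompact x _ rfl).prod
      (finite_fibre f.hasCompactSupport.isCompact (rng x))).subset fun q hq => ⟨?_, ?_⟩
    · exact subset_tsupport _ (right_ne_zero_of_mul hq)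
    · exact subset_tsupport _ (left_ne_zero_of_mul (left_ne_zero_of_mul hq))
  rw [← finsum_curry (fun q : Fibre (rng x) × Fibre (rng x) => f q.2.1 *
      g (ldiv q.2.1 q.1.1 (q.2.2.trans q.1.2.symm)) * h (ldiv q.1.1 x q.1.2)) hs,
    ← finsum_comp_equiv (Equiv.prodComm _ _),
    ← finsum_curry (fun q : Fibre (rng x) × Fibre (rng x) => f q.1.1 *
      g (ldiv q.1.1 q.2.1 (q.1.2.trans q.2.2.symm)) * h (ldiv q.2.1 x q.2.2))]
  · rfl
  · exact (hs.preimage (Equiv.prodComm _ _).injective.injOn)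

end Conv

end ArrowGroupoid

/-- The *-algebra of continuous compactly supported complex functions on an `r`-discrete groupoid,
under convolution. -/
def ConvolutionAlgebra (G : Type u) [TopologicalSpace G] : Type u := C_c(G, ℂ)

namespace ConvolutionAlgebra

noncomputable section

variable {G : Type u} [TopologicalSpace G]

instance : AddCommGroup (ConvolutionAlgebra G) := inferInstanceAs (AddCommGroup C_c(G, ℂ))
instance : Module ℂ (ConvolutionAlgebra G) := inferInstanceAs (Module ℂ C_c(G, ℂ))
instance : FunLike (ConvolutionAlgebra G) G ℂ := inferInstanceAs (FunLike C_c(G, ℂ) G ℂ)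

/-- The function underlying an element of the convolution algebra. -/
def toCc (f : ConvolutionAlgebra G) : C_c(G, ℂ) := f

theorem ext' {f g : ConvolutionAlgebra G} (h : ∀ x, f x = g x) : f = g := DFunLike.ext _ _ h

theorem add_apply (f g : ConvolutionAlgebra G) (x : G) : (f + g) x = f x + g x := rfl
theorem zero_apply (x : G) : (0 : ConvolutionAlgebra G) x = 0 := rfl
theorem smul_apply (k : ℂ) (f : ConvolutionAlgebra G) (x : G) : (k • f) x = k * f x := rfl

variable [ArrowGroupoid G] [hG : IsRDiscrete G]

/-- `(f g)(x) = ∑_{r(y) = r(x)} f(y) g(y⁻¹ x)`. -/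
instance : Mul (ConvolutionAlgebra G) :=
  ⟨fun f g => (⟨⟨conv f g, continuous_conv f.toCc g.toCc⟩,
    hasCompactSupport_conv f.toCc g.toCc⟩ : C_c(G, ℂ))⟩

/-- `f*(x) = conj (f(x⁻¹))`. -/
instance : Star (ConvolutionAlgebra G) :=
  ⟨fun f => (⟨⟨fun x => star (f (inv x)),
      continuous_star.comp (f.toCc.continuous.comp hG.continuous_inv)⟩, by
    have := hG.t2
    refine HasCompactSupport.intro
      (f.toCc.hasCompactSupport.isCompact.image hG.continuous_inv) fun x hx => ?_
    show star (f (inv x)) = 0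
    rw [star_eq_zero]
    by_contra hne
    exact hx ⟨inv x, subset_tsupport _ hne, inv_inv_arrow x⟩⟩ : C_c(G, ℂ))⟩

theorem mul_apply (f g : ConvolutionAlgebra G) (x : G) : (f * g) x = conv f g x := rfl
theorem star_apply (f : ConvolutionAlgebra G) (x : G) : (star f) x = star (f (inv x)) := rfl

instance : NonUnitalRing (ConvolutionAlgebra G) :=
  { (inferInstance : AddCommGroup (ConvolutionAlgebra G)),
    (inferInstance : Mul (ConvolutionAlgebra G)) with
    zero_mul := fun f => ext' fun x => by
      rw [mul_apply]
      exact finsum_eq_zero_of_forall_eq_zero fun y => by rw [zero_apply, zero_mul]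
    mul_zero := fun f => ext' fun x => by
      rw [mul_apply]
      exact finsum_eq_zero_of_forall_eq_zero fun y => by rw [zero_apply, mul_zero]
    left_distrib := fun f g h => ext' fun x => by
      rw [add_apply, mul_apply, mul_apply, mul_apply]
      refine Eq.trans ?_ (finsum_add_distrib (finite_conv f.toCc g.toCc x _ rfl)
          (finite_conv f.toCc h.toCc x _ rfl))
      exact finsum_congr fun y => mul_add (f y.1) _ _
    right_distrib := fun f g h => ext' fun x => by
      rw [add_apply, mul_apply, mul_apply, mul_apply]
      refine Eq.trans ?_ (finsum_add_distrib (finite_conv f.toCc h.toCc x _ rfl)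
          (finite_conv g.toCc h.toCc x _ rfl))
      exact finsum_congr fun y => add_mul (f y.1) (g y.1) _
    mul_assoc := fun f g h => ext' fun x =>
      conv_assoc f.toCc g.toCc h.toCc (f * g).toCc (g * h).toCc rfl rfl x }

instance : StarRing (ConvolutionAlgebra G) where
  star_involutive f := ext' fun x => by
    rw [star_apply, star_apply, inv_inv_arrow, star_star]
  star_mul f g := ext' fun x => conv_star f g x
  star_add f g := ext' fun x => star_add _ _

instance : IsScalarTower ℂ (ConvolutionAlgebra G) (ConvolutionAlgebra G) where
  smul_assoc k f g := ext' fun x => by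
    rw [smul_eq_mul, smul_eq_mul, smul_apply, mul_apply, mul_apply, conv, conv, mul_finsum]
    exact finsum_congr fun y => by rw [smul_apply, mul_assoc]

instance : SMulCommClass ℂ (ConvolutionAlgebra G) (ConvolutionAlgebra G) where
  smul_comm k f g := ext' fun x => by
    rw [smul_eq_mul, smul_eq_mul, smul_apply, mul_apply, mul_apply, conv, conv, mul_finsum]
    exact finsum_congr fun y => by rw [smul_apply, mul_left_comm]

instance : StarModule ℂ (ConvolutionAlgebra G) where
  star_smul k f := ext' fun x => by
    rw [star_apply, smul_apply, smul_apply, star_mul', star_apply]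

/-- A representation of the convolution algebra is continuous from the inductive limit topology to
the weak operator topology: for every compact `K`, each matrix coefficient is continuous, in the
supremum norm, on the space of functions supported in `K`. -/
def IsInductiveLimitContinuous {H : Type u} [NormedAddCommGroup H] [InnerProductSpace ℂ H]
    [CompleteSpace H] (ρ : ConvolutionAlgebra G →⋆ₙₐ[ℂ] (H →L[ℂ] H)) : Prop :=
  ∀ K : Set G, IsCompact K → ∀ ξ η : H, ∀ ε > 0, ∃ δ > 0, ∀ f g : ConvolutionAlgebra G,
    tsupport f ⊆ K → tsupport g ⊆ K → (∀ x, ‖f x - g x‖ < δ) →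
      ‖inner ℂ (ρ f ξ) η - inner ℂ (ρ g ξ) η‖ < ε

/-- The C*-seminorms `f ↦ ‖ρ f‖`, where `ρ` runs over the representations which are continuous from
the inductive limit topology to the weak operator topology. -/
def continuousSeminorms (G : Type u) [TopologicalSpace G] [ArrowGroupoid G] [IsRDiscrete G] :
    Set (CStarSeminorm (ConvolutionAlgebra G)) :=
  {p | ∃ (H : Type u) (_ : NormedAddCommGroup H) (_ : InnerProductSpace ℂ H) (_ : CompleteSpace H)
    (ρ : ConvolutionAlgebra G →⋆ₙₐ[ℂ] (H →L[ℂ] H)),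
    IsInductiveLimitContinuous ρ ∧ p = CStarSeminorm.ofRepresentation ρ}

end

end ConvolutionAlgebra

/-- The C*-algebra `C*(G)` of an `r`-discrete groupoid. -/
noncomputable abbrev GroupoidCStarAlgebra (G : Type u) [TopologicalSpace G] [ArrowGroupoid G]
    [IsRDiscrete G] : Type u :=
  (CStarSeminorm.sup (ConvolutionAlgebra.continuousSeminorms G)).HausdorffCompletion

/-- `β` is the canonical action of the inverse semigroup `S` of open `G`-sets on `C₀(G⁰)`: the
domain of `β_s` is `B_{d(s)}`, the ideal of the functions that vanish off `d(s)`, and for `f` in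
this domain `β_s(f)(u)` is `f(s*us)` if `u ∈ r(s)` (where the set `s*us` consists of one unit `v`)
and is `0` otherwise. -/
def IsCanonicalAction {G : Type u} [TopologicalSpace G] [ArrowGroupoid G] [IsRDiscrete G]
    {S : InverseSubsemigroup (OpenGSet G)}
    (β : InverseSemigroupAction S C₀(unitSpace G, ℂ)) : Prop :=
  ∀ s : S,
    (∀ f : C₀(unitSpace G, ℂ), f ∈ (β s).Dom ↔
      ∀ u : unitSpace G, (u : G) ∉ (InverseSemigroup.d s.1).carrier → f u = 0) ∧
    ∀ (f : (β s).Dom) (u : unitSpace G),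
      ((u : G) ∈ (InverseSemigroup.r s.1).carrier → ∀ v : unitSpace G,
        setComp (setComp (star s.1).carrier {(u : G)}) s.1.carrier = {(v : G)} →
        ((β s).equiv f : C₀(unitSpace G, ℂ)) u = (f : C₀(unitSpace G, ℂ)) v) ∧
      ((u : G) ∉ (InverseSemigroup.r s.1).carrier →
        ((β s).equiv f : C₀(unitSpace G, ℂ)) u = 0)

/-! ### Suprema of C*-seminorms and extension of *-homomorphisms -/

namespace CStarSeminorm

variable {D : Type u} [NonUnitalRing D] [StarRing D] [Module ℂ D] {P : Set (CStarSeminorm D)}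

/-! A function with compact support inside an open G-set s is, read through the chart r : s → r(s),
a function on r(s), hence an element of the ideal B_{r(s)}. Under this reading (`fibreSum`),
convolution and involution become the product and adjoint of the generators (b, s) of the crossed
product (`transports_mul`, `transports_star`). Partitions of unity write every element of C_c(G) as
a finite sum of functions supported in members of S. Formal sums carry more information than
functions, since the same b over w ⊆ s gives two generators (b, w) and (b, s). Covariant
representations do not see the difference: w = w w* s forces π(b)U_w = π(b)U_s (`mul_U_of_subset`).
The local maps therefore glue (`IsCompatible.exists_glue`) to a *-homomorphism Ψ from C_c(G) to the
crossed product, and its range is dense because C_c(s) is dense in B_{r(s)}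
(`exists_fibreSum_near`).

The isomorphism follows once ‖Ψ f‖ is the norm of f in C*(G) (`norm_toCrossedProduct`). A covariant
representation pulls back along Ψ to a representation of C_c(G). Conversely, a nondegenerate
representation ρ is disintegrated: π extends ρ from the functions on the open unit space, and U_s is
the strong limit of ρ(f) as f runs through bump functions tending to 1 on s (`convergent_eq_top`,
`limOp`). The identity π(f)U_s = ρ(f), for f supported in s, recovers ρ (`map_fibreSum_mul_limOp`).

The estimates are automatic. If f lives on a G-set, then f*f lives on the unit space, where the
algebra is commutative and spectra can be computed by hand; so ‖ρ(f)‖ ≤ sup|f| for every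
representation (`norm_map_le`). This makes the suprema over representations of C_c(G) finite and
every representation continuous for the inductive limit topology.

The action itself is transport of functions along s, extended by zero. Vanishing at infinity keeps
the extension continuous (`exists_transports`). Fullness makes the domains directed and lets one
idempotent cover any nonempty compact set of units, which gives density. Uniqueness holds because a
partial automorphism is determined by its graph. -/

theorem sup_apply (h : PointwiseBounded P) (a : D) : sup P a = ⨆ p : P, p.1 a := by
  rw [sup, dif_pos h]; rfl

theorem le_sup (h : PointwiseBounded P) {p : CStarSeminorm D} (hp : p ∈ P) (a : D) :
    p a ≤ sup P a := by
  rw [sup_apply h]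
  have hb : BddAbove (Set.range fun p : P => p.1 a) :=
    (h a).mono (by rintro _ ⟨p, rfl⟩; exact ⟨p.1, p.2, rfl⟩)
  exact le_ciSup hb ⟨p, hp⟩

theorem sup_le (h : PointwiseBounded P) {a : D} {c : ℝ} (hc : 0 ≤ c) (hP : ∀ p ∈ P, p a ≤ c) :
    sup P a ≤ c := by
  rw [sup_apply h]
  exact Real.iSup_le (fun p => hP p.1 p.2) hc

/-- The canonical *-homomorphism of a *-algebra into its Hausdorff completion. -/
noncomputable def mkHom [IsScalarTower ℂ D D] [SMulCommClass ℂ D D] [StarModule ℂ D]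
    (p : CStarSeminorm D) : D →⋆ₙₐ[ℂ] p.HausdorffCompletion where
  toFun := HausdorffCompletion.mk p
  map_zero' := rfl
  map_add' := HausdorffCompletion.mk_add p
  map_smul' := HausdorffCompletion.mk_smul p
  map_mul' := HausdorffCompletion.mk_mul p
  map_star' := HausdorffCompletion.mk_star p

theorem norm_mkHom [IsScalarTower ℂ D D] [SMulCommClass ℂ D D] [StarModule ℂ D]
    (p : CStarSeminorm D) (a : D) : ‖mkHom p a‖ = p a := HausdorffCompletion.norm_mk p a

theorem denseRange_mkHom [IsScalarTower ℂ D D] [SMulCommClass ℂ D D] [StarModule ℂ D]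
    (p : CStarSeminorm D) : DenseRange (mkHom p) := HausdorffCompletion.denseRange_mk p

end CStarSeminorm

section Extension

variable {A B C : Type*} [NonUnitalRing A] [StarRing A] [Module ℂ A]
  [NonUnitalCStarAlgebra B] [NonUnitalCStarAlgebra C]

/-- A *-homomorphism which is dominated by another one, with dense range, factors through it. -/
theorem exists_extension (i : A →⋆ₙₐ[ℂ] B) (hi : DenseRange i) (φ : A →⋆ₙₐ[ℂ] C)
    (h : ∀ a, ‖φ a‖ ≤ ‖i a‖) : ∃ ψ : B →⋆ₙₐ[ℂ] C, ∀ a, ψ (i a) = φ a := by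
  let iL : A →ₗ[ℂ] B := ⟨⟨i, map_add i⟩, map_smul i⟩
  let fL : A →ₗ[ℂ] C := ⟨⟨φ, map_add φ⟩, map_smul φ⟩
  have hd : DenseRange iL := hi
  set Ψ : B →L[ℂ] C := fL.extendOfNorm iL
  have hΨ : ∀ a, Ψ (i a) = φ a := fun a =>
    LinearMap.extendOfNorm_eq (f := fL) (e := iL) hd ⟨1, fun x => by simpa using! h x⟩ a
  refine ⟨{ toFun := Ψ
            map_zero' := map_zero Ψ
            map_add' := map_add Ψ
            map_smul' := map_smul Ψ
            map_mul' := fun x y => ?_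
            map_star' := fun x => ?_ }, hΨ⟩
  · refine hi.induction_on₂ (p := fun x y => Ψ (x * y) = Ψ x * Ψ y) ?_ ?_ x y
    · exact isClosed_eq (by fun_prop) (by fun_prop)
    · intro a b
      rw [← map_mul, hΨ, hΨ, hΨ, map_mul]
  · refine hi.induction_on (p := fun x => Ψ (star x) = star (Ψ x)) x ?_ ?_
    · exact isClosed_eq (by fun_prop) (by fun_prop)
    · intro a
      rw [← map_star, hΨ, hΨ, map_star]

/-- Two C*-algebras that contain the same *-algebra densely, with the same norm, are isomorphic. -/
theorem nonempty_starAlgEquiv (i : A →⋆ₙₐ[ℂ] B) (hi : DenseRange i) (φ : A →⋆ₙₐ[ℂ] C)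
    (hφ : DenseRange φ) (h : ∀ a, ‖φ a‖ = ‖i a‖) : Nonempty (B ≃⋆ₐ[ℂ] C) := by
  obtain ⟨ψ, hψ⟩ := exists_extension i hi φ fun a => (h a).le
  have hc : Continuous ψ := by
    refine AddMonoidHomClass.continuous_of_bound ψ 1 fun x => ?_
    rw [one_mul]; exact NonUnitalStarAlgHom.norm_apply_le ψ x
  have hn : ∀ x, ‖ψ x‖ = ‖x‖ := fun x =>
    hi.induction_on (p := fun x => ‖ψ x‖ = ‖x‖) x (isClosed_eq hc.norm continuous_norm)
      fun a => by rw [hψ, h]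
  have hiso : Isometry ψ := AddMonoidHomClass.isometry_of_norm ψ hn
  refine ⟨StarAlgEquiv.ofBijective ψ ⟨hiso.injective, ?_⟩⟩
  -- The isometric image of a complete space is closed. It contains the dense range of `φ`, so it is
  -- everything.
  have hcl := hiso.isClosedEmbedding.isClosed_range
  have hd : Dense (Set.range ψ) := hφ.mono (by rintro _ ⟨a, rfl⟩; exact ⟨i a, hψ a⟩)
  rw [← Set.range_eq_univ, ← hcl.closure_eq, hd.closure_eq]

end Extension

/-! ### Restriction of a representation to its essential subspace -/

section Essential

variable {D : Type*} [NonUnitalRing D] [StarRing D] [Module ℂ D]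
  {H : Type u} [NormedAddCommGroup H] [InnerProductSpace ℂ H] [CompleteSpace H]

open ContinuousLinearMap in
/-- Every representation has the same norms as its restriction to the essential subspace. -/
theorem exists_nondegenerate (ρ : D →⋆ₙₐ[ℂ] (H →L[ℂ] H)) :
    ∃ (K : Type u) (_ : NormedAddCommGroup K) (_ : InnerProductSpace ℂ K) (_ : CompleteSpace K)
      (σ : D →⋆ₙₐ[ℂ] (K →L[ℂ] K)), (∀ a, ‖ρ a‖ ≤ ‖σ a‖) ∧
      Dense (Submodule.span ℂ {ξ : K | ∃ a η, ξ = σ a η} : Set K) := by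
  set V : Submodule ℂ H :=
    (Submodule.span ℂ {ξ : H | ∃ a η, ξ = ρ a η}).topologicalClosure with hV
  have : CompleteSpace V := (Submodule.isClosed_topologicalClosure _).completeSpace_coe
  set P : H →L[ℂ] V := V.orthogonalProjectionOnto with hP
  have hmem : ∀ a η, ρ a η ∈ V := fun a η =>
    Submodule.le_topologicalClosure _ (Submodule.subset_span ⟨a, η, rfl⟩)
  have hPmem : ∀ a η, ((P (ρ a η) : V) : H) = ρ a η := fun a η => by
    rw [hP, Submodule.coe_orthogonalProjectionOnto_apply]
    exact Submodule.starProjection_eq_self_iff.mpr (hmem a η)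
  have hadj : adjoint V.subtypeL = P := V.adjoint_subtypeL
  -- `ρ a` kills the orthogonal complement of `V`: for ξ in it, ‖ρ(a)ξ‖² = ⟨ξ, ρ(a*)ρ(a)ξ⟩ = 0, as
  -- ρ(a*)ρ(a)ξ lies in `V`.
  have hright : ∀ a η, ρ a ((P η : V) : H) = ρ a η := fun a η => by
    rw [eq_comm, ← sub_eq_zero, ← map_sub, ← inner_self_eq_zero (𝕜 := ℂ), ← adjoint_inner_right,
      ← star_eq_adjoint, ← map_star]
    have h1 : η - ((P η : V) : H) ∈ Vᗮ := V.sub_starProjection_mem_orthogonal η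
    have h2 := (Submodule.mem_orthogonal _ _).mp h1 _ (hmem (star a) (ρ a (η - ((P η : V) : H))))
    exact inner_eq_zero_symm.mp h2
  refine ⟨V, inferInstance, inferInstance, inferInstance,
    { toFun := fun a => P ∘L ρ a ∘L V.subtypeL
      map_zero' := by ext; simp
      map_add' := fun a b => by ext; simp
      map_smul' := fun k a => by ext; simp
      map_mul' := fun a b => by
        ext v
        show ((P (ρ (a * b) v) : V) : H) = ((P (ρ a ((P (ρ b v) : V) : H)) : V) : H)
        rw [hPmem, hPmem, hPmem, map_mul]; rfl
      map_star' := fun a => by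
        rw [star_eq_adjoint, adjoint_comp, adjoint_comp, hadj, map_star, star_eq_adjoint, ← hadj,
          adjoint_adjoint]
        rfl }, ?_, ?_⟩
  · intro a
    refine opNorm_le_bound _ (norm_nonneg _) fun η => ?_
    have h1 : ‖ρ a η‖ = ‖(P ∘L ρ a ∘L V.subtypeL) (P η)‖ := by
      show _ = ‖P (ρ a ((P η : V) : H))‖
      rw [hright]
      exact congrArg norm (hPmem a η).symm
    rw [h1]
    refine (le_opNorm _ _).trans (mul_le_mul_of_nonneg_left ?_ (norm_nonneg _))
    exact (Submodule.norm_orthogonalProjectionOnto_apply_le V η)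
  · intro v
    rw [Metric.mem_closure_iff]
    intro ε hε
    have hv : (v : H) ∈ closure (Submodule.span ℂ {ξ : H | ∃ a η, ξ = ρ a η} : Set H) := v.2
    obtain ⟨w, hw, hd⟩ := Metric.mem_closure_iff.mp hv ε hε
    have hwV : w ∈ V := Submodule.le_topologicalClosure _ hw
    refine ⟨⟨w, hwV⟩, ?_, hd⟩
    -- The projection fixes ρ(a)η, and this vector equals ρ(a)(Pη), so the span taken in `H` is
    -- carried into the span formed by the compressed representation on `V`.
    have key : ∀ w ∈ Submodule.span ℂ {ξ : H | ∃ a η, ξ = ρ a η},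
        P w ∈ Submodule.span ℂ {ξ : V | ∃ a η, ξ = (P ∘L ρ a ∘L V.subtypeL) η} := by
      intro w hw
      induction hw using Submodule.span_induction with
      | mem x hx =>
        obtain ⟨a, η, rfl⟩ := hx
        refine Submodule.subset_span ⟨a, P η, ?_⟩
        show _ = P (ρ a ((P η : V) : H))
        rw [hright]
      | zero => rw [map_zero]; exact zero_mem _
      | add x y _ _ hx hy => rw [map_add]; exact add_mem hx hy
      | smul k x _ hx => rw [map_smul]; exact Submodule.smul_mem _ _ hx
    have := key w hw
    rwa [show P w = ⟨w, hwV⟩ from Submodule.orthogonalProjectionOnto_mem_subspace_eq_self (K := V) ⟨w, hwV⟩] at this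

end Essential

/-! ### Open `G`-sets, cut-off functions and convolution -/

theorem ZeroAtInftyContinuousMap.norm_apply_le {X : Type*} [TopologicalSpace X] (f : C₀(X, ℂ))
    (x : X) : ‖f x‖ ≤ ‖f‖ := by
  rw [← ZeroAtInftyContinuousMap.norm_toBCF_eq_norm]
  exact f.toBCF.norm_coe_le_norm x

theorem ZeroAtInftyContinuousMap.norm_le_of_forall {X : Type*} [TopologicalSpace X] {f : C₀(X, ℂ)}
    {c : ℝ} (hc : 0 ≤ c) (h : ∀ x, ‖f x‖ ≤ c) : ‖f‖ ≤ c := by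
  rw [← ZeroAtInftyContinuousMap.norm_toBCF_eq_norm]
  exact (BoundedContinuousFunction.norm_le hc).mpr h

theorem ZeroAtInftyContinuousMap.isCompact_le_norm {X : Type*} [TopologicalSpace X] (f : C₀(X, ℂ))
    {ε : ℝ} (hε : 0 < ε) : IsCompact {x | ε ≤ ‖f x‖} := by
  have h := (zero_at_infty f).eventually (Metric.ball_mem_nhds (0 : ℂ) hε)
  obtain ⟨K, hK, hKs⟩ := Filter.mem_cocompact.mp h
  refine hK.of_isClosed_subset
    (isClosed_le continuous_const (map_continuous f).norm) fun x hx => ?_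
  by_contra hxK
  have : ‖f x‖ < ε := by simpa using hKs hxK
  exact absurd hx (not_le.mpr this)

namespace ArrowGroupoid

/-! ### Ranges and domains as points of the unit space -/

section Units

variable {G : Type u} [ArrowGroupoid G]

/-- The range of an arrow, as a unit. -/
def rngU (x : G) : unitSpace G := ⟨rng x, rng_rng x⟩

/-- The domain of an arrow, as a unit. -/
def domU (x : G) : unitSpace G := ⟨dom x, rng_dom x⟩

theorem rngU_coe (u : unitSpace G) : rngU (u : G) = u := Subtype.ext u.2

theorem domU_coe (u : unitSpace G) : domU (u : G) = u := Subtype.ext (dom_eq_of_mem u.2)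

theorem rngU_inv (x : G) : rngU (inv x) = domU x := Subtype.ext (rng_inv x)

theorem domU_inv (x : G) : domU (inv x) = rngU x := Subtype.ext (dom_inv x)

theorem rngU_comp (x y : G) (h : dom x = rng y) : rngU (comp x y h) = rngU x :=
  Subtype.ext (rng_comp x y h)

theorem domU_comp (x y : G) (h : dom x = rng y) : domU (comp x y h) = domU y :=
  Subtype.ext (dom_comp x y h)

theorem comp_right_cancel {x y z : G} {h : dom x = rng z} {h' : dom y = rng z}
    (e : comp x z h = comp y z h') : x = y := by
  have h1 := congrArg inv e
  rw [inv_eq_of_comp_cancel, inv_eq_of_comp_cancel] at h1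
  rw [← inv_inv_arrow x, comp_left_cancel h1, inv_inv_arrow]

theorem isGSet_unitSpace : IsGSet (unitSpace G) :=
  ⟨fun x hx y hy h => by rwa [show rng x = x from hx, show rng y = y from hy] at h,
    fun x hx y hy h => by rwa [dom_eq_of_mem hx, dom_eq_of_mem hy] at h⟩

theorem inv_mem_unitSpace {x : G} (h : inv x ∈ unitSpace G) : x ∈ unitSpace G := by
  have := inv_eq_of_mem h
  rw [inv_inv_arrow] at this
  rwa [this]

/-- In a composable product x⁻¹y with x, y in s the ranges of x and y agree, so x = y and the
product is a unit. -/
theorem setComp_inv_subset_units {s : Set G} (hs : IsGSet s) :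
    setComp {x | inv x ∈ s} s ⊆ unitSpace G := by
  rintro _ ⟨x, hx, y, hy, h, rfl⟩
  obtain rfl : inv x = y := hs.1 hx hy (by rw [rng_inv, h])
  have := comp_inv x
  rw [this]
  exact rng_rng x

end Units

/-! ### Open G-sets as charts, and partitions of unity -/

section Charts

variable {G : Type u} [TopologicalSpace G] [ArrowGroupoid G] [hG : IsRDiscrete G]

theorem continuous_rngU : Continuous (rngU : G → unitSpace G) :=
  hG.isLocalHomeomorph_rng.continuous

theorem continuous_domU : Continuous (domU : G → unitSpace G) :=
  hG.isLocalHomeomorph_dom.continuous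

/-- A local homeomorphism is open, so injectivity on an open set is enough to make it a chart. -/
theorem isOpenEmbedding_rngU {s : Set G} (hs : IsOpen s) (hi : Set.InjOn rng s) :
    Topology.IsOpenEmbedding fun x : s => rngU x.1 :=
  .of_continuous_injective_isOpenMap (continuous_rngU.comp continuous_subtype_val)
    (fun x y h => Subtype.ext (hi x.2 y.2 (congrArg Subtype.val h)))
    (hG.isLocalHomeomorph_rng.isOpenMap.comp hs.isOpenMap_subtype_val)

theorem isOpenEmbedding_domU {s : Set G} (hs : IsOpen s) (hi : Set.InjOn dom s) :
    Topology.IsOpenEmbedding fun x : s => domU x.1 :=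
  .of_continuous_injective_isOpenMap (continuous_domU.comp continuous_subtype_val)
    (fun x y h => Subtype.ext (hi x.2 y.2 (congrArg Subtype.val h)))
    (hG.isLocalHomeomorph_dom.isOpenMap.comp hs.isOpenMap_subtype_val)

/-- Compact sets of units inside r(s) lift through the chart to compact subsets of s, on which
cut-off functions supported in s can be prescribed. -/
theorem isCompact_inter_rngU {s : Set G} (hs : IsOpen s) (hi : Set.InjOn rng s)
    {K : Set (unitSpace G)} (hK : IsCompact K) (hKs : K ⊆ rngU '' s) :
    IsCompact (s ∩ rngU ⁻¹' K) := by
  have h := ((isOpenEmbedding_rngU hs hi).isInducing.isCompact_preimage_iff (K := K) (by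
    intro u hu; obtain ⟨x, hx, rfl⟩ := hKs hu; exact ⟨⟨x, hx⟩, rfl⟩)).mpr hK
  convert h.image continuous_subtype_val using 1
  ext x
  constructor
  · rintro ⟨hx, hxK⟩; exact ⟨⟨x, hx⟩, hxK, rfl⟩
  · rintro ⟨y, hy, rfl⟩; exact ⟨y.2, hy⟩

theorem isCompact_inter_domU {s : Set G} (hs : IsOpen s) (hi : Set.InjOn dom s)
    {K : Set (unitSpace G)} (hK : IsCompact K) (hKs : K ⊆ domU '' s) :
    IsCompact (s ∩ domU ⁻¹' K) := by
  have h := ((isOpenEmbedding_domU hs hi).isInducing.isCompact_preimage_iff (K := K) (by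
    intro u hu; obtain ⟨x, hx, rfl⟩ := hKs hu; exact ⟨⟨x, hx⟩, rfl⟩)).mpr hK
  convert h.image continuous_subtype_val using 1
  ext x
  constructor
  · rintro ⟨hx, hxK⟩; exact ⟨⟨x, hx⟩, hxK, rfl⟩
  · rintro ⟨y, hy, rfl⟩; exact ⟨y.2, hy⟩

/-- Near a unit, take V on which the range map is injective. If x and r(x) both lie in V, they have
the same range, so x = r(x). -/
theorem isOpen_unitSpace : IsOpen (unitSpace G) := by
  rw [isOpen_iff_forall_mem_open]
  intro u hu
  obtain ⟨V, hV, huV, hi⟩ := exists_injOn_rng u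
  refine ⟨V ∩ rng ⁻¹' V, ?_, hV.inter (hV.preimage continuous_rng), huV, ?_⟩
  · rintro x ⟨hx, hx'⟩
    exact hi hx' hx (rng_rng x)
  · show rng u ∈ V
    rwa [show rng u = u from hu]

/-- The cover is indexed by the points of G so that a neighbourhood adapted to each point can be
chosen beforehand; the points `p i` remember which neighbourhoods were used. -/
theorem exists_partition {K : Set G} (hK : IsCompact K) {w : G → Set G} (hw : ∀ x, IsOpen (w x))
    (hxw : ∀ x, x ∈ w x) :
    ∃ (n : ℕ) (p : Fin n → G) (φ : Fin n → C(G, ℝ)), (∀ i, tsupport (φ i) ⊆ w (p i)) ∧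
      (∀ i x, φ i x ∈ Set.Icc (0 : ℝ) 1) ∧ ∀ x ∈ K, ∑ i, φ i x = 1 := by
  have := hG.t2
  have := hG.locallyCompact
  obtain ⟨t, -, ht⟩ := hK.elim_nhds_subcover w fun x _ => (hw x).mem_nhds (hxw x)
  obtain ⟨φ, h1, h2, h3, -⟩ := exists_continuous_sum_one_of_isOpen_isCompact
    (s := fun i : Fin t.card => w (t.equivFin.symm i)) (fun i => hw _) hK (by
      intro x hx
      obtain ⟨y, hy, hxy⟩ := Set.mem_iUnion₂.mp (ht hx)
      refine Set.mem_iUnion.mpr ⟨t.equivFin ⟨y, hy⟩, ?_⟩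
      simpa using hxy)
  refine ⟨_, _, φ, h1, h3, fun x hx => ?_⟩
  have := h2 hx
  simpa using this

theorem exists_cutoff {s K : Set G} (hs : IsOpen s) (hK : IsCompact K) (hKs : K ⊆ s) :
    ∃ χ : C(G, ℝ), tsupport χ ⊆ s ∧ HasCompactSupport χ ∧ (∀ x, χ x ∈ Set.Icc (0 : ℝ) 1) ∧
      ∀ x ∈ K, χ x = 1 := by
  have := hG.t2
  have := hG.locallyCompact
  -- A partition of unity with a single member is a cut-off function.
  obtain ⟨φ, h1, h2, h3, h4⟩ := exists_continuous_sum_one_of_isOpen_isCompact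
    (s := fun _ : Fin 1 => s) (fun _ => hs) hK
    (hKs.trans (Set.subset_iUnion (fun _ : Fin 1 => s) 0))
  refine ⟨φ 0, h1 0, h4 0, h3 0, fun x hx => ?_⟩
  simpa using h2 hx

end Charts

end ArrowGroupoid

/-! ### Supports, products and fibre sums in the convolution algebra -/

namespace ConvolutionAlgebra

variable {G : Type u} [TopologicalSpace G]

/-- The element of the convolution algebra given by a compactly supported continuous function. -/
def mk (f : G → ℂ) (hc : Continuous f) (hs : HasCompactSupport f) : ConvolutionAlgebra G :=
  (⟨⟨f, hc⟩, hs⟩ : C_c(G, ℂ))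

theorem mk_apply (f : G → ℂ) (hc : Continuous f) (hs : HasCompactSupport f) (x : G) :
    mk f hc hs x = f x := rfl

theorem continuous (f : ConvolutionAlgebra G) : Continuous f := f.toCc.continuous

theorem hasCompactSupport (f : ConvolutionAlgebra G) : HasCompactSupport f :=
  f.toCc.hasCompactSupport

theorem sum_apply {ι : Type*} (t : Finset ι) (f : ι → ConvolutionAlgebra G) (x : G) :
    (∑ i ∈ t, f i) x = ∑ i ∈ t, f i x := by
  classical
  induction t using Finset.induction_on with
  | empty => rfl
  | insert i t hi h => rw [Finset.sum_insert hi, Finset.sum_insert hi, add_apply, h]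

theorem exists_bound (f : ConvolutionAlgebra G) : ∃ c, 0 ≤ c ∧ ∀ x, ‖f x‖ ≤ c := by
  obtain ⟨c, hc⟩ := f.continuous.bounded_above_of_compact_support f.hasCompactSupport
  exact ⟨max c 0, le_max_right _ _, fun x => (hc x).trans (le_max_left _ _)⟩

/-- Pointwise multiplication by a continuous function. -/
noncomputable def cut (χ : C(G, ℝ)) : ConvolutionAlgebra G →ₗ[ℂ] ConvolutionAlgebra G where
  toFun f := mk (fun x => χ x * f x)
    ((Complex.continuous_ofReal.comp χ.continuous).mul f.continuous) f.hasCompactSupport.mul_left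
  map_add' f g := ext' fun x => mul_add _ (f x) (g x)
  map_smul' k f := ext' fun x => mul_left_comm _ k (f x)

theorem cut_apply (χ : C(G, ℝ)) (f : ConvolutionAlgebra G) (x : G) : cut χ f x = χ x * f x := rfl

theorem tsupport_cut_subset_left (χ : C(G, ℝ)) (f : ConvolutionAlgebra G) :
    tsupport (cut χ f) ⊆ tsupport χ :=
  closure_mono fun x hx => by
    rw [Function.mem_support, cut_apply] at hx
    exact fun h => hx (by rw [h]; simp)

theorem tsupport_cut_subset_right (χ : C(G, ℝ)) (f : ConvolutionAlgebra G) :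
    tsupport (cut χ f) ⊆ tsupport f :=
  closure_mono fun x hx => by
    rw [Function.mem_support, cut_apply] at hx
    exact right_ne_zero_of_mul hx

theorem sum_cut {n : ℕ} {φ : Fin n → C(G, ℝ)} {f : ConvolutionAlgebra G}
    (h : ∀ x ∈ tsupport f, ∑ i, φ i x = 1) : ∑ i, cut (φ i) f = f := by
  refine ext' fun x => ?_
  rw [sum_apply]
  simp only [cut_apply]
  rw [← Finset.sum_mul, ← Complex.ofReal_sum]
  by_cases hx : x ∈ tsupport f
  · rw [h x hx, Complex.ofReal_one, one_mul]
  · rw [image_eq_zero_of_notMem_tsupport hx, mul_zero]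

theorem norm_cut_le {χ : C(G, ℝ)} (hχ : ∀ x, χ x ∈ Set.Icc (0 : ℝ) 1) (f : ConvolutionAlgebra G)
    (x : G) : ‖cut χ f x‖ ≤ ‖f x‖ := by
  rw [cut_apply, norm_mul, Complex.norm_real, Real.norm_of_nonneg (hχ x).1]
  exact mul_le_of_le_one_left (norm_nonneg _) (hχ x).2

theorem apply_eq_zero {f : ConvolutionAlgebra G} {s : Set G} (hf : tsupport f ⊆ s) {x : G}
    (hx : x ∉ s) : f x = 0 := image_eq_zero_of_notMem_tsupport fun h => hx (hf h)

theorem tsupport_add_subset {f g : ConvolutionAlgebra G} {s : Set G} (hf : tsupport f ⊆ s)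
    (hg : tsupport g ⊆ s) : tsupport (f + g : ConvolutionAlgebra G) ⊆ s := by
  refine subset_trans ?_ (Set.union_subset hf hg)
  refine subset_trans (closure_mono (t := Function.support f ∪ Function.support g) fun x hx => ?_)
    closure_union.subset
  by_contra h
  have h' : f x = 0 ∧ g x = 0 := by simpa using h
  exact hx (show (f + g) x = 0 by rw [add_apply, h'.1, h'.2, add_zero])

theorem tsupport_smul_subset (k : ℂ) (f : ConvolutionAlgebra G) :
    tsupport (k • f : ConvolutionAlgebra G) ⊆ tsupport f :=
  closure_mono fun x hx => by
    rw [Function.mem_support, smul_apply] at hx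
    exact right_ne_zero_of_mul hx

theorem tsupport_zero : tsupport (0 : ConvolutionAlgebra G) = ∅ := by
  rw [tsupport_eq_empty_iff]; rfl

theorem tsupport_sum_subset {ι : Type*} {t : Finset ι} {f : ι → ConvolutionAlgebra G} {s : Set G}
    (h : ∀ i ∈ t, tsupport (f i) ⊆ s) : tsupport (∑ i ∈ t, f i : ConvolutionAlgebra G) ⊆ s := by
  classical
  induction t using Finset.induction_on with
  | empty => rw [Finset.sum_empty, tsupport_zero]; exact Set.empty_subset s
  | insert i t hi ih =>
    rw [Finset.sum_insert hi]
    exact tsupport_add_subset (h i (Finset.mem_insert_self i t))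
      (ih fun j hj => h j (Finset.mem_insert_of_mem hj))

theorem eq_of_rng_eq [ArrowGroupoid G] {f : ConvolutionAlgebra G} {s : Set G} (hs : IsGSet s) (hf : tsupport f ⊆ s)
    {x : G} (hx : x ∈ s) (x' : G) (h : rng x' = rng x) (h' : f x' ≠ 0) : x' = x :=
  hs.1 (hf (subset_tsupport _ h')) hx h

theorem eq_of_dom_eq [ArrowGroupoid G] {f : ConvolutionAlgebra G} {s : Set G} (hs : IsGSet s) (hf : tsupport f ⊆ s)
    {x : G} (hx : x ∈ s) (x' : G) (h : dom x' = dom x) (h' : f x' ≠ 0) : x' = x :=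
  hs.2 (hf (subset_tsupport _ h')) hx h

variable [ArrowGroupoid G] [hG : IsRDiscrete G]

/-- The convolution sum runs over arrows with the range of x, and only x itself survives. This is
how convolution becomes a pointwise product on G-sets. -/
theorem mul_apply_of_left (f g : ConvolutionAlgebra G) {x y : G} (h : dom x = rng y)
    (hf : ∀ x', rng x' = rng x → f x' ≠ 0 → x' = x) : (f * g) (comp x y h) = f x * g y := by
  rw [mul_apply, conv_eq f g (rng_comp x y h), finsum_eq_single _ ⟨x, rfl⟩]
  · rw [ldiv_comp]
  · intro z hz
    by_contra hne
    exact hz (Subtype.ext (hf z.1 z.2 (left_ne_zero_of_mul hne)))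

/-- In a nonzero term indexed by z, the arrow z⁻¹(xy) has the domain of y, hence equals y, and
cancelling y on the right gives z = x. -/
theorem mul_apply_of_right (f g : ConvolutionAlgebra G) {x y : G} (h : dom x = rng y)
    (hg : ∀ y', dom y' = dom y → g y' ≠ 0 → y' = y) : (f * g) (comp x y h) = f x * g y := by
  rw [mul_apply, conv_eq f g (rng_comp x y h), finsum_eq_single _ ⟨x, rfl⟩]
  · rw [ldiv_comp]
  · intro z hz
    by_contra hne
    have h1 := hg _ ((dom_ldiv _ _ _).trans (dom_comp x y h)) (right_ne_zero_of_mul hne)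
    have h2 := comp_ldiv z.1 (comp x y h) (z.2.trans (rng_comp x y h).symm)
    refine hz (Subtype.ext (comp_right_cancel (z := y) (h' := h)
      (h := (rng_ldiv _ _ _).symm.trans (congrArg rng h1)) ?_))
    exact (comp_congr rfl h1.symm _ _).trans h2

theorem exists_of_mul_apply_ne_zero {f g : ConvolutionAlgebra G} {z : G} (h : (f * g) z ≠ 0) :
    ∃ x y, ∃ h : dom x = rng y, f x ≠ 0 ∧ g y ≠ 0 ∧ comp x y h = z := by
  obtain ⟨x, hx⟩ : ∃ x : Fibre (rng z), f x.1 * g (ldiv x.1 z x.2) ≠ 0 := by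
    by_contra! h0
    exact h (finsum_eq_zero_of_forall_eq_zero h0)
  exact ⟨x.1, ldiv x.1 z x.2, (rng_ldiv _ _ _).symm, left_ne_zero_of_mul hx,
    right_ne_zero_of_mul hx, comp_ldiv _ _ _⟩

/-- The product of the two closed supports is compact, being the continuous image of the composable
pairs in a compact rectangle. So it is already closed, although `setComp s t` need not be. -/
theorem tsupport_mul_subset {f g : ConvolutionAlgebra G} {s t : Set G} (hf : tsupport f ⊆ s)
    (hg : tsupport g ⊆ t) : tsupport (f * g : ConvolutionAlgebra G) ⊆ setComp s t := by
  have := hG.t2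
  have hcl : IsClosed {q : G × G | dom q.1 = rng q.2} :=
    isClosed_eq (continuous_dom.comp continuous_fst) (continuous_rng.comp continuous_snd)
  have hc : IsCompact ((Subtype.val : {q : G × G // dom q.1 = rng q.2} → G × G) ⁻¹'
      (tsupport f ×ˢ tsupport g)) :=
    hcl.isClosedEmbedding_subtypeVal.isCompact_preimage
      (f.hasCompactSupport.isCompact.prod g.hasCompactSupport.isCompact)
  refine (closure_minimal ?_ (hc.image hG.continuous_comp).isClosed).trans ?_
  · intro z hz
    obtain ⟨x, y, h, hx, hy, rfl⟩ := exists_of_mul_apply_ne_zero hz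
    exact ⟨⟨(x, y), h⟩, ⟨subset_tsupport _ hx, subset_tsupport _ hy⟩, rfl⟩
  · rintro _ ⟨⟨⟨x, y⟩, h⟩, ⟨hx, hy⟩, rfl⟩
    exact ⟨x, hf hx, y, hg hy, h, rfl⟩

theorem tsupport_star_subset {f : ConvolutionAlgebra G} {s : Set G} (hf : tsupport f ⊆ s) :
    tsupport (star f : ConvolutionAlgebra G) ⊆ {x | inv x ∈ s} := by
  refine (closure_minimal (t := inv ⁻¹' tsupport f) ?_
    ((isClosed_tsupport _).preimage hG.continuous_inv)).trans fun x hx => hf hx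
  intro x hx
  refine subset_tsupport _ fun h => hx ?_
  rw [star_apply, h, star_zero]

/-- The sum over the fibres of the range map. -/
noncomputable def fibreSum : ConvolutionAlgebra G →ₗ[ℂ] C₀(unitSpace G, ℂ) where
  toFun f :=
    { toFun := fun u => ∑ᶠ y : Fibre (rng (u : G)), f y.1
      continuous_toFun := (continuous_fibreSum (fun q => f q.1.1)
        (f.continuous.comp (continuous_fst.comp continuous_subtype_val))
        f.hasCompactSupport.isCompact fun q hq => subset_tsupport _ hq).comp continuous_subtype_val
      zero_at_infty' := by
        refine tendsto_const_nhds.congr' ?_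
        filter_upwards
          [(f.hasCompactSupport.isCompact.image continuous_rngU).compl_mem_cocompact] with u hu
        symm
        refine finsum_eq_zero_of_forall_eq_zero fun y => ?_
        by_contra hne
        exact hu ⟨y.1, subset_tsupport _ hne, Subtype.ext (y.2.trans u.2)⟩ }
  map_add' f g := by
    ext u
    exact finsum_add_distrib
      ((finite_fibre f.hasCompactSupport.isCompact _).subset fun y hy => subset_tsupport _ hy)
      ((finite_fibre g.hasCompactSupport.isCompact _).subset fun y hy => subset_tsupport _ hy)
  map_smul' k f := by
    ext u
    exact (smul_finsum k fun y : Fibre (rng (u : G)) => f y.1).symm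

theorem fibreSum_apply (f : ConvolutionAlgebra G) (u : unitSpace G) :
    fibreSum f u = ∑ᶠ y : Fibre (rng (u : G)), f y.1 := rfl

theorem fibreSum_rngU (f : ConvolutionAlgebra G) {x : G}
    (hf : ∀ x', rng x' = rng x → f x' ≠ 0 → x' = x) : fibreSum f (rngU x) = f x := by
  rw [fibreSum_apply]
  refine finsum_eq_single (fun y : Fibre (rng (rngU x : G)) => f y.1) ⟨x, (rng_rng x).symm⟩
    fun z hz => ?_
  by_contra hne
  exact hz (Subtype.ext (hf z.1 (z.2.trans (rng_rng x)) hne))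

theorem fibreSum_eq_zero {f : ConvolutionAlgebra G} {u : unitSpace G}
    (h : ∀ x, rngU x = u → f x = 0) : fibreSum f u = 0 :=
  finsum_eq_zero_of_forall_eq_zero fun y => h y.1 (Subtype.ext (y.2.trans u.2))

/-- On a G-set each fibre sum has at most one nonzero term. Thus `fibreSum` merely moves f to the
unit space along the chart, and realizes C_c(s) inside B_{r(s)}. -/
theorem fibreSum_of_mem {f : ConvolutionAlgebra G} {s : Set G} (hs : IsGSet s)
    (hf : tsupport f ⊆ s) {x : G} (hx : x ∈ s) : fibreSum f (rngU x) = f x :=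
  fibreSum_rngU f (eq_of_rng_eq hs hf hx)

theorem fibreSum_of_notMem {f : ConvolutionAlgebra G} {s : Set G} (hf : tsupport f ⊆ s)
    {u : unitSpace G} (hu : u ∉ rngU '' s) : fibreSum f u = 0 :=
  fibreSum_eq_zero fun x hx => apply_eq_zero hf fun hxs => hu ⟨x, hxs, hx⟩

/-- Functions that vanish off the range of an open `G`-set are approximated by the functions coming
from the compactly supported functions on this `G`-set. -/
theorem exists_fibreSum_near {s : Set G} (ho : IsOpen s) (hs : IsGSet s) {b : C₀(unitSpace G, ℂ)}
    (hb : ∀ u, u ∉ rngU '' s → b u = 0) {ε : ℝ} (hε : 0 < ε) :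
    ∃ f : ConvolutionAlgebra G, tsupport f ⊆ s ∧ ‖fibreSum f - b‖ ≤ ε := by
  -- Where |b| ≥ ε the cut-off will equal 1 and there is no error; elsewhere the error is at most
  -- |b| < ε, because the cut-off takes values in [0, 1].
  have hK : IsCompact (s ∩ rngU ⁻¹' {u | ε ≤ ‖b u‖}) := by
    refine isCompact_inter_rngU ho hs.1 (b.isCompact_le_norm hε) fun u hu => ?_
    by_contra h
    have : ε ≤ ‖b u‖ := hu
    rw [hb u h, norm_zero] at this
    exact absurd hε (not_lt.mpr this)
  obtain ⟨χ, h1, h2, h3, h4⟩ := exists_cutoff ho hK Set.inter_subset_left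
  have hcs : HasCompactSupport fun x => (χ x : ℂ) := h2.comp_left Complex.ofReal_zero
  set f : ConvolutionAlgebra G := mk (fun x => χ x * b (rngU x))
    ((Complex.continuous_ofReal.comp χ.continuous).mul ((map_continuous b).comp continuous_rngU))
    hcs.mul_right with hfdef
  have hf : tsupport f ⊆ s := by
    refine (closure_mono fun x hx => ?_).trans h1
    exact fun h => hx (show (χ x : ℂ) * b (rngU x) = 0 by rw [h]; simp)
  refine ⟨f, hf, ZeroAtInftyContinuousMap.norm_le_of_forall hε.le fun u => ?_⟩
  rw [ZeroAtInftyContinuousMap.sub_apply]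
  by_cases hu : u ∈ rngU '' s
  · obtain ⟨x, hx, rfl⟩ := hu
    rw [fibreSum_of_mem hs hf hx]
    show ‖(χ x : ℂ) * b (rngU x) - b (rngU x)‖ ≤ ε
    by_cases hxb : ε ≤ ‖b (rngU x)‖
    · rw [h4 x ⟨hx, hxb⟩, Complex.ofReal_one, one_mul, sub_self, norm_zero]; exact hε.le
    · rw [← sub_one_mul, norm_mul, ← Complex.ofReal_one, ← Complex.ofReal_sub, Complex.norm_real]
      refine (mul_le_of_le_one_left (norm_nonneg _) ?_).trans (not_le.mp hxb).le
      rw [Real.norm_eq_abs, abs_le]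
      constructor <;> linarith [(h3 x).1, (h3 x).2]
  · rw [fibreSum_of_notMem hf hu, hb u hu, sub_zero, norm_zero]; exact hε.le

end ConvolutionAlgebra

/-! ### The canonical action of an inverse semigroup of open `G`-sets -/

theorem ClosedIdeal.ext_mem {B : Type u} [NonUnitalCStarAlgebra B] {I J : ClosedIdeal B}
    (h : ∀ a, a ∈ I.toNonUnitalStarSubalgebra ↔ a ∈ J.toNonUnitalStarSubalgebra) : I = J := by
  have h' : I.toNonUnitalStarSubalgebra = J.toNonUnitalStarSubalgebra := SetLike.ext h
  cases I; cases J; cases h'; rfl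

/-- Domain, range and isomorphism can all be read off the graph. Uniqueness of the action then
becomes an equivalence of relations, with no transport between equal ideals. -/
theorem PartialAut.ext_maps {B : Type u} [NonUnitalCStarAlgebra B] {φ ψ : PartialAut B}
    (h : ∀ a b, φ.Maps a b ↔ ψ.Maps a b) : φ = ψ := by
  obtain ⟨D, R, e⟩ := φ
  obtain ⟨D', R', e'⟩ := ψ
  obtain rfl : D = D' := ClosedIdeal.ext_mem fun a =>
    ⟨fun ha => ((h a _).mp (PartialAut.maps_equiv ⟨D, R, e⟩ ⟨a, ha⟩)).mem_dom,
      fun ha => ((h a _).mpr (PartialAut.maps_equiv ⟨D', R', e'⟩ ⟨a, ha⟩)).mem_dom⟩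
  obtain rfl : R = R' := ClosedIdeal.ext_mem fun b =>
    ⟨fun hb => ((h _ b).mp (PartialAut.maps_symm ⟨D, R, e⟩ ⟨b, hb⟩)).mem_ran,
      fun hb => ((h _ b).mpr (PartialAut.maps_symm ⟨D, R', e'⟩ ⟨b, hb⟩)).mem_ran⟩
  congr 1
  ext a
  obtain ⟨_, h1⟩ := (h a _).mp (PartialAut.maps_equiv ⟨D, R, e⟩ a)
  exact h1.symm

/-- The closed ideal of the functions that vanish off `V`. -/
def vanishingIdeal {X : Type u} [TopologicalSpace X] (V : Set X) : ClosedIdeal C₀(X, ℂ) where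
  carrier := {f | ∀ u, u ∉ V → f u = 0}
  add_mem' {f g} hf hg u hu := by
    rw [ZeroAtInftyContinuousMap.add_apply, hf u hu, hg u hu, add_zero]
  zero_mem' u _ := rfl
  mul_mem' {f g} hf hg u hu := by
    rw [ZeroAtInftyContinuousMap.mul_apply, hf u hu, zero_mul]
  smul_mem' k f hf u hu := by
    rw [ZeroAtInftyContinuousMap.smul_apply, hf u hu, smul_zero]
  star_mem' {f} hf u hu := by
    rw [ZeroAtInftyContinuousMap.star_apply, hf u hu, star_zero]
  isClosed' := by
    have : {f : C₀(X, ℂ) | ∀ u, u ∉ V → f u = 0} =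
        ⋂ (u : X) (_ : u ∉ V), {f | f u = 0} := by ext; simp
    show IsClosed {f : C₀(X, ℂ) | ∀ u, u ∉ V → f u = 0}
    rw [this]
    refine isClosed_iInter fun u => isClosed_iInter fun _ => ?_
    have hc : Continuous fun f : C₀(X, ℂ) => f u :=
      (BoundedContinuousFunction.evalCLM ℂ u).continuous.comp
        ZeroAtInftyContinuousMap.isometry_toBCF.continuous
    exact isClosed_eq hc continuous_const
  mul_mem_left' f {g} hg u hu := by
    rw [ZeroAtInftyContinuousMap.mul_apply, hg u hu, mul_zero]
  mul_mem_right' {f} g hf u hu := by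
    rw [ZeroAtInftyContinuousMap.mul_apply, hf u hu, zero_mul]

theorem mem_vanishingIdeal {X : Type u} [TopologicalSpace X] {V : Set X} {f : C₀(X, ℂ)} :
    f ∈ (vanishingIdeal V).toNonUnitalStarSubalgebra ↔ ∀ u, u ∉ V → f u = 0 := Iff.rfl

theorem ArrowGroupoid.isGSet_of_subset_units {G : Type u} [ArrowGroupoid G] {s : Set G}
    (h : s ⊆ unitSpace G) : IsGSet s :=
  ⟨isGSet_unitSpace.1.mono h, isGSet_unitSpace.2.mono h⟩

/-! ### Transport of functions along open G-sets -/

section Transport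

variable {G : Type u} [TopologicalSpace G] [ArrowGroupoid G]

/-- The function `b`, which vanishes off the range of `s`, corresponds along `s` to the function
`a`, which vanishes off the domain of `s`. -/
def Transports (s : Set G) (a b : C₀(unitSpace G, ℂ)) : Prop :=
  (∀ u, u ∉ domU '' s → a u = 0) ∧ (∀ u, u ∉ rngU '' s → b u = 0) ∧
    ∀ x ∈ s, b (rngU x) = a (domU x)

namespace Transports

variable {s t : Set G} {a a' b b' c : C₀(unitSpace G, ℂ)}

theorem symm (h : Transports s a b) : Transports {x | inv x ∈ s} b a := by
  refine ⟨fun u hu => h.2.1 u ?_, fun u hu => h.1 u ?_, fun x hx => ?_⟩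
  · rintro ⟨x, hx, rfl⟩
    exact hu ⟨inv x, by simpa [inv_inv_arrow] using hx, domU_inv x⟩
  · rintro ⟨x, hx, rfl⟩
    exact hu ⟨inv x, by simpa [inv_inv_arrow] using hx, rngU_inv x⟩
  · have := h.2.2 _ hx
    rwa [rngU_inv, domU_inv, eq_comm] at this

theorem right_unique (h : Transports s a b) (h' : Transports s a b') : b = b' := by
  ext u
  by_cases hu : u ∈ rngU '' s
  · obtain ⟨x, hx, rfl⟩ := hu
    rw [h.2.2 x hx, h'.2.2 x hx]
  · rw [h.2.1 u hu, h'.2.1 u hu]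

theorem left_unique (h : Transports s a b) (h' : Transports s a' b) : a = a' :=
  h.symm.right_unique h'.symm

theorem add (h : Transports s a b) (h' : Transports s a' b') :
    Transports s (a + a') (b + b') := by
  refine ⟨fun u hu => ?_, fun u hu => ?_, fun x hx => ?_⟩ <;>
    simp only [ZeroAtInftyContinuousMap.add_apply]
  · rw [h.1 u hu, h'.1 u hu, add_zero]
  · rw [h.2.1 u hu, h'.2.1 u hu, add_zero]
  · rw [h.2.2 x hx, h'.2.2 x hx]

theorem mul (h : Transports s a b) (h' : Transports s a' b') :
    Transports s (a * a') (b * b') := by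
  refine ⟨fun u hu => ?_, fun u hu => ?_, fun x hx => ?_⟩ <;>
    simp only [ZeroAtInftyContinuousMap.mul_apply]
  · rw [h.1 u hu, zero_mul]
  · rw [h.2.1 u hu, zero_mul]
  · rw [h.2.2 x hx, h'.2.2 x hx]

theorem smul (k : ℂ) (h : Transports s a b) : Transports s (k • a) (k • b) := by
  refine ⟨fun u hu => ?_, fun u hu => ?_, fun x hx => ?_⟩ <;>
    simp only [ZeroAtInftyContinuousMap.smul_apply]
  · rw [h.1 u hu, smul_zero]
  · rw [h.2.1 u hu, smul_zero]
  · rw [h.2.2 x hx]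

theorem star (h : Transports s a b) : Transports s (star a) (star b) := by
  refine ⟨fun u hu => ?_, fun u hu => ?_, fun x hx => ?_⟩ <;>
    simp only [ZeroAtInftyContinuousMap.star_apply]
  · rw [h.1 u hu, star_zero]
  · rw [h.2.1 u hu, star_zero]
  · rw [h.2.2 x hx]

/-- If y is in t and d(y) is outside d(st), then r(y) is outside d(s), where b vanishes; hence a
vanishes at d(y). The argument for c is symmetric. -/
theorem comp (h : Transports t a b) (h' : Transports s b c) : Transports (setComp s t) a c := by
  refine ⟨fun u hu => ?_, fun u hu => ?_, ?_⟩
  · by_cases hut : u ∈ domU '' t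
    · obtain ⟨y, hy, rfl⟩ := hut
      rw [← h.2.2 y hy]
      refine h'.1 _ ?_
      rintro ⟨x, hx, e⟩
      exact hu ⟨_, ⟨x, hx, y, hy, congrArg Subtype.val e, rfl⟩, domU_comp _ _ _⟩
    · exact h.1 u hut
  · by_cases hus : u ∈ rngU '' s
    · obtain ⟨x, hx, rfl⟩ := hus
      rw [h'.2.2 x hx]
      refine h.2.1 _ ?_
      rintro ⟨y, hy, e⟩
      exact hu ⟨_, ⟨x, hx, y, hy, (congrArg Subtype.val e).symm, rfl⟩, rngU_comp _ _ _⟩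
    · exact h'.2.1 u hus
  · rintro _ ⟨x, hx, y, hy, e, rfl⟩
    rw [rngU_comp, domU_comp, h'.2.2 x hx, ← h.2.2 y hy]
    exact congrArg b (Subtype.ext e)

end Transports

variable [hG : IsRDiscrete G]

/-- The function is moved by the homeomorphism d(s) → r(s) and extended by zero. Continuity at
points outside r(s) is the issue: the sets where the modulus is at least ε are images of compact
sets, hence closed, so the function is small near each of its zeros. The same compactness gives
vanishing at infinity. -/
theorem exists_transports (s : OpenGSet G) {a : C₀(unitSpace G, ℂ)}
    (ha : ∀ u, u ∉ domU '' s.carrier → a u = 0) : ∃ b, Transports s.carrier a b := by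
  classical
  have := hG.t2
  set g : unitSpace G → ℂ := fun u => if h : u ∈ rngU '' s.carrier then a (domU h.choose) else 0
    with hg
  have hgx : ∀ x ∈ s.carrier, g (rngU x) = a (domU x) := by
    intro x hx
    have h : rngU x ∈ rngU '' s.carrier := ⟨x, hx, rfl⟩
    rw [hg]
    dsimp only
    rw [dif_pos h]
    have h2 := h.choose_spec
    rw [s.isGSet'.1 h2.1 hx (congrArg Subtype.val h2.2)]
  have hg0 : ∀ u, u ∉ rngU '' s.carrier → g u = 0 := fun u hu => dif_neg hu
  -- This set is the range of the arrows of s whose domain lies in the compact set where |a| ≥ ε.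
  have hcpt : ∀ ε > 0, IsCompact {u | ε ≤ ‖g u‖} := by
    intro ε hε
    have hK := isCompact_inter_domU s.isOpen' s.isGSet'.2 (a.isCompact_le_norm hε) fun u hu => by
      by_contra h
      have hu' : ε ≤ ‖a u‖ := hu
      rw [ha u h, norm_zero] at hu'
      exact absurd hε (not_lt.mpr hu')
    convert hK.image continuous_rngU using 1
    ext u
    constructor
    · intro hu
      have hus : u ∈ rngU '' s.carrier := by
        by_contra h
        have hu' : ε ≤ ‖g u‖ := hu
        rw [hg0 u h, norm_zero] at hu'
        exact absurd hε (not_lt.mpr hu')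
      obtain ⟨x, hx, rfl⟩ := hus
      exact ⟨x, ⟨hx, by show ε ≤ ‖a (domU x)‖; rw [← hgx x hx]; exact hu⟩, rfl⟩
    · rintro ⟨x, ⟨hx, hxa⟩, rfl⟩
      show ε ≤ ‖g (rngU x)‖
      rw [hgx x hx]; exact hxa
  have hsmall : ∀ ε > 0, ∀ u, g u = 0 → ∀ᶠ v in nhds u, ‖g v‖ < ε := by
    intro ε hε u hu
    filter_upwards [(hcpt ε hε).isClosed.isOpen_compl.mem_nhds
      (show u ∈ {u | ε ≤ ‖g u‖}ᶜ by simp [hu, hε])] with v hv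
    simpa using hv
  have hcont : Continuous g := by
    rw [continuous_iff_continuousAt]
    intro u
    by_cases hu : u ∈ rngU '' s.carrier
    · obtain ⟨x, hx, rfl⟩ := hu
      have hemb := isOpenEmbedding_rngU s.isOpen' s.isGSet'.1
      rw [show rngU x = (fun y : s.carrier => rngU y.1) ⟨x, hx⟩ from rfl,
        ← hemb.continuousAt_iff]
      refine Continuous.continuousAt ?_
      refine ((map_continuous a).comp (continuous_domU.comp continuous_subtype_val)).congr
        fun y => (hgx y.1 y.2).symm
    · rw [ContinuousAt, hg0 u hu, Metric.tendsto_nhds]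
      intro ε hε
      simpa using hsmall ε hε u (hg0 u hu)
  refine ⟨⟨⟨g, hcont⟩, ?_⟩, ha, hg0, hgx⟩
  rw [Metric.tendsto_nhds]
  intro ε hε
  filter_upwards [(hcpt ε hε).compl_mem_cocompact] with u hu
  simpa using hu

theorem inv_mem_star {s : OpenGSet G} {x : G} (hx : x ∈ s.carrier) :
    inv x ∈ (star s).carrier := by
  show inv (inv x) ∈ s.carrier
  rwa [inv_inv_arrow]

theorem inv_inv_carrier (s : OpenGSet G) : {x | inv x ∈ (star s).carrier} = s.carrier := by
  have := congrArg OpenGSet.carrier (star_star s)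
  exact this

theorem exists_transports' (s : OpenGSet G) {b : C₀(unitSpace G, ℂ)}
    (hb : ∀ u, u ∉ rngU '' s.carrier → b u = 0) : ∃ a, Transports s.carrier a b := by
  obtain ⟨a, ha⟩ := exists_transports (star s) (a := b) fun u hu => hb u fun ⟨x, hx, e⟩ =>
    hu ⟨inv x, inv_mem_star hx, by rw [domU_inv, e]⟩
  have := ha.symm
  rw [inv_inv_carrier] at this
  exact ⟨a, this⟩

theorem mem_r_iff (s : OpenGSet G) (u : unitSpace G) :
    (u : G) ∈ (InverseSemigroup.r s).carrier ↔ u ∈ rngU '' s.carrier := by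
  have : (InverseSemigroup.r s).carrier = rng '' s.carrier := s.isGSet'.setComp_inv
  rw [this]
  exact ⟨fun ⟨x, hx, e⟩ => ⟨x, hx, Subtype.ext e⟩,
    fun ⟨x, hx, e⟩ => ⟨x, hx, congrArg Subtype.val e⟩⟩

theorem mem_d_iff (s : OpenGSet G) (u : unitSpace G) :
    (u : G) ∈ (InverseSemigroup.d s).carrier ↔ u ∈ domU '' s.carrier := by
  have : InverseSemigroup.d s = InverseSemigroup.r (star s) := by
    rw [InverseSemigroup.d, InverseSemigroup.r, star_star]
  rw [this, mem_r_iff]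
  constructor
  · rintro ⟨x, hx, rfl⟩
    exact ⟨inv x, hx, domU_inv x⟩
  · rintro ⟨x, hx, rfl⟩
    exact ⟨inv x, inv_mem_star hx, rngU_inv x⟩

/-- For u = r(x), injectivity of the range map on s leaves x⁻¹ r(x) x as the only product. This
turns the formula f(s*us) into f(d(x)). -/
theorem conj_singleton (s : OpenGSet G) {x : G} (hx : x ∈ s.carrier) :
    setComp (setComp (star s).carrier {rng x}) s.carrier = {dom x} := by
  ext z
  constructor
  · rintro ⟨_, ⟨y, hy, _, rfl, h, rfl⟩, w, hw, h', rfl⟩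
    rw [rng_rng] at h
    have hw' : rng w = rng x := by rw [← h', dom_comp, dom_rng]
    have hwx : w = x := s.isGSet'.1 hw hx hw'
    have hyx : y = inv x := by
      have : inv y = x := s.isGSet'.1 hy hx (by rw [rng_inv, h])
      rw [← this, inv_inv_arrow]
    subst hwx hyx
    rw [Set.mem_singleton_iff, comp_assoc _ _ _ (by rw [h, rng_rng]) (dom_rng w), ← inv_comp w]
    exact comp_congr rfl (rng_comp_self w) _ _
  · rintro rfl
    refine ⟨inv x, ⟨inv x, inv_mem_star hx, rng x, rfl,
      by rw [dom_inv, rng_rng], ?_⟩, x, hx, dom_inv x, inv_comp x⟩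
    exact (comp_congr rfl (dom_inv x).symm _ (rng_dom _).symm).trans (comp_dom_self (inv x))

variable {S : InverseSubsemigroup (OpenGSet G)}

/-- The description by domains and pointwise formulas is replaced by a graph. The backward half of
the graph equivalence holds because the image of a under β_s is itself a transport of a, and
transports are unique. -/
theorem isCanonicalAction_iff (β : InverseSemigroupAction S C₀(unitSpace G, ℂ)) :
    IsCanonicalAction β ↔ ∀ s a b, (β s).Maps a b ↔ Transports s.1.carrier a b := by
  constructor
  · intro h s a b
    have key : ∀ a b, (β s).Maps a b → Transports s.1.carrier a b := by
      rintro a _ ⟨ha, rfl⟩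
      refine ⟨fun u hu => ((h s).1 a).mp ha u (by rwa [mem_d_iff]),
        fun u hu => ((h s).2 ⟨a, ha⟩ u).2 (by rwa [mem_r_iff]), fun x hx => ?_⟩
      exact ((h s).2 ⟨a, ha⟩ (rngU x)).1 (by rw [mem_r_iff]; exact ⟨x, hx, rfl⟩) (domU x)
        (conj_singleton s.1 hx)
    refine ⟨key a b, fun ht => ?_⟩
    have ha : a ∈ (β s).Dom := ((h s).1 a).mpr fun u hu => ht.1 u (by rwa [mem_d_iff] at hu)
    obtain ⟨b', hb'⟩ := PartialAut.exists_maps_of_mem_dom ha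
    rwa [ht.right_unique (key a b' hb')]
  · intro h s
    refine ⟨fun f => ⟨fun hf u hu => ?_, fun hf => ?_⟩, fun f u => ⟨fun hu v hv => ?_, fun hu => ?_⟩⟩
    · obtain ⟨b, hb⟩ := PartialAut.exists_maps_of_mem_dom hf
      exact ((h s f b).mp hb).1 u (by rwa [mem_d_iff] at hu)
    · obtain ⟨b, hb⟩ := exists_transports s.1 (a := f) fun u hu => hf u (by rwa [mem_d_iff])
      exact ((h s f b).mpr hb).mem_dom
    · rw [mem_r_iff] at hu
      obtain ⟨x, hx, rfl⟩ := hu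
      have h1 := (conj_singleton s.1 hx).symm.trans hv
      rw [((h s _ _).mp ((β s).maps_equiv f)).2.2 x hx]
      exact congrArg _ (Subtype.ext (Set.singleton_injective h1))
    · rw [mem_r_iff] at hu
      exact ((h s _ _).mp ((β s).maps_equiv f)).2.1 u hu

/-- The function that corresponds along `s` to a function vanishing off the domain of `s`. -/
noncomputable def transport (s : OpenGSet G)
    (a : (vanishingIdeal (domU '' s.carrier)).toNonUnitalStarSubalgebra) :
    (vanishingIdeal (rngU '' s.carrier)).toNonUnitalStarSubalgebra :=
  ⟨(exists_transports s a.2).choose, (exists_transports s a.2).choose_spec.2.1⟩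

theorem transports_transport (s : OpenGSet G)
    (a : (vanishingIdeal (domU '' s.carrier)).toNonUnitalStarSubalgebra) :
    Transports s.carrier a (transport s a) := (exists_transports s a.2).choose_spec

theorem transport_eq {s : OpenGSet G}
    {a : (vanishingIdeal (domU '' s.carrier)).toNonUnitalStarSubalgebra}
    {b : (vanishingIdeal (rngU '' s.carrier)).toNonUnitalStarSubalgebra}
    (h : Transports s.carrier (a : C₀(unitSpace G, ℂ)) b) : transport s a = b :=
  Subtype.ext ((transports_transport s a).right_unique h)

/-- The partial automorphism of `C₀(G⁰)` given by an open `G`-set. -/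
noncomputable def transportAut (s : OpenGSet G) : PartialAut C₀(unitSpace G, ℂ) where
  dom := vanishingIdeal (domU '' s.carrier)
  ran := vanishingIdeal (rngU '' s.carrier)
  equiv :=
    { toFun := transport s
      invFun := fun b =>
        ⟨(exists_transports' s b.2).choose, (exists_transports' s b.2).choose_spec.1⟩
      left_inv := fun a => Subtype.ext
        ((exists_transports' s (transport s a).2).choose_spec.left_unique
          (transports_transport s a))
      right_inv := fun b => transport_eq (exists_transports' s b.2).choose_spec
      map_mul' := fun a b =>
        transport_eq ((transports_transport s a).mul (transports_transport s b))
      map_add' := fun a b =>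
        transport_eq ((transports_transport s a).add (transports_transport s b))
      map_smul' := fun k a => transport_eq ((transports_transport s a).smul k)
      map_star' := fun a => transport_eq (transports_transport s a).star }

theorem mem_transportAut_dom {s : OpenGSet G} {a : C₀(unitSpace G, ℂ)} :
    a ∈ (transportAut s).Dom ↔ ∀ u, u ∉ domU '' s.carrier → a u = 0 := mem_vanishingIdeal

theorem transportAut_maps (s : OpenGSet G) (a b : C₀(unitSpace G, ℂ)) :
    (transportAut s).Maps a b ↔ Transports s.carrier a b := by
  constructor
  · rintro ⟨ha, rfl⟩
    exact transports_transport s ⟨a, ha⟩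
  · intro h
    exact ⟨mem_transportAut_dom.mpr h.1, congrArg Subtype.val
      (transport_eq (a := ⟨a, mem_transportAut_dom.mpr h.1⟩)
        (b := ⟨b, mem_vanishingIdeal.mpr h.2.1⟩) h)⟩

/-- The domains match exactly: if a vanishes off d(st), then its transport along t vanishes off
d(s), since a unit r(y) = d(x) with y in t and x in s comes from the composable product xy. -/
theorem transportAut_isComp (s t : OpenGSet G) :
    (transportAut s).IsComp (transportAut t) (transportAut (s * t)) := by
  intro a c
  simp only [transportAut_maps]
  constructor
  · intro h
    obtain ⟨b, hb⟩ := exists_transports t (a := a) fun u hu => h.1 u fun ⟨z, hz, e⟩ => by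
      obtain ⟨x, hx, y, hy, h', rfl⟩ := hz
      exact hu ⟨y, hy, by rw [← e, domU_comp]⟩
    obtain ⟨c', hc'⟩ := exists_transports s (a := b) fun u hu => by
      by_cases hut : u ∈ rngU '' t.carrier
      · obtain ⟨y, hy, rfl⟩ := hut
        rw [hb.2.2 y hy]
        refine h.1 _ fun ⟨z, hz, e⟩ => ?_
        obtain ⟨x, hx, y', hy', h', rfl⟩ := hz
        rw [domU_comp] at e
        obtain rfl := t.isGSet'.2 hy' hy (congrArg Subtype.val e)
        exact hu ⟨x, hx, Subtype.ext h'⟩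
      · exact hb.2.1 u hut
    refine ⟨b, hb, ?_⟩
    have hcc : c = c' := h.right_unique (hb.comp hc')
    rwa [hcc]
  · rintro ⟨b, hb, hc⟩
    exact hb.comp hc

/-- Write x = yz with y, z in e. Then yz and y have the same range in the G-set e, so yz = y and z
is the unit d(y); comparing domains gives yz = z. -/
theorem idem_subset_units {e : OpenGSet G} (he : e * e = e) : e.carrier ⊆ unitSpace G := by
  intro x hx
  rw [← he] at hx
  obtain ⟨y, hy, z, hz, h, rfl⟩ := hx
  have hmem : comp y z h ∈ e.carrier := by rw [← he]; exact ⟨y, hy, z, hz, h, rfl⟩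
  have h1 : comp y z h = y := e.isGSet'.1 hmem hy (rng_comp y z h)
  have h2 : z = dom y := comp_left_cancel (h := h) (h' := (rng_dom y).symm)
    (h1.trans (comp_dom_self y).symm)
  have h3 : comp y z h = z := e.isGSet'.2 hmem hz (dom_comp y z h)
  rw [h3, h2]
  exact rng_dom y

theorem idem_of_subset_units {e : OpenGSet G} (he : e.carrier ⊆ unitSpace G) : e * e = e := by
  refine OpenGSet.ext' ?_
  show setComp e.carrier e.carrier = e.carrier
  rw [setComp_of_subset_units _ he]
  ext x
  exact ⟨fun h => h.1, fun h => ⟨h, by rwa [show rng x = x from he h]⟩⟩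

/-- The set ss*t is the part of t whose ranges lie in r(s); when s ⊆ t, injectivity of the range map
on t makes it s. -/
theorem natLE_iff {s t : OpenGSet G} : InverseSemigroup.NatLE s t ↔ s.carrier ⊆ t.carrier := by
  have h0 : (s * star s * t).carrier = {y | y ∈ t.carrier ∧ rng y ∈ rng '' s.carrier} := by
    show setComp (setComp s.carrier {x | inv x ∈ s.carrier}) t.carrier = _
    rw [s.isGSet'.setComp_inv, setComp_of_subset_units _ (rng_image_subset _)]
  constructor
  · intro h x hx
    have h' : s = s * star s * t := h
    rw [h', h0] at hx
    exact hx.1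
  · intro h
    refine OpenGSet.ext' ?_
    rw [h0]
    ext x
    constructor
    · exact fun hx => ⟨h hx, x, hx, rfl⟩
    · rintro ⟨hx, y, hy, e⟩
      rwa [← t.isGSet'.1 (h hy) hx e]

end Transport

/-! ### Full inverse semigroups and the canonical action -/

namespace InverseSubsemigroup

variable {G : Type u} [TopologicalSpace G] [ArrowGroupoid G] [hG : IsRDiscrete G]
  {S : InverseSubsemigroup (OpenGSet G)}

/-- Idempotents are open sets of units, so the union of two of them is automatically an open G-set
and an idempotent; it serves as the upper bound. -/
theorem IsAdditive.isFull (h : S.IsAdditive) : S.IsFull := by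
  refine ⟨h.1, fun e f he hf => ?_⟩
  have he' := idem_subset_units (congrArg Subtype.val he)
  have hf' := idem_subset_units (congrArg Subtype.val hf)
  have hu : e.1.carrier ∪ f.1.carrier ⊆ unitSpace G := Set.union_subset he' hf'
  set g : OpenGSet G := ⟨_, e.1.isOpen'.union f.1.isOpen', isGSet_of_subset_units hu⟩ with hg
  refine ⟨⟨g, h.2 e.1 f.1 g e.2 f.2 rfl⟩, Subtype.ext (idem_of_subset_units hu), ?_, ?_⟩
  · exact Subtype.ext (natLE_iff (s := e.1) (t := g) |>.mpr Set.subset_union_left)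
  · exact Subtype.ext (natLE_iff (s := f.1) (t := g) |>.mpr Set.subset_union_right)

theorem IsBase.exists_mem_subset (h : S.IsBase) {x : G} {U : Set G} (hU : IsOpen U) (hx : x ∈ U) :
    ∃ s : S, x ∈ s.1.carrier ∧ s.1.carrier ⊆ U := by
  obtain ⟨_, ⟨s, hs, rfl⟩, hxs, hsU⟩ := h.exists_subset_of_mem_open hx hU
  exact ⟨⟨s, hs⟩, hxs, hsU⟩

/-- The idempotent `d(s)` consists of the domains of the arrows of `s`. -/
theorem d_carrier (s : OpenGSet G) : (star s * s).carrier = dom '' s.carrier := by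
  have h := (star s).isGSet'.setComp_inv
  rw [inv_inv_carrier] at h
  refine Eq.trans h ?_
  ext x
  constructor
  · rintro ⟨y, hy, rfl⟩; exact ⟨inv y, hy, dom_inv y⟩
  · rintro ⟨y, hy, rfl⟩
    exact ⟨inv y, inv_mem_star hy, rng_inv y⟩

theorem star_mul_self_idem {T : Type u} [InverseSemigroup T] (s : T) :
    (star s * s) * (star s * s) = star s * s := by
  rw [← mul_assoc, InverseSemigroup.star_mul_self_star]

theorem IsFull.exists_idem_ge (h : S.IsFull) (s t : S) : ∃ g : S, g * g = g ∧
    domU '' s.1.carrier ⊆ domU '' g.1.carrier ∧ domU '' t.1.carrier ⊆ domU '' g.1.carrier := by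
  obtain ⟨g, hg, h1, h2⟩ := h.2 _ _ (star_mul_self_idem s) (star_mul_self_idem t)
  have hgu := idem_subset_units (congrArg Subtype.val hg)
  have key : ∀ s : S, InverseSemigroup.NatLE (star s * s) g →
      domU '' s.1.carrier ⊆ domU '' g.1.carrier := by
    rintro s hs _ ⟨x, hx, rfl⟩
    have h1 : InverseSemigroup.NatLE (star s.1 * s.1) g.1 := congrArg Subtype.val hs
    have h2 := natLE_iff.mp h1
    rw [d_carrier] at h2
    exact ⟨dom x, h2 ⟨x, hx, rfl⟩, domU_coe (domU x)⟩
  exact ⟨g, hg, key s h1, key t h2⟩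

/-- The domains d(s) form an open cover of the unit space, directed by fullness, so one of them
contains the compact set; enlarging it gives an idempotent. -/
theorem IsFull.exists_idem_of_isCompact (h : S.IsFull) {K : Set (unitSpace G)} (hK : IsCompact K)
    (hne : K.Nonempty) : ∃ g : S, g * g = g ∧ K ⊆ domU '' g.1.carrier := by
  have key : ∃ g : S, K ⊆ domU '' g.1.carrier := by
    have hS : ∀ u : unitSpace G, ∃ s : S, u ∈ domU '' s.1.carrier := fun u => by
      obtain ⟨s, hs, -⟩ := h.1.exists_mem_subset isOpen_univ (Set.mem_univ (u : G))
      exact ⟨s, u, hs, domU_coe u⟩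
    obtain ⟨u, -⟩ := hne
    have : Nonempty S := ⟨(hS u).choose⟩
    refine hK.elim_directed_cover (fun s : S => domU '' s.1.carrier) (fun s =>
      hG.isLocalHomeomorph_dom.isOpenMap _ s.1.isOpen')
      (fun u _ => Set.mem_iUnion.mpr (hS u)) fun s t => ?_
    obtain ⟨g, -, h1, h2⟩ := h.exists_idem_ge s t
    exact ⟨g, h1, h2⟩
  obtain ⟨s, hs⟩ := key
  obtain ⟨g, hg, h1, -⟩ := h.exists_idem_ge s s
  exact ⟨g, hg, hs.trans h1⟩

open ConvolutionAlgebra in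
/-- The canonical action of a full inverse semigroup of open `G`-sets on `C₀(G⁰)`. -/
noncomputable def IsFull.action (h : S.IsFull) : InverseSemigroupAction S C₀(unitSpace G, ℂ) where
  toPAut s := transportAut s.1
  map_mul' s t := transportAut_isComp s.1 t.1
  directed' s t := by
    obtain ⟨g, -, h1, h2⟩ := h.exists_idem_ge s t
    exact ⟨g,
      fun a ha => mem_transportAut_dom.mpr fun u hu => mem_transportAut_dom.mp ha u (mt (@h1 u) hu),
      fun a ha => mem_transportAut_dom.mpr fun u hu => mem_transportAut_dom.mp ha u (mt (@h2 u) hu)⟩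
  dense_span' := by
    intro b
    rw [Metric.mem_closure_iff]
    intro ε hε
    obtain ⟨f, hf, hfb⟩ := exists_fibreSum_near isOpen_unitSpace isGSet_unitSpace (b := b)
      (fun u hu => absurd ⟨u.1, u.2, rngU_coe u⟩ hu) (half_pos hε)
    refine ⟨fibreSum f, ?_, ?_⟩
    -- The empty support is treated apart: if G is empty, S may have no element to cover it with.
    · rcases (rngU '' tsupport f).eq_empty_or_nonempty with h0 | hne
      · have : fibreSum f = 0 := by
          ext u
          exact fibreSum_of_notMem subset_rfl (by rw [h0]; exact Set.notMem_empty u)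
        rw [this]; exact zero_mem _
      · obtain ⟨g, -, hg⟩ := h.exists_idem_of_isCompact
          (f.hasCompactSupport.isCompact.image continuous_rngU) hne
        refine Submodule.subset_span (Set.mem_iUnion.mpr ⟨g,
          mem_transportAut_dom.mpr fun u hu => ?_⟩)
        exact fibreSum_of_notMem subset_rfl fun h => hu (hg h)
    · rw [dist_comm, dist_eq_norm]
      exact hfb.trans_lt (half_lt_self hε)

theorem IsFull.existsUnique_action (h : S.IsFull) :
    ∃! β : InverseSemigroupAction S C₀(unitSpace G, ℂ), IsCanonicalAction β := by
  refine ⟨h.action, (isCanonicalAction_iff _).mpr fun s a b => transportAut_maps s.1 a b,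
    fun β hβ => ?_⟩
  have : β.toPAut = h.action.toPAut := by
    funext s
    refine PartialAut.ext_maps fun a b => ?_
    exact ((isCanonicalAction_iff β).mp hβ s a b).trans (transportAut_maps s.1 a b).symm
  obtain ⟨p, h1, h2, h3⟩ := β
  obtain rfl : p = h.action.toPAut := this
  rfl

end InverseSubsemigroup

/-! ### Norm estimates for representations -/

namespace ConvolutionAlgebra

variable {G : Type u} [TopologicalSpace G] [ArrowGroupoid G] [hG : IsRDiscrete G]

theorem unit_mul_apply {F : ConvolutionAlgebra G} (hF : tsupport F ⊆ unitSpace G)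
    (g : ConvolutionAlgebra G) (z : G) : (F * g) z = F (rng z) * g z := by
  have h := mul_apply_of_left F g (dom_rng z) (eq_of_rng_eq isGSet_unitSpace hF (rng_rng z))
  rwa [rng_comp_self] at h

theorem mul_unit_apply {F : ConvolutionAlgebra G} (hF : tsupport F ⊆ unitSpace G)
    (g : ConvolutionAlgebra G) (z : G) : (g * F) z = g z * F (dom z) := by
  have h := mul_apply_of_right g F (rng_dom z).symm (eq_of_dom_eq isGSet_unitSpace hF (rng_dom z))
  rwa [comp_dom_self] at h

theorem unit_mul_unit_apply {F F' : ConvolutionAlgebra G} (hF : tsupport F ⊆ unitSpace G)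
    (hF' : tsupport F' ⊆ unitSpace G) (z : G) : (F * F') z = F z * F' z := by
  rw [unit_mul_apply hF]
  by_cases hz : z ∈ unitSpace G
  · rw [show rng z = z from hz]
  · rw [apply_eq_zero hF' hz, mul_zero, mul_zero]

theorem star_unit_apply {F : ConvolutionAlgebra G} (hF : tsupport F ⊆ unitSpace G) (z : G) :
    (star F) z = star (F z) := by
  rw [star_apply]
  by_cases hz : z ∈ unitSpace G
  · rw [inv_eq_of_mem hz]
  · rw [apply_eq_zero hF hz, apply_eq_zero hF fun h => hz (inv_mem_unitSpace h)]

variable (G) in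
/-- The subalgebra of the functions supported by the unit space. -/
noncomputable def unitFunctions : NonUnitalStarSubalgebra ℂ (ConvolutionAlgebra G) where
  carrier := {F | tsupport F ⊆ unitSpace G}
  add_mem' hF hF' := tsupport_add_subset hF hF'
  zero_mem' := by
    show tsupport _ ⊆ _
    rw [tsupport_zero]; exact Set.empty_subset _
  mul_mem' hF hF' := (tsupport_mul_subset hF hF').trans (by
    rw [setComp_of_subset_units _ subset_rfl]; exact fun x hx => hx.1)
  smul_mem' k _ hF := (tsupport_smul_subset k _).trans hF
  star_mem' hF := (tsupport_star_subset hF).trans fun _ h => inv_mem_unitSpace h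

theorem fibreSum_unit {F : ConvolutionAlgebra G} (hF : tsupport F ⊆ unitSpace G)
    (u : unitSpace G) : fibreSum F u = F u := by
  have := fibreSum_of_mem isGSet_unitSpace hF u.2
  rwa [rngU_coe] at this

/-- The restriction of functions to the unit space. -/
noncomputable def restrictUnits : unitFunctions G →⋆ₙₐ[ℂ] C₀(unitSpace G, ℂ) where
  toFun F := fibreSum F.1
  map_zero' := map_zero fibreSum
  map_add' F F' := map_add fibreSum F.1 F'.1
  map_smul' k F := map_smul fibreSum k F.1
  map_mul' F F' := by
    ext u
    rw [ZeroAtInftyContinuousMap.mul_apply, fibreSum_unit F.2, fibreSum_unit F'.2,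
      fibreSum_unit (F * F').2]
    exact unit_mul_unit_apply F.2 F'.2 u
  map_star' F := by
    ext u
    rw [ZeroAtInftyContinuousMap.star_apply, fibreSum_unit F.2, fibreSum_unit (star F).2]
    exact star_unit_apply F.2 u

theorem denseRange_restrictUnits : DenseRange (restrictUnits (G := G)) := by
  intro b
  rw [Metric.mem_closure_iff]
  intro ε hε
  obtain ⟨f, hf, hfb⟩ := exists_fibreSum_near isOpen_unitSpace isGSet_unitSpace (b := b)
    (fun u hu => absurd ⟨u.1, u.2, rngU_coe u⟩ hu) (half_pos hε)
  refine ⟨_, ⟨⟨f, hf⟩, rfl⟩, ?_⟩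
  rw [dist_comm, dist_eq_norm]
  exact hfb.trans_lt (half_lt_self hε)

/-- On the unit space convolution is the pointwise product. For |k| > sup|F| the function F/(k − F)
is again continuous with compact support in the units, and it is the quasi-inverse of −k⁻¹F. The
bound is purely algebraic, so it passes to every representation. -/
theorem norm_le_of_mem_quasispectrum {F : unitFunctions G} {c : ℝ} (hc : 0 ≤ c)
    (h : ∀ x, ‖F.1 x‖ ≤ c) {k : ℂ}
    (hk : k ∈ quasispectrum ℂ F) : ‖k‖ ≤ c := by
  by_contra! hlt
  have hk0 : k ≠ 0 := by
    rintro rfl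
    rw [norm_zero] at hlt
    exact absurd hc (not_le.mpr hlt)
  have hne : ∀ x, k - F.1 x ≠ 0 := fun x hx => by
    rw [sub_eq_zero] at hx
    exact absurd (h x) (not_le.mpr (hx ▸ hlt))
  have hcs : HasCompactSupport fun x => F.1 x / (k - F.1 x) := by
    simp only [div_eq_mul_inv]
    exact F.1.hasCompactSupport.mul_right
  set y : ConvolutionAlgebra G := mk (fun x => F.1 x / (k - F.1 x))
    (F.1.continuous.div (continuous_const.sub F.1.continuous) hne) hcs with hy
  have hyu : tsupport y ⊆ unitSpace G := by
    refine (closure_mono fun x hx => ?_).trans F.2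
    intro h0
    exact hx (show F.1 x / (k - F.1 x) = 0 by rw [h0, zero_div])
  -- For k ≠ 0, membership in the quasispectrum says that −k⁻¹F is not quasiregular; `y` contradicts
  -- this.
  refine hk (isUnit_iff_ne_zero.mpr hk0) ?_
  have hunit : (isUnit_iff_ne_zero.mpr hk0).unit⁻¹ • F = k⁻¹ • F := by
    rw [Units.smul_def, Units.val_inv_eq_inv_val, IsUnit.unit_spec]
  rw [isQuasiregular_iff, hunit]
  have hsc : tsupport (-(k⁻¹ • F.1) : ConvolutionAlgebra G) ⊆ unitSpace G := by
    have := (-((k⁻¹ • F : unitFunctions G))).2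
    exact this
  have hneg : ∀ x, (-(k⁻¹ • F.1) : ConvolutionAlgebra G) x = -(k⁻¹ * F.1 x) := fun x => rfl
  refine ⟨⟨y, hyu⟩, Subtype.ext (ext' fun x => ?_), Subtype.ext (ext' fun x => ?_)⟩
  · show y x + (-(k⁻¹ • F.1) : ConvolutionAlgebra G) x +
      ((-(k⁻¹ • F.1) : ConvolutionAlgebra G) * y) x = 0
    rw [unit_mul_unit_apply hsc hyu, hneg, hy, mk_apply]
    have := hne x
    field_simp
    ring
  · show (-(k⁻¹ • F.1) : ConvolutionAlgebra G) x + y x +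
      (y * (-(k⁻¹ • F.1) : ConvolutionAlgebra G)) x = 0
    rw [unit_mul_unit_apply hyu hsc, hneg, hy, mk_apply]
    have := hne x
    field_simp
    ring

variable {H : Type u} [NormedAddCommGroup H] [InnerProductSpace ℂ H] [CompleteSpace H]
  (ρ : ConvolutionAlgebra G →⋆ₙₐ[ℂ] (H →L[ℂ] H))

/-- The norm of a self-adjoint operator is its spectral radius, and homomorphisms do not enlarge
quasispectra. No continuity of `ρ` enters. -/
theorem norm_map_unit_le {F : ConvolutionAlgebra G} (hF : tsupport F ⊆ unitSpace G)
    (hsa : star F = F) {c : ℝ} (hc : 0 ≤ c) (h : ∀ x, ‖F x‖ ≤ c) : ‖ρ F‖ ≤ c := by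
  have hsa' : IsSelfAdjoint (ρ F) := by
    show star (ρ F) = ρ F
    rw [← map_star, hsa]
  have h1 := hsa'.spectralRadius_eq_nnnorm
  have h2 : spectralRadius ℂ (ρ F) ≤ ENNReal.ofNNReal (⟨c, hc⟩ : NNReal) := by
    refine iSup₂_le fun k hk => ?_
    have hk' : k ∈ quasispectrum ℂ (⟨F, hF⟩ : unitFunctions G) :=
      NonUnitalAlgHom.quasispectrum_apply_subset
        (ρ.comp (NonUnitalStarSubalgebraClass.subtype (unitFunctions G))) _
        (spectrum_subset_quasispectrum ℂ _ hk)
    have h3 : ‖k‖₊ ≤ ⟨c, hc⟩ := norm_le_of_mem_quasispectrum (F := ⟨F, hF⟩) hc h hk'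
    exact ENNReal.coe_le_coe.mpr h3
  rw [h1] at h2
  have h3 : ‖ρ F‖₊ ≤ ⟨c, hc⟩ := ENNReal.coe_le_coe.mp h2
  exact h3

/-- A representation is contractive on the functions supported by a `G`-set, relative to the
supremum norm. -/
theorem norm_map_le {f : ConvolutionAlgebra G} {s : Set G} (hs : IsGSet s) (hf : tsupport f ⊆ s)
    {c : ℝ} (hc : 0 ≤ c) (h : ∀ x, ‖f x‖ ≤ c) : ‖ρ f‖ ≤ c := by
  have hu : tsupport (star f * f : ConvolutionAlgebra G) ⊆ unitSpace G :=
    (tsupport_mul_subset (tsupport_star_subset hf) hf).trans (setComp_inv_subset_units hs)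
  -- The product f*f is self-adjoint, supported by units and bounded by c²; the C*-identity then
  -- gives the estimate for f.
  have h1 : ‖ρ (star f * f)‖ ≤ c * c := by
    refine norm_map_unit_le ρ hu (by rw [star_mul, star_star]) (mul_nonneg hc hc) fun z => ?_
    by_cases hz : (star f * f) z = 0
    · rw [hz, norm_zero]; exact mul_nonneg hc hc
    · obtain ⟨x, y, hxy, hx, -, rfl⟩ := exists_of_mul_apply_ne_zero hz
      rw [mul_apply_of_left _ _ hxy (eq_of_rng_eq hs.inv (tsupport_star_subset hf)
        (tsupport_star_subset hf (subset_tsupport _ hx))), norm_mul, star_apply, norm_star]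
      exact mul_le_mul (h _) (h _) (norm_nonneg _) hc
  rw [map_mul, map_star, CStarRing.norm_star_mul_self] at h1
  exact abs_le_of_sq_le_sq' (by rwa [sq, sq]) hc |>.2

/-- Inversion exchanges range and domain, so injectivity of the domain map near x is injectivity of
the range map near x⁻¹. -/
theorem exists_isGSet (x : G) : ∃ V : Set G, IsOpen V ∧ x ∈ V ∧ IsGSet V := by
  obtain ⟨V, hV, hxV, hi⟩ := exists_injOn_rng x
  obtain ⟨W, hW, hxW, hj⟩ := exists_injOn_rng (inv x)
  refine ⟨V ∩ inv ⁻¹' W, hV.inter (hW.preimage hG.continuous_inv), ⟨hxV, hxW⟩,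
    hi.mono Set.inter_subset_left, fun y hy z hz h => ?_⟩
  rw [← inv_inv_arrow y, hj hy.2 hz.2 (by rw [rng_inv, rng_inv, h]), inv_inv_arrow]

/-- On the functions supported by a compact set, all representations are uniformly bounded,
relative to the supremum norm. -/
theorem exists_uniform_bound {K : Set G} (hK : IsCompact K) : ∃ N : ℝ, 0 < N ∧
    ∀ (H : Type u) [NormedAddCommGroup H] [InnerProductSpace ℂ H] [CompleteSpace H]
      (ρ : ConvolutionAlgebra G →⋆ₙₐ[ℂ] (H →L[ℂ] H)) (f : ConvolutionAlgebra G),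
      tsupport f ⊆ K → ∀ c, 0 ≤ c → (∀ x, ‖f x‖ ≤ c) → ‖ρ f‖ ≤ N * c := by
  choose w hw hxw hwg using exists_isGSet (G := G)
  obtain ⟨n, p, φ, h1, h2, h3⟩ := exists_partition hK hw hxw
  -- Each of the `n` pieces of f lives on a G-set and contributes at most c; the extra 1 keeps the
  -- constant positive when `n = 0`.
  refine ⟨n + 1, by positivity, fun H _ _ _ ρ f hf c hc h => ?_⟩
  rw [← sum_cut (φ := φ) (f := f) fun x hx => h3 x (hf hx), map_sum]
  refine (norm_sum_le_of_le (n := fun _ => c) _ fun i _ => ?_).trans ?_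
  · exact norm_map_le ρ (hwg (p i)) ((tsupport_cut_subset_left _ _).trans (h1 i)) hc
      fun x => (norm_cut_le (h2 i) f x).trans (h x)
  · rw [Finset.sum_const, Finset.card_univ, Fintype.card_fin, nsmul_eq_mul]
    nlinarith

/-- Since `exists_uniform_bound` applies to all representations, the continuity condition in the
definition of C*(G) excludes none of them. -/
theorem isInductiveLimitContinuous : IsInductiveLimitContinuous ρ := by
  intro K hK ξ η ε hε
  obtain ⟨N, hN, hb⟩ := exists_uniform_bound hK
  have hpos : 0 < N * (‖ξ‖ * ‖η‖ + 1) := by positivity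
  -- The summand 1 covers zero vectors and makes the final inequality strict.
  refine ⟨ε / (N * (‖ξ‖ * ‖η‖ + 1)), div_pos hε hpos, fun f g hf hg hfg => ?_⟩
  have hsub : f - g = f + (-1 : ℂ) • g := by rw [neg_one_smul, sub_eq_add_neg]
  have h1 := hb H ρ (f - g) (by
    rw [hsub]; exact tsupport_add_subset hf ((tsupport_smul_subset _ _).trans hg)) _
    (div_pos hε hpos).le fun x => (hfg x).le
  have h2 : inner ℂ (ρ f ξ) η - inner ℂ (ρ g ξ) η = inner ℂ (ρ (f - g) ξ) η := by
    rw [map_sub, sub_apply, inner_sub_left]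
  rw [h2]
  calc ‖inner ℂ (ρ (f - g) ξ) η‖ ≤ ‖ρ (f - g) ξ‖ * ‖η‖ := norm_inner_le_norm _ _
    _ ≤ ‖ρ (f - g)‖ * ‖ξ‖ * ‖η‖ := by gcongr; exact ContinuousLinearMap.le_opNorm _ _
    _ ≤ N * (ε / (N * (‖ξ‖ * ‖η‖ + 1))) * ‖ξ‖ * ‖η‖ := by gcongr
    _ = ε * ((‖ξ‖ * ‖η‖) / (‖ξ‖ * ‖η‖ + 1)) := by field_simp
    _ < ε * 1 := by
        gcongr
        rw [div_lt_one (by positivity)]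
        exact lt_add_one _
    _ = ε := mul_one ε

theorem pointwiseBounded_continuousSeminorms :
    CStarSeminorm.PointwiseBounded (continuousSeminorms G) := by
  intro f
  obtain ⟨N, -, hb⟩ := exists_uniform_bound f.hasCompactSupport.isCompact
  obtain ⟨c, hc, hfc⟩ := f.exists_bound
  refine ⟨N * c, ?_⟩
  rintro _ ⟨_, ⟨H, i1, i2, i3, ρ, -, rfl⟩, rfl⟩
  exact hb H ρ f subset_rfl c hc hfc

end ConvolutionAlgebra

/-! ### Bounds for covariant representations -/

namespace InverseSemigroupAction

variable {S : Type u} [InverseSemigroup S] {B : Type u} [NonUnitalCStarAlgebra B]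
  {β : InverseSemigroupAction S B}

namespace CovariantRep

variable {H : Type u} [NormedAddCommGroup H] [InnerProductSpace ℂ H] [CompleteSpace H]
  (R : β.CovariantRep H)

theorem range_mul {s : S} {b : B} (hb : b ∈ (β s).Ran) :
    R.π b * (R.U s * star (R.U s)) = R.π b := by
  obtain ⟨a, ha⟩ := PartialAut.exists_maps_of_mem_ran hb
  have := R.mul_initial (β.maps_star.mpr ha)
  rwa [R.U_star, star_star] at this

/-- For T = π(b)U_s one has TT* = π(b)U_sU_s*π(b)* = π(b)π(b)*, since π(b) absorbs the range
projection of U_s. Hence ‖T‖ = ‖π(b)‖ ≤ ‖b‖. -/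
theorem norm_integratedForm_of_le {s : S} (b : β.Fib s) :
    ‖R.integratedForm (SectionAlgebra.of β b)‖ ≤ ‖b‖ := by
  rw [integratedForm_of]
  have h1 : R.π b * R.U s * star (R.π b * R.U s) = R.π b * star (R.π b) := by
    rw [star_mul, mul_assoc, ← mul_assoc (R.U s), ← mul_assoc, R.range_mul b.2]
  have h2 := congrArg norm h1
  rw [CStarRing.norm_self_mul_star, CStarRing.norm_self_mul_star] at h2
  have h3 : ‖R.π b * R.U s‖ = ‖R.π b‖ := by
    rwa [mul_self_inj_of_nonneg (norm_nonneg _) (norm_nonneg _)] at h2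
  rw [h3]
  exact NonUnitalStarAlgHom.norm_apply_le R.π (b : B)

end CovariantRep

variable (β) in
theorem pointwiseBounded_covariantSeminorms :
    CStarSeminorm.PointwiseBounded β.covariantSeminorms := by
  -- The constant is found before the representation is given: it is a sum of norms ‖bᵢ‖ over a
  -- decomposition of f into generators.
  have key : ∀ f : β.SectionAlgebra, ∃ c : ℝ, ∀ (H : Type u) [NormedAddCommGroup H]
      [InnerProductSpace ℂ H] [CompleteSpace H] (R : β.CovariantRep H),
      ‖R.integratedForm f‖ ≤ c := by
    intro f
    induction f using SectionAlgebra.induction with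
    | zero => exact ⟨0, fun H _ _ _ R => by rw [map_zero, norm_zero]⟩
    | of s b => exact ⟨‖b‖, fun H _ _ _ R => R.norm_integratedForm_of_le b⟩
    | add f g hf hg =>
      obtain ⟨c, hc⟩ := hf
      obtain ⟨c', hc'⟩ := hg
      exact ⟨c + c', fun H _ _ _ R => by
        rw [map_add]; exact norm_add_le_of_le (hc H R) (hc' H R)⟩
  intro f
  obtain ⟨c, hc⟩ := key f
  refine ⟨c, ?_⟩
  rintro _ ⟨_, ⟨H, i1, i2, i3, R, rfl⟩, rfl⟩
  exact hc H R

/-- The canonical map of the sections into the crossed product is contractive on each fibre. -/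
theorem norm_mkHom_of_le {s : S} (b : β.Fib s) :
    ‖CStarSeminorm.mkHom (CStarSeminorm.sup β.covariantSeminorms) (SectionAlgebra.of β b)‖ ≤ ‖b‖ := by
  rw [CStarSeminorm.norm_mkHom]
  refine CStarSeminorm.sup_le (pointwiseBounded_covariantSeminorms β) (norm_nonneg _) ?_
  rintro _ ⟨H, i1, i2, i3, R, rfl⟩
  exact R.norm_integratedForm_of_le b

/-- Every covariant representation extends to the crossed product. -/
theorem CovariantRep.exists_extension {H : Type u} [NormedAddCommGroup H] [InnerProductSpace ℂ H]
    [CompleteSpace H] (R : β.CovariantRep H) : ∃ Θ : β.CrossedProduct →⋆ₙₐ[ℂ] (H →L[ℂ] H),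
      ∀ f, Θ (CStarSeminorm.mkHom _ f) = R.integratedForm f :=
  _root_.exists_extension (CStarSeminorm.mkHom (CStarSeminorm.sup β.covariantSeminorms))
    (CStarSeminorm.denseRange_mkHom _) R.integratedForm fun f => by
      rw [CStarSeminorm.norm_mkHom]
      exact CStarSeminorm.le_sup (pointwiseBounded_covariantSeminorms β)
        (p := CStarSeminorm.ofRepresentation R.integratedForm) ⟨H, _, _, _, R, rfl⟩ f

end InverseSemigroupAction

/-! ### From the convolution algebra to the crossed product -/

namespace InverseSubsemigroup

variable {G : Type u} [TopologicalSpace G] [ArrowGroupoid G] [hG : IsRDiscrete G]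
  {S : InverseSubsemigroup (OpenGSet G)}

open ConvolutionAlgebra

/-- Every element of the convolution algebra is a sum of functions supported by elements of `S`. -/
theorem IsBase.exists_sum_eq (hS : S.IsBase) (f : ConvolutionAlgebra G) :
    ∃ (n : ℕ) (s : Fin n → S) (g : Fin n → ConvolutionAlgebra G),
      (∀ i, tsupport (g i) ⊆ (s i).1.carrier) ∧ ∑ i, g i = f := by
  choose w hw hwu using fun x => hS.exists_mem_subset isOpen_univ (Set.mem_univ (x : G))
  obtain ⟨n, p, φ, h1, -, h3⟩ := exists_partition f.hasCompactSupport.isCompact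
    (w := fun x => (w x).1.carrier) (fun x => (w x).1.isOpen') hw
  exact ⟨n, fun i => w (p i), fun i => cut (φ i) f,
    fun i => (tsupport_cut_subset_left _ _).trans (h1 i), sum_cut h3⟩

/-- Additive identities in C_c(G) need only be checked on functions supported by a single element of
S. -/
theorem IsBase.induction (hS : S.IsBase) {P : ConvolutionAlgebra G → Prop} (zero : P 0)
    (add : ∀ f g, P f → P g → P (f + g)) (of : ∀ (s : S) (f : ConvolutionAlgebra G), tsupport f ⊆ s.1.carrier → P f)
    (f : ConvolutionAlgebra G) : P f := by
  obtain ⟨n, s, g, hg, rfl⟩ := hS.exists_sum_eq f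
  exact Finset.sum_induction _ P add zero fun i _ => of (s i) (g i) (hg i)

/-! ### Gluing additive maps defined on the pieces C_c(s) -/

section Glue

variable {M : Type*} [AddCommGroup M] {L : S → ConvolutionAlgebra G → M}

/-- The functions `L s` are additive on the functions supported by `s`, and compatible with the
inclusions between the elements of `S`. -/
structure IsCompatible (L : S → ConvolutionAlgebra G → M) : Prop where
  add : ∀ (s : S) (f g : ConvolutionAlgebra G), tsupport f ⊆ s.1.carrier →
    tsupport g ⊆ s.1.carrier → L s (f + g) = L s f + L s g
  mono : ∀ (w s : S) (f : ConvolutionAlgebra G), w.1.carrier ⊆ s.1.carrier →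
    tsupport f ⊆ w.1.carrier → L w f = L s f

namespace IsCompatible

variable (hL : IsCompatible L)
include hL

theorem map_zero (s : S) : L s 0 = 0 := by
  have h0 : tsupport (0 : ConvolutionAlgebra G) ⊆ s.1.carrier := by
    rw [ConvolutionAlgebra.tsupport_zero]; exact Set.empty_subset _
  have := hL.add s 0 0 h0 h0
  rwa [add_zero, left_eq_add] at this

theorem map_sum {ι : Type*} (s : S) (t : Finset ι) (f : ι → ConvolutionAlgebra G)
    (hf : ∀ i, tsupport (f i) ⊆ s.1.carrier) : L s (∑ i ∈ t, f i) = ∑ i ∈ t, L s (f i) := by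
  classical
  induction t using Finset.induction_on with
  | empty => exact hL.map_zero s
  | insert i t hi ih =>
    rw [Finset.sum_insert hi, Finset.sum_insert hi, hL.add s _ _ (hf i)
      (tsupport_sum_subset fun j _ => hf j), ih]

theorem map_neg (s : S) {f : ConvolutionAlgebra G} (hf : tsupport f ⊆ s.1.carrier) :
    L s (-f) = -L s f := by
  have hn : tsupport (-f : ConvolutionAlgebra G) ⊆ s.1.carrier := by
    rw [← neg_one_smul ℂ]; exact (tsupport_smul_subset _ _).trans hf
  have := hL.add s (-f) f hn hf
  rw [neg_add_cancel, hL.map_zero] at this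
  exact eq_neg_of_add_eq_zero_left this.symm

/-- Every linear relation among functions supported by elements of S is a consequence of local ones.
Around each point choose w in S so small that, for each i, either w lies in s_i or w misses the
support of f_i. A partition of unity subordinate to these w cuts the relation into pieces; each
piece can be evaluated by `L w` alone, where additivity applies. -/
theorem sum_eq_zero (hS : S.IsBase) {ι : Type} [Fintype ι] (s : ι → S)
    (f : ι → ConvolutionAlgebra G) (hf : ∀ i, tsupport (f i) ⊆ (s i).1.carrier)
    (h0 : ∑ i, f i = 0) : ∑ i, L (s i) (f i) = 0 := by
  classical
  have hw : ∀ x : G, ∃ w : S, x ∈ w.1.carrier ∧ ∀ i,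
      (x ∈ (s i).1.carrier → w.1.carrier ⊆ (s i).1.carrier) ∧
      (x ∉ (s i).1.carrier → w.1.carrier ⊆ (tsupport (f i))ᶜ) := by
    intro x
    obtain ⟨w, hxw, hw⟩ := hS.exists_mem_subset (x := x)
      (U := ⋂ i, if x ∈ (s i).1.carrier then (s i).1.carrier else (tsupport (f i))ᶜ)
      (isOpen_iInter_of_finite fun i => by
        split_ifs
        · exact (s i).1.isOpen'
        · exact (isClosed_tsupport _).isOpen_compl)
      (Set.mem_iInter.mpr fun i => by
        split_ifs with h
        · exact h
        · exact fun hx => h (hf i hx))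
    refine ⟨w, hxw, fun i => ⟨fun h => ?_, fun h => ?_⟩⟩ <;>
      simpa [h] using hw.trans (Set.iInter_subset _ i)
  choose w hxw hw using hw
  obtain ⟨n, p, φ, h1, -, h3⟩ := exists_partition
    (isCompact_iUnion fun i => (f i).hasCompactSupport.isCompact)
    (w := fun x => (w x).1.carrier) (fun x => (w x).1.isOpen') hxw
  -- If the centre `p j` lies in s_i, then compatibility with w ⊆ s_i applies; otherwise w misses
  -- the support of f_i and the piece is zero.
  have hcut : ∀ i j, L (s i) (cut (φ j) (f i)) = L (w (p j)) (cut (φ j) (f i)) := by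
    intro i j
    by_cases h : p j ∈ (s i).1.carrier
    · exact (hL.mono _ _ _ ((hw (p j) i).1 h) ((tsupport_cut_subset_left _ _).trans (h1 j))).symm
    · have hz : cut (φ j) (f i) = 0 := by
        refine ext' fun x => ?_
        rw [cut_apply, ConvolutionAlgebra.zero_apply]
        by_cases hx : x ∈ tsupport (f i)
        · have : x ∉ tsupport (φ j) := fun hx' => (hw (p j) i).2 h (h1 j hx') hx
          rw [image_eq_zero_of_notMem_tsupport this]; simp
        · rw [image_eq_zero_of_notMem_tsupport hx, mul_zero]
      rw [hz, hL.map_zero, hL.map_zero]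
  calc ∑ i, L (s i) (f i) = ∑ i, L (s i) (∑ j, cut (φ j) (f i)) :=
        Finset.sum_congr rfl fun i _ => by
          rw [sum_cut fun x hx => h3 x (Set.mem_iUnion.mpr ⟨i, hx⟩)]
    _ = ∑ i, ∑ j, L (w (p j)) (cut (φ j) (f i)) := Finset.sum_congr rfl fun i _ => by
        rw [hL.map_sum _ _ _ fun j => (tsupport_cut_subset_right _ _).trans (hf i)]
        exact Finset.sum_congr rfl fun j _ => hcut i j
    _ = ∑ j, ∑ i, L (w (p j)) (cut (φ j) (f i)) := Finset.sum_comm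
    _ = ∑ j, L (w (p j)) (cut (φ j) (∑ i, f i)) := Finset.sum_congr rfl fun j _ => by
        rw [_root_.map_sum, hL.map_sum]
        exact fun i => (tsupport_cut_subset_left _ _).trans (h1 j)
    _ = 0 := Finset.sum_eq_zero fun j _ => by rw [h0, _root_.map_zero, hL.map_zero]

/-- A compatible family of additive functions, defined on the functions supported by the elements
of a base `S`, extends to the convolution algebra. -/
theorem exists_glue (hS : S.IsBase) :
    ∃ Λ : ConvolutionAlgebra G →+ M, ∀ (s : S) (f : ConvolutionAlgebra G), tsupport f ⊆ s.1.carrier → Λ f = L s f := by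
  choose n s g hg hsum using hS.exists_sum_eq
  -- Independence of the decomposition: two decompositions of f, one with its sign changed, form a
  -- single relation over the disjoint union of the index sets.
  have key : ∀ (f : ConvolutionAlgebra G) {ι : Type} [Fintype ι] (t : ι → S)
      (h : ι → ConvolutionAlgebra G), (∀ i, tsupport (h i) ⊆ (t i).1.carrier) → ∑ i, h i = f →
      ∑ i, L (s f i) (g f i) = ∑ i, L (t i) (h i) := by
    intro f ι _ t h ht hf
    have := hL.sum_eq_zero hS (ι := Fin (n f) ⊕ ι) (Sum.elim (s f) t)
      (Sum.elim (g f) fun i => -h i) (by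
        rintro (i | i)
        · exact hg f i
        · show tsupport (-h i : ConvolutionAlgebra G) ⊆ _
          rw [← neg_one_smul ℂ]; exact (tsupport_smul_subset _ _).trans (ht i))
      (by simp [hsum, hf])
    rw [Fintype.sum_sum_type] at this
    simp only [Sum.elim_inl, Sum.elim_inr] at this
    rw [Finset.sum_congr (g := fun i => -L (t i) (h i)) rfl fun i _ =>
      hL.map_neg (t i) (ht i), Finset.sum_neg_distrib] at this
    exact eq_of_sub_eq_zero (by rw [sub_eq_add_neg]; exact this)
  refine ⟨AddMonoidHom.mk' (fun f => ∑ i, L (s f i) (g f i)) fun f f' => ?_, fun t f hf => ?_⟩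
  -- The chosen decompositions of f and f', put side by side, decompose f + f'.
  · rw [key (f + f') (ι := Fin (n f) ⊕ Fin (n f')) (Sum.elim (s f) (s f'))
      (Sum.elim (g f) (g f')) (by
        rintro (i | i)
        · exact hg f i
        · exact hg f' i) (by simp [hsum])]
    simp
  · show ∑ i, L (s f i) (g f i) = L t f
    rw [key f (ι := Unit) (fun _ => t) (fun _ => f) (fun _ => hf) (by simp)]
    simp

end IsCompatible

end Glue

end InverseSubsemigroup

/-! ### The *-homomorphism from the convolution algebra to the crossed product -/

section CrossedProduct

variable {G : Type u} [TopologicalSpace G] [ArrowGroupoid G] [hG : IsRDiscrete G]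
  {S : InverseSubsemigroup (OpenGSet G)} {β : InverseSemigroupAction S C₀(unitSpace G, ℂ)}
  (hβ : IsCanonicalAction β)

open ConvolutionAlgebra InverseSemigroupAction

namespace IsCanonicalAction

include hβ

theorem maps_iff {s : S} {a b : C₀(unitSpace G, ℂ)} :
    (β s).Maps a b ↔ Transports s.1.carrier a b := (isCanonicalAction_iff β).mp hβ s a b

theorem mem_dom_iff {s : S} {a : C₀(unitSpace G, ℂ)} :
    a ∈ (β s).Dom ↔ ∀ u, u ∉ domU '' s.1.carrier → a u = 0 := by
  refine ⟨fun h => ?_, fun h => ?_⟩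
  · obtain ⟨b, hb⟩ := PartialAut.exists_maps_of_mem_dom h
    exact (hβ.maps_iff.mp hb).1
  · obtain ⟨b, hb⟩ := exists_transports s.1 h
    exact (hβ.maps_iff.mpr hb).mem_dom

theorem mem_ran_iff {s : S} {b : C₀(unitSpace G, ℂ)} :
    b ∈ (β s).Ran ↔ ∀ u, u ∉ rngU '' s.1.carrier → b u = 0 := by
  refine ⟨fun h => ?_, fun h => ?_⟩
  · obtain ⟨b, hb⟩ := PartialAut.exists_maps_of_mem_ran h
    exact (hβ.maps_iff.mp hb).2.1
  · obtain ⟨b, hb⟩ := exists_transports' s.1 h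
    exact (hβ.maps_iff.mpr hb).mem_ran

theorem fibreSum_mem {s : S} {f : ConvolutionAlgebra G} (hf : tsupport f ⊆ s.1.carrier) :
    fibreSum f ∈ (β s).Ran := hβ.mem_ran_iff.mpr fun _ hu => fibreSum_of_notMem hf hu

end IsCanonicalAction

/-- Here a plays the role of β_{s*}(f), so the conclusion says that f * g corresponds to
β_s(β_{s*}(f) g), the coefficient of the product of the generators (f, s) and (g, t). -/
theorem transports_mul {s t : OpenGSet G} {f g : ConvolutionAlgebra G}
    (hf : tsupport f ⊆ s.carrier) (hg : tsupport g ⊆ t.carrier) {a : C₀(unitSpace G, ℂ)}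
    (ha : Transports s.carrier a (fibreSum f)) :
    Transports s.carrier (a * fibreSum g) (fibreSum (f * g)) := by
  have hfg := tsupport_mul_subset hf hg
  refine ⟨fun u hu => ?_, fun u hu => ?_, fun x hx => ?_⟩
  · rw [ZeroAtInftyContinuousMap.mul_apply, ha.1 u hu, zero_mul]
  · refine fibreSum_of_notMem hfg ?_
    rintro ⟨_, ⟨x, hx, y, hy, h, rfl⟩, e⟩
    exact hu ⟨x, hx, by rw [← e, rngU_comp]⟩
  · rw [ZeroAtInftyContinuousMap.mul_apply, ← ha.2.2 x hx, fibreSum_of_mem s.isGSet' hf hx]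
    -- Either x extends to a product xy in st, and the convolution has the single term f(x)g(y), or
    -- no element of st has the range of x, and both sides vanish.
    by_cases hxt : domU x ∈ rngU '' t.carrier
    · obtain ⟨y, hy, e⟩ := hxt
      have h : dom x = rng y := (congrArg Subtype.val e).symm
      rw [← e, fibreSum_of_mem t.isGSet' hg hy, ← rngU_comp x y h,
        fibreSum_of_mem (s.isGSet'.comp t.isGSet') hfg ⟨x, hx, y, hy, h, rfl⟩]
      exact mul_apply_of_left f g h (eq_of_rng_eq s.isGSet' hf hx)
    · rw [fibreSum_of_notMem hg hxt, mul_zero]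
      refine fibreSum_of_notMem hfg ?_
      rintro ⟨_, ⟨x', hx', y, hy, h, rfl⟩, e⟩
      rw [rngU_comp] at e
      obtain rfl := s.isGSet'.1 hx' hx (congrArg Subtype.val e)
      exact hxt ⟨y, hy, Subtype.ext h.symm⟩

theorem transports_star {s : OpenGSet G} {f : ConvolutionAlgebra G}
    (hf : tsupport f ⊆ s.carrier) :
    Transports (star s).carrier (star (fibreSum f)) (fibreSum (star f)) := by
  have hsf : tsupport (star f : ConvolutionAlgebra G) ⊆ (star s).carrier := tsupport_star_subset hf
  refine ⟨fun u hu => ?_, fun u hu => fibreSum_of_notMem hsf hu, fun x hx => ?_⟩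
  · rw [ZeroAtInftyContinuousMap.star_apply, fibreSum_of_notMem hf, star_zero]
    rintro ⟨x, hx, rfl⟩
    exact hu ⟨inv x, inv_mem_star hx, domU_inv x⟩
  · rw [ZeroAtInftyContinuousMap.star_apply, fibreSum_of_mem (star s).isGSet' hsf hx, star_apply,
      ← rngU_inv, fibreSum_of_mem s.isGSet' hf hx]

theorem eq_mul_of_carrier_subset {w s : S} (h : w.1.carrier ⊆ s.1.carrier) :
    w = w * star w * s := Subtype.ext (natLE_iff.mpr h)

/-- From w = w w* s one gets U_w = U_wU_w*U_s, and π(b) absorbs the projection U_wU_w*. This is the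
relation that formal sums lack and functions satisfy. -/
theorem InverseSemigroupAction.CovariantRep.mul_U_of_subset {H : Type u} [NormedAddCommGroup H]
    [InnerProductSpace ℂ H] [CompleteSpace H] (R : β.CovariantRep H) {w s : S}
    (h : w.1.carrier ⊆ s.1.carrier) {b : C₀(unitSpace G, ℂ)} (hb : b ∈ (β w).Ran) :
    R.π b * R.U w = R.π b * R.U s := by
  conv_lhs => rw [eq_mul_of_carrier_subset h, R.U_mul, R.U_mul, R.U_star, ← mul_assoc,
    R.range_mul hb]

open Classical in
/-- The element of the crossed product given by a function supported by `s`. -/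
noncomputable def IsCanonicalAction.toCrossedProductOn (s : S) (f : ConvolutionAlgebra G) :
    β.CrossedProduct :=
  if h : tsupport f ⊆ s.1.carrier then
    CStarSeminorm.mkHom _ (SectionAlgebra.of β ⟨fibreSum f, hβ.fibreSum_mem h⟩) else 0

theorem IsCanonicalAction.toCrossedProductOn_eq {s : S} {f : ConvolutionAlgebra G}
    (h : tsupport f ⊆ s.1.carrier) : hβ.toCrossedProductOn s f =
      CStarSeminorm.mkHom _ (SectionAlgebra.of β ⟨fibreSum f, hβ.fibreSum_mem h⟩) := dif_pos h

/-- The generators over w and s may differ as formal sums, but all covariant seminorms vanish on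
their difference, so they coincide in the Hausdorff completion. -/
theorem IsCanonicalAction.toCrossedProductOn_mono {w s : S} {f : ConvolutionAlgebra G}
    (h : w.1.carrier ⊆ s.1.carrier) (hf : tsupport f ⊆ w.1.carrier) :
    hβ.toCrossedProductOn w f = hβ.toCrossedProductOn s f := by
  rw [hβ.toCrossedProductOn_eq hf, hβ.toCrossedProductOn_eq (hf.trans h), ← sub_eq_zero, ← map_sub,
    ← norm_eq_zero, CStarSeminorm.norm_mkHom]
  refine le_antisymm (CStarSeminorm.sup_le (pointwiseBounded_covariantSeminorms β) le_rfl ?_)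
    (CStarSeminorm.nonneg _ _)
  rintro _ ⟨H, i1, i2, i3, R, rfl⟩
  show ‖R.integratedForm _‖ ≤ 0
  rw [map_sub, CovariantRep.integratedForm_of, CovariantRep.integratedForm_of,
    R.mul_U_of_subset h (hβ.fibreSum_mem hf), sub_self, norm_zero]

theorem IsCanonicalAction.exists_toCrossedProduct (hS : S.IsBase) :
    ∃ Ψ : ConvolutionAlgebra G →⋆ₙₐ[ℂ] β.CrossedProduct, ∀ (s : S)
      (f : ConvolutionAlgebra G) (h : tsupport f ⊆ s.1.carrier), Ψ f =
        CStarSeminorm.mkHom _ (SectionAlgebra.of β ⟨fibreSum f, hβ.fibreSum_mem h⟩) := by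
  have hL : InverseSubsemigroup.IsCompatible hβ.toCrossedProductOn := ⟨fun s f g hf hg => by
      rw [hβ.toCrossedProductOn_eq hf, hβ.toCrossedProductOn_eq hg,
        hβ.toCrossedProductOn_eq (tsupport_add_subset hf hg), ← map_add, ← SectionAlgebra.of_add]
      congr 2
      exact Subtype.ext (map_add fibreSum f g),
    fun w s f h hf => hβ.toCrossedProductOn_mono h hf⟩
  obtain ⟨Λ, hΛ⟩ := hL.exists_glue hS
  have hΛ' : ∀ (s : S) (f : ConvolutionAlgebra G) (h : tsupport f ⊆ s.1.carrier), Λ f =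
      CStarSeminorm.mkHom _ (SectionAlgebra.of β ⟨fibreSum f, hβ.fibreSum_mem h⟩) :=
    fun s f h => (hΛ s f h).trans (hβ.toCrossedProductOn_eq h)
  refine ⟨{ toFun := Λ
            map_zero' := map_zero Λ
            map_add' := map_add Λ
            map_smul' := fun k f => ?_
            map_mul' := fun f g => ?_
            map_star' := fun f => ?_ }, hΛ'⟩
  · show Λ (k • f) = k • Λ f
    induction f using hS.induction with
    | zero => rw [smul_zero, map_zero, smul_zero]
    | add f g hf hg => rw [smul_add, map_add, map_add, smul_add, hf, hg]
    | of s f hf =>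
      rw [hΛ' s f hf, hΛ' s (k • f) ((tsupport_smul_subset k f).trans hf), ← map_smul,
        ← SectionAlgebra.of_smul]
      congr 2
      exact Subtype.ext (map_smul fibreSum k f)
  · show Λ (f * g) = Λ f * Λ g
    induction f using hS.induction with
    | zero => rw [zero_mul, map_zero, zero_mul]
    | add f f' hf hf' => rw [add_mul, map_add, map_add, add_mul, hf, hf']
    | of s f hf =>
      induction g using hS.induction with
      | zero => rw [mul_zero, map_zero, mul_zero]
      | add g g' hg hg' => rw [mul_add, map_add, map_add, mul_add, hg, hg']
      | of t g hg =>
        have hfg : tsupport (f * g : ConvolutionAlgebra G) ⊆ (s * t).1.carrier :=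
          tsupport_mul_subset hf hg
        rw [hΛ' s f hf, hΛ' t g hg, hΛ' (s * t) (f * g) hfg, ← map_mul, SectionAlgebra.of_mul_of]
        refine congrArg _ (SectionAlgebra.of_congr rfl ?_)
        -- This a is the preimage β_{s*}(f) that occurs in the product of generators.
        obtain ⟨a, ha⟩ := PartialAut.exists_maps_of_mem_ran (hβ.fibreSum_mem hf)
        exact (β.mulGen_eq ha
          (hβ.maps_iff.mpr (transports_mul hf hg (hβ.maps_iff.mp ha)))).symm
  · show Λ (star f) = star (Λ f)
    induction f using hS.induction with
    | zero => rw [star_zero, map_zero, star_zero]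
    | add f f' hf hf' => rw [star_add, map_add, map_add, star_add, hf, hf']
    | of s f hf =>
      have hsf : tsupport (star f : ConvolutionAlgebra G) ⊆ (star s).1.carrier :=
        tsupport_star_subset hf
      rw [hΛ' s f hf, hΛ' (star s) (star f) hsf, ← map_star, SectionAlgebra.star_of]
      refine congrArg _ (SectionAlgebra.of_congr rfl ?_)
      exact (hβ.maps_iff.mpr (transports_star hf)).right_unique (β.starGen_maps _)

/-- The functions coming from C_c(s) are dense in B_{r(s)}, and b ↦ (b, s) is contractive into the
crossed product; so each generator, and then each formal sum, is a limit of values of `Ψ`. -/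
theorem IsCanonicalAction.denseRange_toCrossedProduct
    {Ψ : ConvolutionAlgebra G →⋆ₙₐ[ℂ] β.CrossedProduct} (hΨ : ∀ (s : S)
      (f : ConvolutionAlgebra G) (h : tsupport f ⊆ s.1.carrier), Ψ f =
        CStarSeminorm.mkHom _ (SectionAlgebra.of β ⟨fibreSum f, hβ.fibreSum_mem h⟩)) :
    DenseRange Ψ := by
  let V : Submodule ℂ β.CrossedProduct :=
    LinearMap.range (⟨⟨Ψ, map_add Ψ⟩, map_smul Ψ⟩ : ConvolutionAlgebra G →ₗ[ℂ] β.CrossedProduct)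
  have hV : (V : Set β.CrossedProduct) = Set.range Ψ := rfl
  have key : ∀ f : β.SectionAlgebra,
      CStarSeminorm.mkHom (CStarSeminorm.sup β.covariantSeminorms) f ∈ V.topologicalClosure := by
    intro f
    induction f using SectionAlgebra.induction with
    | zero => rw [map_zero]; exact zero_mem _
    | add f g hf hg => rw [map_add]; exact add_mem hf hg
    | of s b =>
      rw [← SetLike.mem_coe, Submodule.topologicalClosure_coe, Metric.mem_closure_iff]
      intro ε hε
      obtain ⟨f, hf, hfb⟩ := exists_fibreSum_near s.1.isOpen' s.1.isGSet'
        (hβ.mem_ran_iff.mp b.2) (half_pos hε)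
      refine ⟨Ψ f, ⟨f, rfl⟩, ?_⟩
      rw [dist_comm, dist_eq_norm, hΨ s f hf, ← map_sub]
      have : SectionAlgebra.of β ⟨fibreSum f, hβ.fibreSum_mem hf⟩ - SectionAlgebra.of β b =
          SectionAlgebra.of β (⟨fibreSum f, hβ.fibreSum_mem hf⟩ - b) :=
        (map_sub (SectionAlgebra.ofHom β s) _ _).symm
      rw [this]
      exact ((norm_mkHom_of_le _).trans hfb).trans_lt (half_lt_self hε)
  intro x
  have h1 := CStarSeminorm.denseRange_mkHom (CStarSeminorm.sup β.covariantSeminorms) x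
  rw [← hV, ← Submodule.topologicalClosure_coe]
  refine closure_minimal ?_ V.isClosed_topologicalClosure h1
  rintro _ ⟨f, rfl⟩
  exact key f

end CrossedProduct

/-! ### From representations of the convolution algebra to covariant representations -/

/-- Every nonzero value of a is a value of b. An approximation of b over r(s) thus controls the
corresponding approximation of a over d(s). -/
theorem Transports.norm_le {G : Type u} [TopologicalSpace G] [ArrowGroupoid G] {s : Set G}
    {a b : C₀(unitSpace G, ℂ)} (h : Transports s a b) : ‖a‖ ≤ ‖b‖ := by
  refine ZeroAtInftyContinuousMap.norm_le_of_forall (norm_nonneg _) fun u => ?_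
  by_cases hu : u ∈ domU '' s
  · obtain ⟨x, hx, rfl⟩ := hu
    rw [← h.2.2 x hx]
    exact ZeroAtInftyContinuousMap.norm_apply_le _ _
  · rw [h.1 u hu, norm_zero]; exact norm_nonneg _

namespace ConvolutionAlgebra

open Filter Topology

variable {G : Type u} [TopologicalSpace G] [ArrowGroupoid G] [hG : IsRDiscrete G]

/-- The functions supported by `s`, bounded by `1`, which are equal to `1` on `K`. -/
def bumpSet (s K : Set G) : Set (ConvolutionAlgebra G) :=
  {f | tsupport f ⊆ s ∧ (∀ x, ‖f x‖ ≤ 1) ∧ ∀ x ∈ K, f x = 1}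

theorem bumpSet_nonempty {s K : Set G} (hs : IsOpen s) (hK : IsCompact K) (hKs : K ⊆ s) :
    (bumpSet s K).Nonempty := by
  obtain ⟨χ, h1, h2, h3, h4⟩ := exists_cutoff hs hK hKs
  refine ⟨mk (fun x => (χ x : ℂ)) (Complex.continuous_ofReal.comp χ.continuous)
    (h2.comp_left Complex.ofReal_zero), ?_, fun x => ?_, fun x hx => ?_⟩
  · refine (closure_mono fun x hx => ?_).trans h1
    exact fun h => hx (show (χ x : ℂ) = 0 by rw [h, Complex.ofReal_zero])
  · rw [mk_apply, Complex.norm_real, Real.norm_of_nonneg (h3 x).1]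
    exact (h3 x).2
  · rw [mk_apply, h4 x hx, Complex.ofReal_one]

/-- The filter of the bump functions on an open `G`-set `s`, which tend to `1` on `s`. -/
def bumps (s : OpenGSet G) : Filter (ConvolutionAlgebra G) where
  sets := {A | ∃ K, IsCompact K ∧ K ⊆ s.carrier ∧ bumpSet s.carrier K ⊆ A}
  univ_sets := ⟨∅, isCompact_empty, Set.empty_subset _, Set.subset_univ _⟩
  sets_of_superset := fun ⟨K, h1, h2, h3⟩ h => ⟨K, h1, h2, h3.trans h⟩
  inter_sets := fun ⟨K, h1, h2, h3⟩ ⟨K', h1', h2', h3'⟩ =>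
    ⟨K ∪ K', h1.union h1', Set.union_subset h2 h2', fun _ hf =>
      ⟨h3 ⟨hf.1, hf.2.1, fun x hx => hf.2.2 x (Or.inl hx)⟩,
        h3' ⟨hf.1, hf.2.1, fun x hx => hf.2.2 x (Or.inr hx)⟩⟩⟩

omit hG in
theorem mem_bumps {s : OpenGSet G} {K : Set G} (hK : IsCompact K) (hKs : K ⊆ s.carrier) :
    bumpSet s.carrier K ∈ bumps s := ⟨K, hK, hKs, subset_rfl⟩

omit hG in
theorem eventually_tsupport_subset (s : OpenGSet G) :
    ∀ᶠ f : ConvolutionAlgebra G in bumps s, tsupport f ⊆ s.carrier :=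
  mem_of_superset (mem_bumps isCompact_empty (Set.empty_subset _)) fun _ hf => hf.1

instance (s : OpenGSet G) : (bumps s).NeBot :=
  ⟨fun h => by
    obtain ⟨K, hK, hKs, hsub⟩ := empty_mem_iff_bot.mpr h
    obtain ⟨f, hf⟩ := bumpSet_nonempty s.isOpen' hK hKs
    exact hsub hf⟩

theorem tendsto_star_bumps (s : OpenGSet G) : Tendsto star (bumps s) (bumps (star s)) := by
  rintro A ⟨K, hK, hKs, hA⟩
  rw [mem_map]
  refine mem_of_superset (mem_bumps (hK.image hG.continuous_inv) ?_) fun f hf => hA ?_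
  · rintro _ ⟨x, hx, rfl⟩
    exact hKs hx
  · refine ⟨tsupport_star_subset hf.1, fun x => ?_, fun x hx => ?_⟩
    · rw [star_apply, norm_star]; exact hf.2.1 _
    · rw [star_apply, hf.2.2 _ ⟨x, hx, rfl⟩, star_one]

/-- A product of bump functions on s and t is a bump function on st. To be 1 at xy in K it suffices
that the first factor is 1 on the arrows of s with range in r(K) and the second on the arrows of t
with domain in d(K); both sets are compact. -/
theorem tendsto_mul_bumps (s t : OpenGSet G) :
    Tendsto (fun p : ConvolutionAlgebra G × ConvolutionAlgebra G => p.1 * p.2)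
      (bumps s ×ˢ bumps t) (bumps (s * t)) := by
  rintro A ⟨K, hK, hKs, hA⟩
  have h1 : IsCompact (s.carrier ∩ rngU ⁻¹' (rngU '' K)) :=
    isCompact_inter_rngU s.isOpen' s.isGSet'.1 (hK.image continuous_rngU) (by
      rintro _ ⟨z, hz, rfl⟩
      obtain ⟨x, hx, y, hy, h, rfl⟩ := hKs hz
      exact ⟨x, hx, (rngU_comp x y h).symm⟩)
  have h2 : IsCompact (t.carrier ∩ domU ⁻¹' (domU '' K)) :=
    isCompact_inter_domU t.isOpen' t.isGSet'.2 (hK.image continuous_domU) (by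
      rintro _ ⟨z, hz, rfl⟩
      obtain ⟨x, hx, y, hy, h, rfl⟩ := hKs hz
      exact ⟨y, hy, (domU_comp x y h).symm⟩)
  rw [mem_map]
  refine mem_of_superset (prod_mem_prod (mem_bumps h1 Set.inter_subset_left)
    (mem_bumps h2 Set.inter_subset_left)) ?_
  rintro ⟨f, g⟩ ⟨hf, hg⟩
  refine hA ⟨tsupport_mul_subset hf.1 hg.1, fun z => ?_, fun z hz => ?_⟩
  · by_cases hz : (f * g) z = 0
    · rw [hz, norm_zero]; exact zero_le_one
    · obtain ⟨x, y, h, hx, -, rfl⟩ := exists_of_mul_apply_ne_zero hz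
      rw [mul_apply_of_left f g h
        (eq_of_rng_eq s.isGSet' hf.1 (hf.1 (subset_tsupport _ hx))), norm_mul]
      exact mul_le_one₀ (hf.2.1 x) (norm_nonneg _) (hg.2.1 y)
  · obtain ⟨x, hx, y, hy, h, rfl⟩ := hKs hz
    show (f * g) _ = 1
    rw [mul_apply_of_left f g h (eq_of_rng_eq s.isGSet' hf.1 hx),
      hf.2.2 x ⟨hx, _, hz, rngU_comp x y h⟩, hg.2.2 y ⟨hy, _, hz, domU_comp x y h⟩, one_mul]

/-! ### Strong limits along bump functions -/

section Limit

variable {H : Type u} [NormedAddCommGroup H] [InnerProductSpace ℂ H] [CompleteSpace H]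
  (ρ : ConvolutionAlgebra G →⋆ₙₐ[ℂ] (H →L[ℂ] H))

theorem eventually_norm_le_one (s : OpenGSet G) : ∀ᶠ f in bumps s, ∀ v, ‖ρ f v‖ ≤ ‖v‖ :=
  mem_of_superset (mem_bumps isCompact_empty (Set.empty_subset _)) fun f hf v => by
    have h1 := norm_map_le ρ s.isGSet' hf.1 zero_le_one hf.2.1
    exact ((ρ f).le_opNorm v).trans (mul_le_of_le_one_left (norm_nonneg v) h1)

theorem inner_map_left (f : ConvolutionAlgebra G) (v w : H) :
    inner ℂ (ρ f v) w = inner ℂ v (ρ (star f) w) := by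
  rw [map_star, ContinuousLinearMap.star_eq_adjoint, ContinuousLinearMap.adjoint_inner_right]

theorem map_mul_apply (f g : ConvolutionAlgebra G) (v : H) : ρ (f * g) v = ρ f (ρ g v) := by
  rw [map_mul]; rfl

/-- The vectors at which the representation converges along the bump functions on `s`. -/
def convergent (s : OpenGSet G) : Submodule ℂ H where
  carrier := {v | ∃ y, Tendsto (fun f => ρ f v) (bumps s) (𝓝 y)}
  add_mem' := by
    rintro v w ⟨y, hy⟩ ⟨z, hz⟩
    exact ⟨y + z, (hy.add hz).congr fun f => (map_add _ v w).symm⟩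
  zero_mem' := ⟨0, tendsto_const_nhds.congr fun f => (map_zero (ρ f)).symm⟩
  smul_mem' := by
    rintro k v ⟨y, hy⟩
    exact ⟨k • y, (hy.const_smul k).congr fun f => (map_smul _ k v).symm⟩

/-- Along the bump functions the operators are contractions, so an ε/3 argument shows that ρ(f)v is
Cauchy when v is a limit of vectors of convergence. -/
theorem isClosed_convergent (s : OpenGSet G) : IsClosed (convergent ρ s : Set H) := by
  refine isClosed_of_closure_subset fun v hv => ?_
  refine cauchy_map_iff_exists_tendsto.mp (Metric.cauchy_iff.mpr ⟨inferInstance, fun ε hε => ?_⟩)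
  obtain ⟨w, ⟨y, hy⟩, hvw⟩ := Metric.mem_closure_iff.mp hv (ε / 3) (by positivity)
  obtain ⟨t, ht, htd⟩ := (Metric.cauchy_iff.mp hy.cauchy_map).2 (ε / 3) (by positivity)
  refine ⟨(fun f => ρ f v) '' ({f | ρ f w ∈ t} ∩ {f | ∀ v, ‖ρ f v‖ ≤ ‖v‖}),
    image_mem_map (inter_mem ht (eventually_norm_le_one ρ s)), ?_⟩
  rintro _ ⟨f, ⟨hft, hf⟩, rfl⟩ _ ⟨g, ⟨hgt, hg⟩, rfl⟩
  have h1 : dist (ρ f v) (ρ f w) ≤ dist v w := by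
    rw [dist_eq_norm, dist_eq_norm, ← map_sub]; exact hf _
  have h2 : dist (ρ g w) (ρ g v) ≤ dist v w := by
    rw [dist_comm, dist_eq_norm, dist_eq_norm, ← map_sub]; exact hg _
  have h3 := htd _ hft _ hgt
  calc dist (ρ f v) (ρ g v) ≤ dist (ρ f v) (ρ f w) + dist (ρ f w) (ρ g w) + dist (ρ g w) (ρ g v) :=
        dist_triangle4 _ _ _ _
    _ < ε := by linarith

/-- The product f * k no longer changes once f equals 1 on the arrows of s whose domain lies in the
support of k, a compact set. So ρ(f)ρ(k)v is eventually constant. -/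
theorem map_unit_mem_convergent (s : OpenGSet G) {k : ConvolutionAlgebra G}
    (hk : tsupport k ⊆ unitSpace G) (hks : tsupport k ⊆ dom '' s.carrier) (v : H) :
    ρ k v ∈ convergent ρ s := by
  have hK : IsCompact (s.carrier ∩ domU ⁻¹' (domU '' tsupport k)) :=
    isCompact_inter_domU s.isOpen' s.isGSet'.2
      (k.hasCompactSupport.isCompact.image continuous_domU) (by
        rintro _ ⟨x, hx, rfl⟩
        obtain ⟨y, hy, rfl⟩ := hks hx
        exact ⟨y, hy, (domU_coe (domU y)).symm⟩)
  obtain ⟨f₀, hf₀⟩ := bumpSet_nonempty s.isOpen' hK Set.inter_subset_left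
  refine ⟨ρ (f₀ * k) v, tendsto_const_nhds.congr' ?_⟩
  filter_upwards [mem_bumps hK Set.inter_subset_left] with f hf
  rw [← map_mul_apply]
  congr 2
  refine ext' fun z => ?_
  rw [mul_unit_apply hk, mul_unit_apply hk]
  by_cases hz : z ∈ s.carrier
  · by_cases hzk : dom z ∈ tsupport k
    · have hzK : z ∈ s.carrier ∩ domU ⁻¹' (domU '' tsupport k) :=
        ⟨hz, dom z, hzk, domU_coe (domU z)⟩
      rw [hf.2.2 z hzK, hf₀.2.2 z hzK]
    · rw [image_eq_zero_of_notMem_tsupport hzk, mul_zero, mul_zero]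
  · rw [apply_eq_zero hf.1 hz, apply_eq_zero hf₀.1 hz]

/-- Let v be orthogonal to this closed subspace. For f supported in s, f*f is a function on units
supported in d(s), so ‖ρ(f)v‖² = ⟨v, ρ(f*f)v⟩ = 0. Then ρ(f)v tends to 0, so v itself belongs to the
subspace and must be zero. -/
theorem convergent_eq_top (s : OpenGSet G) : convergent ρ s = ⊤ := by
  have : CompleteSpace (convergent ρ s) := (isClosed_convergent ρ s).completeSpace_coe
  rw [← Submodule.orthogonal_eq_bot_iff, Submodule.eq_bot_iff]
  intro v hv
  have h0 : ∀ f : ConvolutionAlgebra G, tsupport f ⊆ s.carrier → ρ f v = 0 := by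
    intro f hf
    have hsub := tsupport_mul_subset (tsupport_star_subset hf) hf
    have hdom : setComp {x | inv x ∈ s.carrier} s.carrier = dom '' s.carrier :=
      InverseSubsemigroup.d_carrier s
    rw [← inner_self_eq_zero (𝕜 := ℂ), inner_map_left, ← map_mul_apply]
    refine (Submodule.mem_orthogonal' _ _).mp hv _ (map_unit_mem_convergent ρ s
      (hsub.trans (setComp_inv_subset_units s.isGSet')) (hsub.trans hdom.subset) v)
  have hmem : v ∈ convergent ρ s := by
    refine ⟨0, tendsto_const_nhds.congr' ?_⟩
    filter_upwards [eventually_tsupport_subset s] with f hf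
    exact (h0 f hf).symm
  exact inner_self_eq_zero.mp ((Submodule.mem_orthogonal _ _).mp hv v hmem)

theorem exists_tendsto (s : OpenGSet G) (v : H) :
    ∃ y, Tendsto (fun f => ρ f v) (bumps s) (𝓝 y) := by
  have : v ∈ convergent ρ s := by rw [convergent_eq_top]; trivial
  exact this

/-- The limit of a representation along the bump functions on `s`. -/
noncomputable def limOp (s : OpenGSet G) : H →L[ℂ] H :=
  LinearMap.mkContinuous
    { toFun := fun v => (exists_tendsto ρ s v).choose
      map_add' := fun v w => tendsto_nhds_unique (exists_tendsto ρ s (v + w)).choose_spec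
        (((exists_tendsto ρ s v).choose_spec.add (exists_tendsto ρ s w).choose_spec).congr
          fun f => (map_add _ v w).symm)
      map_smul' := fun k v => tendsto_nhds_unique (exists_tendsto ρ s (k • v)).choose_spec
        (((exists_tendsto ρ s v).choose_spec.const_smul k).congr
          fun f => (map_smul _ k v).symm) } 1 fun v => by
    rw [one_mul]
    exact le_of_tendsto (exists_tendsto ρ s v).choose_spec.norm
      ((eventually_norm_le_one ρ s).mono fun f hf => hf v)

theorem norm_limOp_le (s : OpenGSet G) : ‖limOp ρ s‖ ≤ 1 :=
  LinearMap.mkContinuous_norm_le _ zero_le_one _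

theorem tendsto_limOp (s : OpenGSet G) (v : H) :
    Tendsto (fun f => ρ f v) (bumps s) (𝓝 (limOp ρ s v)) := (exists_tendsto ρ s v).choose_spec

theorem limOp_star (s : OpenGSet G) : limOp ρ (star s) = star (limOp ρ s) := by
  rw [ContinuousLinearMap.star_eq_adjoint, ContinuousLinearMap.eq_adjoint_iff]
  intro v w
  have h1 : Tendsto (fun f => inner ℂ (ρ (star f) v) w) (bumps s)
      (𝓝 (inner ℂ (limOp ρ (star s) v) w)) :=
    ((tendsto_limOp ρ (star s) v).comp (tendsto_star_bumps s)).inner tendsto_const_nhds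
  have h2 : Tendsto (fun f => inner ℂ v (ρ f w)) (bumps s) (𝓝 (inner ℂ v (limOp ρ s w))) :=
    tendsto_const_nhds.inner (tendsto_limOp ρ s w)
  exact tendsto_nhds_unique h1 (h2.congr fun f => by rw [inner_map_left, star_star])

/-- Moving the first factor to the other side, ⟨ρ(f)ρ(g)v, w⟩ = ⟨ρ(g)v, ρ(f*)w⟩, makes both entries
converge in norm, so the double limit can be taken. -/
theorem limOp_mul (s t : OpenGSet G) : limOp ρ (s * t) = limOp ρ s * limOp ρ t := by
  ext v
  refine ext_inner_right ℂ fun w => ?_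
  have h1 : Tendsto (fun p : ConvolutionAlgebra G × ConvolutionAlgebra G =>
      inner ℂ (ρ (p.1 * p.2) v) w) (bumps s ×ˢ bumps t) (𝓝 (inner ℂ (limOp ρ (s * t) v) w)) :=
    ((tendsto_limOp ρ (s * t) v).comp (tendsto_mul_bumps s t)).inner tendsto_const_nhds
  have h2 : Tendsto (fun p : ConvolutionAlgebra G × ConvolutionAlgebra G =>
      inner ℂ (ρ p.2 v) (ρ (star p.1) w)) (bumps s ×ˢ bumps t)
      (𝓝 (inner ℂ (limOp ρ t v) (limOp ρ (star s) w))) :=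
    ((tendsto_limOp ρ t v).comp tendsto_snd).inner
      (((tendsto_limOp ρ (star s) w).comp (tendsto_star_bumps s)).comp tendsto_fst)
  rw [tendsto_nhds_unique h1 (h2.congr fun p => by rw [map_mul_apply, inner_map_left ρ p.1]),
    limOp_star, ContinuousLinearMap.star_eq_adjoint, ContinuousLinearMap.adjoint_inner_right]
  rfl

theorem map_mul_limOp {s : OpenGSet G} {g k : ConvolutionAlgebra G}
    (h : ∀ᶠ f in bumps s, g * f = k) : ρ g * limOp ρ s = ρ k := by
  ext v
  have h1 : Tendsto (fun f => ρ g (ρ f v)) (bumps s) (𝓝 (ρ g (limOp ρ s v))) :=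
    ((ρ g).continuous.tendsto _).comp (tendsto_limOp ρ s v)
  refine tendsto_nhds_unique h1 (tendsto_const_nhds.congr' ?_)
  filter_upwards [h] with f hf
  rw [← map_mul_apply, hf]

theorem norm_map_le_restrictUnits (F : unitFunctions G) : ‖ρ F.1‖ ≤ ‖restrictUnits F‖ := by
  refine norm_map_le ρ isGSet_unitSpace F.2 (norm_nonneg _) fun x => ?_
  by_cases hx : x ∈ unitSpace G
  · have := fibreSum_unit F.2 ⟨x, hx⟩
    rw [← this]
    exact ZeroAtInftyContinuousMap.norm_apply_le (restrictUnits F) _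
  · rw [apply_eq_zero F.2 hx, norm_zero]; exact norm_nonneg _

/-- The representation of `C₀(G⁰)` given by a representation of the convolution algebra. -/
theorem exists_map_units : ∃ π : C₀(unitSpace G, ℂ) →⋆ₙₐ[ℂ] (H →L[ℂ] H),
    ∀ F : ConvolutionAlgebra G, tsupport F ⊆ unitSpace G → π (fibreSum F) = ρ F := by
  have h := exists_extension (restrictUnits (G := G)) denseRange_restrictUnits
    (ρ.comp (NonUnitalStarSubalgebraClass.subtype (unitFunctions G)))
  have h' : ∃ π : C₀(unitSpace G, ℂ) →⋆ₙₐ[ℂ] (H →L[ℂ] H),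
    ∀ F : unitFunctions G, π (restrictUnits F) = ρ F.1 := h (norm_map_le_restrictUnits ρ)
  obtain ⟨π, hπ⟩ := h'
  refine ⟨π, fun F hF => ?_⟩
  exact hπ ⟨F, hF⟩

variable {π : C₀(unitSpace G, ℂ) →⋆ₙₐ[ℂ] (H →L[ℂ] H)}
  (hπ : ∀ F : ConvolutionAlgebra G, tsupport F ⊆ unitSpace G → π (fibreSum F) = ρ F)
include hπ

/-- With χ in C_c(s) equal to 1 on the support of f, the product F = f * χ* is supported by units
and carries the values of f at their ranges, so F restricts to `fibreSum f`. For every bump function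
h on s equal to 1 on the support of f one has F * h = f; the limit over h gives the identity. -/
theorem map_fibreSum_mul_limOp {s : OpenGSet G} {f : ConvolutionAlgebra G}
    (hf : tsupport f ⊆ s.carrier) : π (fibreSum f) * limOp ρ s = ρ f := by
  obtain ⟨χ, hχ⟩ := bumpSet_nonempty s.isOpen' f.hasCompactSupport.isCompact hf
  have hsχ : tsupport (star χ : ConvolutionAlgebra G) ⊆ {x | inv x ∈ s.carrier} :=
    tsupport_star_subset hχ.1
  have hsub : tsupport (f * star χ : ConvolutionAlgebra G) ⊆ rng '' s.carrier :=
    (tsupport_mul_subset hf hsχ).trans s.isGSet'.setComp_inv.subset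
  have hu : tsupport (f * star χ : ConvolutionAlgebra G) ⊆ unitSpace G :=
    hsub.trans (rng_image_subset _)
  have hval : ∀ x ∈ s.carrier, (f * star χ) (rng x) = f x := by
    intro x hx
    rw [← comp_inv x, mul_apply_of_left f _ _ (eq_of_rng_eq s.isGSet' hf hx), star_apply,
      inv_inv_arrow]
    by_cases hxf : x ∈ tsupport f
    · rw [hχ.2.2 x hxf, star_one, mul_one]
    · rw [image_eq_zero_of_notMem_tsupport hxf, zero_mul]
  have hfs : fibreSum f = fibreSum (f * star χ) := by
    ext u
    rw [fibreSum_unit hu]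
    by_cases hus : u ∈ rngU '' s.carrier
    · obtain ⟨x, hx, rfl⟩ := hus
      rw [fibreSum_of_mem s.isGSet' hf hx]
      exact (hval x hx).symm
    · rw [fibreSum_of_notMem hf hus]
      refine (apply_eq_zero hsub ?_).symm
      rintro ⟨x, hx, e⟩
      exact hus ⟨x, hx, Subtype.ext e⟩
  rw [hfs, hπ _ hu]
  refine map_mul_limOp ρ ?_
  filter_upwards [mem_bumps f.hasCompactSupport.isCompact hf] with h hh
  refine ext' fun z => ?_
  rw [unit_mul_apply hu]
  by_cases hz : z ∈ s.carrier
  · rw [hval z hz]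
    by_cases hzf : z ∈ tsupport f
    · rw [hh.2.2 z hzf, mul_one]
    · rw [image_eq_zero_of_notMem_tsupport hzf, zero_mul]
  · rw [apply_eq_zero hh.1 hz, apply_eq_zero hf hz, mul_zero]

/-- This is the adjoint of `map_fibreSum_mul_limOp` for f* on s*: the function a over d(s) is the
conjugate of the one that f* defines. -/
theorem limOp_mul_map {s : OpenGSet G} {f : ConvolutionAlgebra G} (hf : tsupport f ⊆ s.carrier)
    {a : C₀(unitSpace G, ℂ)} (ha : Transports s.carrier a (fibreSum f)) :
    limOp ρ s * π a = ρ f := by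
  have hsf : tsupport (star f : ConvolutionAlgebra G) ⊆ (star s).carrier := tsupport_star_subset hf
  have h1 := congrArg star (map_fibreSum_mul_limOp ρ hπ hsf)
  have h2 := (transports_star hf).symm.star
  rw [inv_inv_carrier, star_star] at h2
  rw [star_mul, limOp_star, star_star, ← map_star π, ← map_star ρ, star_star] at h1
  rwa [ha.left_unique h2]

theorem map_mul_limOp_idem {e : OpenGSet G} (he : e.carrier ⊆ unitSpace G)
    {b : C₀(unitSpace G, ℂ)} (hb : ∀ u, u ∉ rngU '' e.carrier → b u = 0) :
    π b * limOp ρ e = π b := by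
  refine eq_of_forall_dist_le fun ε hε => ?_
  obtain ⟨f, hf, hfb⟩ := exists_fibreSum_near e.isOpen' e.isGSet' hb (half_pos hε)
  have h1 : π (fibreSum f) * limOp ρ e = π (fibreSum f) := by
    rw [map_fibreSum_mul_limOp ρ hπ hf, hπ f (hf.trans he)]
  have h2 : ‖π (fibreSum f) - π b‖ ≤ ε / 2 := by
    rw [← map_sub]; exact (NonUnitalStarAlgHom.norm_apply_le π _).trans hfb
  -- For f supported in e, the operator π(f) = ρ(f) absorbs the limit at e, so the defect of b
  -- involves only the approximation error.
  have h3 : π b * limOp ρ e - π b =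
      (π (fibreSum f) - π b) - (π (fibreSum f) - π b) * limOp ρ e := by
    rw [sub_mul, h1]; abel
  rw [dist_eq_norm, h3]
  have h4 : ‖(π (fibreSum f) - π b) * limOp ρ e‖ ≤ ε / 2 * 1 :=
    (norm_mul_le _ _).trans
      (mul_le_mul h2 (norm_limOp_le ρ e) (norm_nonneg _) (half_pos hε).le)
  refine (norm_sub_le_of_le h2 h4).trans ?_
  linarith

/-- When b comes from f in C_c(s), one has U_sπ(a)U_s* = ρ(f)U_s* = π(b)U_sU_s* = π(b)U_{ss*} =
π(b). The general case follows by approximating b. -/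
theorem limOp_covariant (s : OpenGSet G) {a b : C₀(unitSpace G, ℂ)}
    (h : Transports s.carrier a b) : limOp ρ s * π a * star (limOp ρ s) = π b := by
  refine eq_of_forall_dist_le fun ε hε => ?_
  obtain ⟨f, hf, hfb⟩ := exists_fibreSum_near s.isOpen' s.isGSet' h.2.1 (half_pos hε)
  obtain ⟨a', ha'⟩ := exists_transports' s (b := fibreSum f) fun u hu => fibreSum_of_notMem hf hu
  have h1 : limOp ρ s * π a' * star (limOp ρ s) = π (fibreSum f) := by
    rw [limOp_mul_map ρ hπ hf ha', ← map_fibreSum_mul_limOp ρ hπ hf, mul_assoc, ← limOp_star,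
      ← limOp_mul]
    have hr : (s * star s).carrier = rng '' s.carrier := s.isGSet'.setComp_inv
    refine map_mul_limOp_idem ρ hπ (hr.subset.trans (rng_image_subset _)) fun u hu => ?_
    refine fibreSum_of_notMem hf ?_
    rintro ⟨x, hx, rfl⟩
    exact hu ⟨rng x, by rw [hr]; exact ⟨x, hx, rfl⟩, rngU_coe (rngU x)⟩
  have h2 : ‖π (fibreSum f) - π b‖ ≤ ε / 2 := by
    rw [← map_sub]; exact (NonUnitalStarAlgHom.norm_apply_le π _).trans hfb
  -- Transport is linear and does not increase norms backwards, so a' is as close to a as `fibreSum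
  -- f` is to b.
  have hab : Transports s.carrier (a' - a) (fibreSum f - b) := by
    have := ha'.add (h.smul (-1 : ℂ))
    have e : ∀ x y : C₀(unitSpace G, ℂ), x + (-1 : ℂ) • y = x - y := fun x y => by
      ext u
      rw [ZeroAtInftyContinuousMap.add_apply, ZeroAtInftyContinuousMap.smul_apply,
        ZeroAtInftyContinuousMap.sub_apply, neg_one_smul, sub_eq_add_neg]
    rwa [e, e] at this
  have h3 : ‖π a' - π a‖ ≤ ε / 2 := by
    rw [← map_sub]
    exact (NonUnitalStarAlgHom.norm_apply_le π _).trans (hab.norm_le.trans hfb)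
  have h4 : limOp ρ s * π a * star (limOp ρ s) - π b = (π (fibreSum f) - π b) -
      limOp ρ s * (π a' - π a) * star (limOp ρ s) := by
    rw [mul_sub, sub_mul, h1]; abel
  have h5 : ‖limOp ρ s * (π a' - π a) * star (limOp ρ s)‖ ≤ 1 * (ε / 2) * 1 := by
    refine (norm_mul_le _ _).trans (mul_le_mul ((norm_mul_le _ _).trans
      (mul_le_mul (norm_limOp_le ρ s) h3 (norm_nonneg _) zero_le_one)) ?_ (norm_nonneg _)
      (by positivity))
    rw [norm_star]; exact norm_limOp_le ρ s
  rw [dist_eq_norm, h4]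
  refine (norm_sub_le_of_le h2 h5).trans ?_
  linarith

end Limit

end ConvolutionAlgebra

/-! ### Disintegration of nondegenerate representations -/

section Disintegration

open ConvolutionAlgebra InverseSemigroupAction Filter Topology

variable {G : Type u} [TopologicalSpace G] [ArrowGroupoid G] [hG : IsRDiscrete G]
  {S : InverseSubsemigroup (OpenGSet G)} {β : InverseSemigroupAction S C₀(unitSpace G, ℂ)}

/-- Every nondegenerate representation of the convolution algebra comes from a covariant
representation. -/
theorem IsCanonicalAction.exists_covariantRep (hβ : IsCanonicalAction β) (hS : S.IsBase)
    {H : Type u} [NormedAddCommGroup H] [InnerProductSpace ℂ H] [CompleteSpace H]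
    (ρ : ConvolutionAlgebra G →⋆ₙₐ[ℂ] (H →L[ℂ] H))
    (hρ : Dense (Submodule.span ℂ {ξ : H | ∃ f η, ξ = ρ f η} : Set H)) :
    ∃ R : β.CovariantRep H, ∀ (s : S) (f : ConvolutionAlgebra G) (h : tsupport f ⊆ s.1.carrier),
      R.integratedForm (SectionAlgebra.of β ⟨fibreSum f, hβ.fibreSum_mem h⟩) = ρ f := by
  obtain ⟨π, hπ⟩ := exists_map_units ρ
  have hA : ∀ (s : S) (f : ConvolutionAlgebra G), tsupport f ⊆ s.1.carrier →
    π (fibreSum f) * limOp ρ s.1 = ρ f := fun s f hf => map_fibreSum_mul_limOp ρ hπ hf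
  -- Every vector ρ(f)η is a sum of such vectors with f supported in elements of S. This serves both
  -- density conditions, through ρ(f) = π(f)U_s and ρ(f) = U_sπ(a).
  have hdense : ∀ W : Submodule ℂ H,
      (∀ (s : S) (f : ConvolutionAlgebra G), tsupport f ⊆ s.1.carrier → ∀ η, ρ f η ∈ W) →
      Dense (W : Set H) := by
    intro W hW
    refine hρ.mono (Submodule.span_le.mpr ?_)
    rintro _ ⟨f, η, rfl⟩
    induction f using hS.induction with
    | zero => rw [map_zero]; exact zero_mem _
    | add f g hf hg => rw [map_add]; exact add_mem hf hg
    | of s f hf => exact hW s f hf η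
  -- This is the adjoint of `map_mul_limOp_idem`; e* = e because units are their own inverses.
  have hidem : ∀ e : S, e * e = e → ∀ b ∈ (β e).Dom, limOp ρ e.1 * π b = π b := by
    intro e he b hb
    have heu := idem_subset_units (congrArg Subtype.val he)
    have hb' : ∀ u, u ∉ rngU '' e.1.carrier → star b u = 0 := by
      intro u hu
      rw [ZeroAtInftyContinuousMap.star_apply, hβ.mem_dom_iff.mp hb u, star_zero]
      rintro ⟨x, hx, rfl⟩
      refine hu ⟨x, hx, Subtype.ext ?_⟩
      show rng x = dom x
      rw [dom_eq_of_mem (heu hx)]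
      exact heu hx
    have h1 := congrArg star (map_mul_limOp_idem ρ hπ heu hb')
    rw [star_mul, ← map_star, star_star, ← limOp_star] at h1
    have h2 : star e.1 = e.1 := by
      refine OpenGSet.ext' (Set.ext fun x => ⟨fun hx => ?_, fun hx => ?_⟩)
      · have hx' : inv x ∈ e.1.carrier := hx
        rwa [← inv_inv_arrow x, inv_eq_of_mem (heu hx')]
      · show inv x ∈ e.1.carrier
        rwa [inv_eq_of_mem (heu hx)]
    rwa [h2] at h1
  refine ⟨{ π := π
            nondegenerate := hdense _ fun s f hf η =>
              Submodule.subset_span ⟨fibreSum f, limOp ρ s.1 η, by rw [← hA s f hf]; rfl⟩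
            U := fun s => limOp ρ s.1
            U_mul := fun s t => limOp_mul ρ s.1 t.1
            U_star := fun s => limOp_star ρ s.1
            U_dense := hdense _ fun s f hf η => ?_
            range_idem := fun e he => ?_
            covariant := fun s b =>
              limOp_covariant ρ hπ s.1 (hβ.maps_iff.mp ((β s).maps_equiv b)) }, fun s f h => ?_⟩
  · obtain ⟨a, ha⟩ := exists_transports' s.1 (b := fibreSum f) fun u hu => fibreSum_of_notMem hf hu
    exact Submodule.subset_span ⟨s, π a η, by rw [← limOp_mul_map ρ hπ hf ha]; rfl⟩
  · have heu := idem_subset_units (congrArg Subtype.val he)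
    refine Set.Subset.antisymm ?_ fun v hv => ⟨v, ?_⟩
    · rintro _ ⟨v, rfl⟩
      -- U_e v is the limit of ρ(f)v with f supported in e, and there ρ(f) = π(f) with f in B_e.
      refine mem_closure_of_tendsto (tendsto_limOp ρ e.1 v) ?_
      filter_upwards [eventually_tsupport_subset e.1] with f hf
      refine Submodule.subset_span ⟨fibreSum f, hβ.mem_dom_iff.mpr fun u hu => ?_, v,
        by rw [hπ f (hf.trans heu)]⟩
      rw [fibreSum_unit (hf.trans heu)]
      exact apply_eq_zero hf fun h => hu ⟨u, h, domU_coe u⟩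
    -- Conversely, U_e fixes every π(b)η with b in B_e, hence the closed span of these vectors.
    · have hcl : IsClosed {v : H | limOp ρ e.1 v = v} :=
        isClosed_eq (limOp ρ e.1).continuous continuous_id
      refine closure_minimal ?_ hcl hv
      intro w hw
      show limOp ρ e.1 w = w
      induction hw using Submodule.span_induction with
      | mem x hx =>
        obtain ⟨b, hb, η, rfl⟩ := hx
        exact DFunLike.congr_fun (hidem e he b hb) η
      | zero => rw [map_zero]
      | add x y _ _ hx hy => rw [map_add, hx, hy]
      | smul k x _ hx => rw [map_smul, hx]
  · rw [CovariantRep.integratedForm_of]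
    exact hA s f h

end Disintegration

/-! ### The isomorphism of the groupoid C*-algebra with the crossed product -/

section Isomorphism

open ConvolutionAlgebra InverseSemigroupAction

variable {G : Type u} [TopologicalSpace G] [ArrowGroupoid G] [hG : IsRDiscrete G]
  {S : InverseSubsemigroup (OpenGSet G)} {β : InverseSemigroupAction S C₀(unitSpace G, ℂ)}

/-- The two families of representations give the same norms. A covariant representation extends to
the crossed product and pulls back along `Ψ` to a representation of C_c(G), continuous
automatically. A representation of C_c(G) is dominated by a nondegenerate one, which comes from a
covariant representation. -/
theorem IsCanonicalAction.norm_toCrossedProduct (hβ : IsCanonicalAction β) (hS : S.IsBase)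
    {Ψ : ConvolutionAlgebra G →⋆ₙₐ[ℂ] β.CrossedProduct} (hΨ : ∀ (s : S)
      (f : ConvolutionAlgebra G) (h : tsupport f ⊆ s.1.carrier), Ψ f =
        CStarSeminorm.mkHom _ (SectionAlgebra.of β ⟨fibreSum f, hβ.fibreSum_mem h⟩))
    (f : ConvolutionAlgebra G) : ‖Ψ f‖ = CStarSeminorm.sup (continuousSeminorms G) f := by
  obtain ⟨n, s, g, hg, hf⟩ := hS.exists_sum_eq f
  -- A formal sum representing Ψ(f), on which both families of seminorms can be compared.
  set x : β.SectionAlgebra :=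
    ∑ i, SectionAlgebra.of β ⟨fibreSum (g i), hβ.fibreSum_mem (hg i)⟩ with hx
  have hx' : Ψ f = CStarSeminorm.mkHom _ x := by
    rw [← hf, hx, map_sum, map_sum]
    exact Finset.sum_congr rfl fun i _ => hΨ (s i) (g i) (hg i)
  apply le_antisymm
  · rw [hx', CStarSeminorm.norm_mkHom]
    refine CStarSeminorm.sup_le (pointwiseBounded_covariantSeminorms β)
      (CStarSeminorm.nonneg _ _) ?_
    rintro _ ⟨H, i1, i2, i3, R, rfl⟩
    obtain ⟨Θ, hΘ⟩ := R.exists_extension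
    have h1 : R.integratedForm x = Θ.comp Ψ f := by
      rw [← hΘ, ← hx']; rfl
    show ‖R.integratedForm x‖ ≤ _
    rw [h1]
    exact CStarSeminorm.le_sup pointwiseBounded_continuousSeminorms
      (p := CStarSeminorm.ofRepresentation (Θ.comp Ψ))
      ⟨H, _, _, _, Θ.comp Ψ, isInductiveLimitContinuous _, rfl⟩ f
  · refine CStarSeminorm.sup_le pointwiseBounded_continuousSeminorms (norm_nonneg _) ?_
    rintro _ ⟨H, i1, i2, i3, ρ, -, rfl⟩
    obtain ⟨K, j1, j2, j3, σ, hσ, hd⟩ := exists_nondegenerate ρ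
    obtain ⟨R, hR⟩ := hβ.exists_covariantRep hS σ hd
    have h1 : R.integratedForm x = σ f := by
      rw [← hf, hx, map_sum, map_sum]
      exact Finset.sum_congr rfl fun i _ => hR (s i) (g i) (hg i)
    refine (hσ f).trans ?_
    rw [← h1, hx', CStarSeminorm.norm_mkHom]
    exact CStarSeminorm.le_sup (pointwiseBounded_covariantSeminorms β)
      (p := CStarSeminorm.ofRepresentation R.integratedForm) ⟨K, _, _, _, R, rfl⟩ x

theorem IsCanonicalAction.nonempty_starAlgEquiv (hβ : IsCanonicalAction β) (hS : S.IsBase) :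
    Nonempty (GroupoidCStarAlgebra G ≃⋆ₐ[ℂ] β.CrossedProduct) := by
  obtain ⟨Ψ, hΨ⟩ := hβ.exists_toCrossedProduct hS
  refine _root_.nonempty_starAlgEquiv (CStarSeminorm.mkHom _) (CStarSeminorm.denseRange_mkHom _) Ψ
    (hβ.denseRange_toCrossedProduct hΨ) fun f => ?_
  rw [hβ.norm_toCrossedProduct hS hΨ, CStarSeminorm.norm_mkHom]

end Isomorphism

theorem mainTheorem5 (G : Type u) [TopologicalSpace G] [ArrowGroupoid G] [IsRDiscrete G]
    (S : InverseSubsemigroup (OpenGSet G)) :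
    (S.IsFull →
      (∃! β : InverseSemigroupAction S C₀(unitSpace G, ℂ), IsCanonicalAction β) ∧
      ∀ β : InverseSemigroupAction S C₀(unitSpace G, ℂ), IsCanonicalAction β →
        CStarSeminorm.PointwiseBounded (ConvolutionAlgebra.continuousSeminorms G) ∧
        CStarSeminorm.PointwiseBounded β.covariantSeminorms ∧
        Nonempty (GroupoidCStarAlgebra G ≃⋆ₐ[ℂ] β.CrossedProduct)) ∧
    (S.IsAdditive → S.IsFull) :=
  ⟨fun hF => ⟨hF.existsUnique_action, fun β hβ =>
      ⟨ConvolutionAlgebra.pointwiseBounded_continuousSeminorms,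
        InverseSemigroupAction.pointwiseBounded_covariantSeminorms β,
        hβ.nonempty_starAlgEquiv hF.1⟩⟩,
    fun hA => hA.isFull⟩
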